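/- Let $M$ be a smooth closed (compact, connected, without boundary) surface with a smooth hyperbolic Riemannian metric $\sigma$, i.e. one of constant Gaussian curvature $-1$, and let $A$ be the total area of $(M,\sigma)$. Let $[\sigma]_A^{\leqslant}$ be the set of all smooth Riemannian metrics $g$ on $M$ of the form $g=e^{2u}\sigma$, with $u\colon M\to\mathbb{R}$ smooth, whose Gaussian curvature is everywhere $\leqslant 0$ and whose total area is $A$. Write $l_g(\gamma)$ for the $g$-length of a curve $\gamma$. A closed $\sigma$-geodesic is a non-constant smooth closed curve that satisfies the geodesic equation of $\sigma$, parametrized by $\sigma$-arc length; it may be non-simple or multiply traversed. (1) For every $N>0$ there is $\varepsilon=\varepsilon(\sigma,N)>0$ such that, for every closed $\sigma$-geodesic $\gamma$ with $l_\sigma(\gamma)\leqslant N$ and every $g\in[\sigma]_A^{\leqslant}$, $$l_g(\gamma)\geqslant\varepsilon .$$ (2) There is a function $K_4=K_4^{\sigma}\colon\mathbb{R}\to(0,\infty)$ such that, for every closed $\sigma$-geodesic $\gamma$ and every smooth function $u\colon M\to\mathbb{R}$ with $g=e^{2u}\sigma\in[\sigma]_A^{\leqslant}$, $$\int_\gamma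 u\,dl_\sigma\geqslant -K_4\bigl(l_\sigma(\gamma)\bigr).$$ -/

import Mathlib

open scoped Manifold ContDiff NNReal ENNReal

noncomputable section

namespace ConformalSurface

/-- The coordinate plane on which surfaces are modelled. -/
abbrev Plane : Type := EuclideanSpace ℝ (Fin 2)

/-- The coordinate vector `∂ᵢ` of the plane. -/
def coordVec (i : Fin 2) : Plane := EuclideanSpace.single i (1 : ℝ)

/-- The partial derivative `∂ᵢ f` of a function on the plane. -/
def partialDeriv (i : Fin 2) (f : Plane → ℝ) (y : Plane) : ℝ := fderiv ℝ f y (coordVec i)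

variable {M : Type*} [TopologicalSpace M] [ChartedSpace Plane M] [IsManifold (𝓡 2) ∞ M]

variable (M) in
/-- Smooth Riemannian metrics on the surface `M`. -/
abbrev Metric : Type _ :=
  Bundle.ContMDiffRiemannianMetric (𝓡 2) ∞ Plane (fun x : M => TangentSpace (𝓡 2) x)

variable (M) in
/-- The charts of the smooth structure of `M` (all charts of the maximal smooth atlas). -/
abbrev smoothCharts : Set (OpenPartialHomeomorph M Plane) :=
  IsManifold.maximalAtlas (𝓡 2) ∞ M

/-- The matrix `(gᵢⱼ)` of the metric `g` in the chart `e`, as a function of the coordinates `y`. -/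
def gram (g : Metric M) (e : OpenPartialHomeomorph M Plane) (y : Plane) :
    Matrix (Fin 2) (Fin 2) ℝ :=
  Matrix.of fun i j =>
    g.inner (e.symm y) (mfderiv (𝓡 2) (𝓡 2) e.symm y (coordVec i))
      (mfderiv (𝓡 2) (𝓡 2) e.symm y (coordVec j))

/-- The Christoffel symbol
`Γᵏᵢⱼ = ½ ∑ₗ gᵏˡ (∂ᵢ gⱼₗ + ∂ⱼ gᵢₗ - ∂ₗ gᵢⱼ)` of `g` in the chart `e`. -/
def christoffel (g : Metric M) (e : OpenPartialHomeomorph M Plane) (k i j : Fin 2)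
    (y : Plane) : ℝ :=
  (1 / 2) * ∑ l, (gram g e y)⁻¹ k l *
    (partialDeriv i (fun z => gram g e z j l) y + partialDeriv j (fun z => gram g e z i l) y
      - partialDeriv l (fun z => gram g e z i j) y)

/-- The `l`-th component of `R(∂₀, ∂₁) ∂₁ = ∇_{∂₀} ∇_{∂₁} ∂₁ - ∇_{∂₁} ∇_{∂₀} ∂₁` in the
chart `e`. -/
def curvComponent (g : Metric M) (e : OpenPartialHomeomorph M Plane) (l : Fin 2)
    (y : Plane) : ℝ :=
  partialDeriv 0 (christoffel g e l 1 1) y - partialDeriv 1 (christoffel g e l 0 1) y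
    + ∑ m, (christoffel g e l 0 m y * christoffel g e m 1 1 y
      - christoffel g e l 1 m y * christoffel g e m 0 1 y)

/-- The Gaussian curvature `K = ⟨R(∂₀, ∂₁) ∂₁, ∂₀⟩ / (g₀₀ g₁₁ - g₀₁²)` of `g`, computed in the
chart `e`, at the point of `M` with coordinates `y`. -/
def gaussCurvature (g : Metric M) (e : OpenPartialHomeomorph M Plane) (y : Plane) : ℝ :=
  (∑ l, curvComponent g e l y * gram g e y l 0) / (gram g e y).det

/-- Hyperbolic metric: the Gaussian curvature is constant, equal to `-1`. -/
def IsHyperbolic (g : Metric M) : Prop :=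
  ∀ e ∈ smoothCharts M, ∀ y ∈ e.target, gaussCurvature g e y = -1

/-- Nonpositively curved metric: the Gaussian curvature is everywhere at most `0`. -/
def IsNonpositivelyCurved (g : Metric M) : Prop :=
  ∀ e ∈ smoothCharts M, ∀ y ∈ e.target, gaussCurvature g e y ≤ 0

/-- The Riemannian area element `√(det gᵢⱼ) dy` of the chart `e`, as a measure on `M` (it lives
on the domain of `e`). -/
def chartMeasure [MeasurableSpace M] (g : Metric M) (e : OpenPartialHomeomorph M Plane) :
    MeasureTheory.Measure M :=
  MeasureTheory.Measure.map e.symm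
    ((MeasureTheory.volume.restrict e.target).withDensity
      fun y => ENNReal.ofReal (Real.sqrt (gram g e y).det))

/-- The Riemannian measure of `g`. The area elements of the various charts agree on overlaps, and
the Riemannian measure, which is obtained by gluing them, is the least measure that dominates all
of them. -/
def riemannianMeasure [MeasurableSpace M] (g : Metric M) : MeasureTheory.Measure M :=
  ⨆ e ∈ smoothCharts M, chartMeasure g e

/-- The total area of `(M, g)`. -/
def area [MeasurableSpace M] (g : Metric M) : ℝ≥0∞ := riemannianMeasure g Set.univ

/-- The smooth function `u` is the conformal factor of `g` over `σ`: `g = e²ᵘ σ`. -/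
structure IsConformalFactor (σ g : Metric M) (u : M → ℝ) : Prop where
  smooth : ContMDiff (𝓡 2) 𝓘(ℝ, ℝ) ∞ u
  inner_eq : ∀ (x : M) (v w : TangentSpace (𝓡 2) x),
    g.inner x v w = Real.exp (2 * u x) * σ.inner x v w

/-- The class of nonpositively curved smooth metrics of total area `A` that are conformally
equivalent to `σ`. -/
def nonposConformalClass [MeasurableSpace M] (σ : Metric M) (A : ℝ≥0) : Set (Metric M) :=
  {g | (∃ u : M → ℝ, IsConformalFactor σ g u) ∧ IsNonpositivelyCurved g ∧ area g = A}

/-- The velocity `γ'(t)`. -/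
def velocity (γ : ℝ → M) (t : ℝ) : TangentSpace (𝓡 2) (γ t) :=
  mfderiv 𝓘(ℝ, ℝ) (𝓡 2) γ t (1 : ℝ)

/-- The `g`-speed `|γ'(t)|_g`. -/
def speed (g : Metric M) (γ : ℝ → M) (t : ℝ) : ℝ :=
  Real.sqrt (g.inner (γ t) (velocity γ t) (velocity γ t))

/-- The `g`-length of the curve `γ` over `[0, T]`. -/
def length (g : Metric M) (γ : ℝ → M) (T : ℝ) : ℝ := ∫ t in (0 : ℝ)..T, speed g γ t

/-- The integral of the function `u` along the curve `γ` over `[0, T]`, with respect to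
`g`-length. -/
def lineIntegral (g : Metric M) (γ : ℝ → M) (T : ℝ) (u : M → ℝ) : ℝ :=
  ∫ t in (0 : ℝ)..T, u (γ t) * speed g γ t

/-- A closed `g`-geodesic: a smooth curve parametrized by `g`-arc length, periodic with
period `T > 0` (not necessarily the least one), that satisfies the geodesic equation
`(xᵏ)'' + ∑ᵢⱼ Γᵏᵢⱼ (xⁱ)' (xʲ)' = 0` in every chart. The closed curve that is meant is `γ`
traversed once over `[0, T]`. -/
structure IsClosedGeodesic (g : Metric M) (γ : ℝ → M) (T : ℝ) : Prop where
  smooth : ContMDiff 𝓘(ℝ, ℝ) (𝓡 2) ∞ γ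
  period_pos : 0 < T
  periodic : Function.Periodic γ T
  unit_speed : ∀ t, speed g γ t = 1
  geodesic_eq : ∀ e ∈ smoothCharts M, ∀ t, γ t ∈ e.source → ∀ k : Fin 2,
    deriv (deriv fun s => e (γ s) k) t
      + ∑ i, ∑ j, christoffel g e k i j (e (γ t))
          * deriv (fun s => e (γ s) i) t * deriv (fun s => e (γ s) j) t = 0

end ConformalSurface

end

/-!
Let `g = e²ᵘ σ` be nonpositively curved, with the area of the hyperbolic metric `σ`, and let
`v = max u - u ≥ 0`. Since the curvature of `σ` is `-1`, nonpositive curvature of `g` means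
`Δ_σ u ≥ -1`, that is `Δ_σ v ≤ 1` (`neg_sqrt_det_le_divOp`), and since the areas agree, `max u ≥ 0`
(`conformalFactor_bound_nonneg`). So it suffices to bound `∫_γ v` for a closed geodesic `γ` in terms
of its length `T`, uniformly in `v`: this gives `∫_γ u ≥ -C (1 + T)`, which is the second claim
(`exists_le_integral_conformalFactor`). The first claim follows by Jensen's inequality
(`mul_exp_average_le`), because `T` is bounded below.

The only information on `v` is that it is a nonnegative supersolution, up to a constant, that
vanishes somewhere (`IsConformalDefect`). Everything is done in charts in which `σ` is a multiple of
a nearly Euclidean metric (`IsFlatChart`); the Laplace operator being conformally invariant, its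
divergence form `∂ᵢ (√(det σ) σⁱʲ ∂ⱼ)` is then close to the flat one at every scale (`NearlyFlat`).

* *Weak Harnack inequality.* Testing `Δ v ≤ 1` against a compactly supported function with a
  mollified pole (`poleBump`), which is subharmonic outside a small ball, strictly so up to
  distance `3` from the pole, bounds the integral of `v` over the ball of radius `3` by its integral
  over the small ball
  (`exists_integral_closedBall_le`), or by a constant if `v` vanishes at the centre
  (`exists_integral_closedBall_le_of_zero`). By compactness and connectedness, the mass of `v` in
  each chart of a finite atlas is therefore bounded (`exists_flatAtlas`): start from the chart that
  contains a zero of `v`, and pass from chart to chart through overlaps.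
* *Restriction to curves.* Near a curve that is the graph of a `C²` function `h`, use the test
  function `p(x) q(y - h(x))`, with a cut-off `p` and with `q` a cut-off of `s ↦ √(s² + ε²)`, whose second
  derivative is of order `1 / ε` in the `ε`-strip around the graph and bounded below elsewhere. This
  bounds the mass of `v` in the strip by `C ε` times one plus the mass of `v` in the chart; letting
  the strip shrink bounds the integral of `v` over the graph (`exists_integral_graph_le`).
* *Geodesics.* In a nearly flat chart the Christoffel symbols are tiny, so over a definite length a
  geodesic is an embedded curve that is such a graph over a coordinate axis
  (`IsFlatChart.isTameCurve`, `IsTameCurve.exists_isTameGraph`). Hence closed geodesics have length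
  bounded below, and adding up the pieces gives `∫_γ v ≤ C (1 + T)`
  (`exists_integral_closedGeodesic_le`).
-/

noncomputable section

open scoped Topology
open Bundle Set Filter MeasureTheory Metric

set_option linter.unusedSectionVars false

namespace ConformalSurface

variable {M : Type*} [TopologicalSpace M] [ChartedSpace Plane M] [IsManifold (𝓡 2) ∞ M]


/-! ### The metric in a chart -/

theorem contMDiffOn_chart_symm {e : OpenPartialHomeomorph M Plane} (he : e ∈ smoothCharts M) :
    ContMDiffOn (𝓡 2) (𝓡 2) ∞ e.symm e.target := contMDiffOn_symm_of_mem_maximalAtlas he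

theorem contMDiffOn_chart {e : OpenPartialHomeomorph M Plane} (he : e ∈ smoothCharts M) :
    ContMDiffOn (𝓡 2) (𝓡 2) ∞ e e.source := contMDiffOn_of_mem_maximalAtlas he

theorem contMDiffOn_coordField {e : OpenPartialHomeomorph M Plane} (he : e ∈ smoothCharts M)
    (c : Plane) :
    ContMDiffOn (𝓡 2) (𝓡 2).tangent ∞
      (fun y => (⟨e.symm y, mfderiv (𝓡 2) (𝓡 2) e.symm y c⟩ : TangentBundle (𝓡 2) M)) e.target := by
  have h := ContMDiffOn.contMDiffOn_tangentMapWithin (m := ∞) (contMDiffOn_chart_symm he)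
    (by simp) e.open_target.uniqueMDiffOn
  have hc : ContMDiffOn (𝓡 2) (𝓡 2).tangent ∞
      (fun y : Plane => (⟨y, c⟩ : TangentBundle (𝓡 2) Plane)) e.target := by
    apply ContMDiff.contMDiffOn
    exact contMDiff_vectorSpace_iff_contDiff.2 contDiff_const
  have := h.comp hc (fun y hy => hy)
  refine this.congr ?_
  intro y hy
  simp only [Function.comp, tangentMapWithin]
  rw [mfderivWithin_of_isOpen e.open_target hy]

theorem contDiffOn_gram (g : Metric M) {e : OpenPartialHomeomorph M Plane}
    (he : e ∈ smoothCharts M) (i j : Fin 2) :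
    ContDiffOn ℝ ∞ (fun y => gram g e y i j) e.target := by
  rw [← contMDiffOn_iff_contDiffOn]
  intro y hy
  have : ContMDiffWithinAt (𝓡 2) ((𝓡 2).prod 𝓘(ℝ)) ∞
      (fun m ↦ TotalSpace.mk' ℝ (E := Bundle.Trivial M ℝ) (e.symm m)
        (g.inner (e.symm m) (mfderiv (𝓡 2) (𝓡 2) e.symm m (coordVec i))
      (mfderiv (𝓡 2) (𝓡 2) e.symm m (coordVec j)))) e.target y := by
    apply ContMDiffWithinAt.clm_bundle_apply₂ (F₁ := Plane) (F₂ := Plane)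
    · exact ContMDiffAt.comp_contMDiffWithinAt y g.contMDiff.contMDiffAt
        (contMDiffOn_chart_symm he y hy)
    · exact contMDiffOn_coordField he _ y hy
    · exact contMDiffOn_coordField he _ y hy
  simp only [contMDiffWithinAt_totalSpace] at this
  exact this.2

theorem eq_sum_coordVec (c : Plane) : c = ∑ i, c i • coordVec i := by
  ext k
  fin_cases k <;> simp [coordVec]

/-- The scalar product of the metric at a point, with the tangent space identified with the
plane (which it is by definition). -/
def form (g : Metric M) (q : M) : Plane →L[ℝ] Plane →L[ℝ] ℝ := g.inner q

/-- The differential of the inverse of a chart, with the tangent spaces identified with the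
plane. -/
def symmDeriv (e : OpenPartialHomeomorph M Plane) (y : Plane) : Plane →L[ℝ] Plane :=
  mfderiv (𝓡 2) (𝓡 2) e.symm y

theorem gram_eq_form (g : Metric M) (e : OpenPartialHomeomorph M Plane) (y : Plane) (i j : Fin 2) :
    gram g e y i j = form g (e.symm y) (symmDeriv e y (coordVec i)) (symmDeriv e y (coordVec j)) :=
  rfl

theorem form_symmDeriv (g : Metric M) (e : OpenPartialHomeomorph M Plane) (y c d : Plane) :
    form g (e.symm y) (symmDeriv e y c) (symmDeriv e y d)
      = ∑ i, ∑ j, c i * d j * gram g e y i j := by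
  conv_lhs => rw [eq_sum_coordVec c, eq_sum_coordVec d]
  simp only [gram_eq_form]
  generalize symmDeriv e y = L
  generalize form g (e.symm y) = B
  simp only [map_add, map_smul, smul_apply, Fin.sum_univ_two, smul_eq_mul, add_apply]
  ring

theorem gram_symm (g : Metric M) (e : OpenPartialHomeomorph M Plane) (y : Plane) (i j : Fin 2) :
    gram g e y i j = gram g e y j i := g.symm _ _ _

theorem mdifferentiableAt_chart_symm {e : OpenPartialHomeomorph M Plane} (he : e ∈ smoothCharts M)
    {y : Plane} (hy : y ∈ e.target) : MDifferentiableAt (𝓡 2) (𝓡 2) e.symm y :=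
  ((contMDiffOn_chart_symm he).contMDiffAt (e.open_target.mem_nhds hy)).mdifferentiableAt
    (by simp)

theorem mdifferentiableAt_chart {e : OpenPartialHomeomorph M Plane} (he : e ∈ smoothCharts M)
    {q : M} (hq : q ∈ e.source) : MDifferentiableAt (𝓡 2) (𝓡 2) e q :=
  ((contMDiffOn_chart he).contMDiffAt (e.open_source.mem_nhds hq)).mdifferentiableAt
    (by simp)

theorem symmDeriv_injective {e : OpenPartialHomeomorph M Plane} (he : e ∈ smoothCharts M)
    {y : Plane} (hy : y ∈ e.target) {c : Plane} (hc : symmDeriv e y c = 0) : c = 0 := by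
  have h1 := mfderiv_comp (I := 𝓡 2) (I' := 𝓡 2) (I'' := 𝓡 2) y
    (mdifferentiableAt_chart he (e.map_target hy)) (mdifferentiableAt_chart_symm he hy)
  have h2 : mfderiv (𝓡 2) (𝓡 2) (e ∘ e.symm) y = mfderiv (𝓡 2) (𝓡 2) (id : Plane → Plane) y := by
    apply Filter.EventuallyEq.mfderiv_eq
    filter_upwards [e.open_target.mem_nhds hy] with z hz using e.right_inv hz
  rw [h2, mfderiv_id] at h1
  have h3 : c = (mfderiv (𝓡 2) (𝓡 2) e (e.symm y) : Plane →L[ℝ] Plane) (symmDeriv e y c) :=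
    congrArg (fun L : Plane →L[ℝ] Plane => L c) h1
  have h4 : ∀ L : Plane →L[ℝ] Plane, L 0 = 0 := fun L => map_zero L
  rw [h3, hc]
  exact h4 _

theorem gram_quadratic_pos (g : Metric M) {e : OpenPartialHomeomorph M Plane}
    (he : e ∈ smoothCharts M) {y : Plane} (hy : y ∈ e.target) {c : Plane} (hc : c ≠ 0) :
    0 < ∑ i, ∑ j, c i * c j * gram g e y i j := by
  rw [← form_symmDeriv]
  exact g.pos _ _ fun h => hc (symmDeriv_injective he hy h)

theorem gram_det_pos (g : Metric M) {e : OpenPartialHomeomorph M Plane}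
    (he : e ∈ smoothCharts M) {y : Plane} (hy : y ∈ e.target) : 0 < (gram g e y).det := by
  have h0 := gram_quadratic_pos g he hy (c := !₂[1, 0]) (by
    intro h; have := congrArg (fun v : Plane => v 0) h; simp at this)
  have h1 := gram_quadratic_pos g he hy (c := !₂[-gram g e y 0 1, gram g e y 0 0]) (by
    intro h; have := congrArg (fun v : Plane => v 1) h; simp at this; simp [this] at h0)
  simp only [Fin.sum_univ_two, Matrix.cons_val_zero, Matrix.cons_val_one,
    Matrix.cons_val_fin_one] at h0 h1
  rw [gram_symm g e y 1 0] at h1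
  rw [Matrix.det_fin_two, gram_symm g e y 1 0]
  by_contra hcon
  push Not at hcon
  nlinarith

theorem gram_diag_pos (g : Metric M) {e : OpenPartialHomeomorph M Plane}
    (he : e ∈ smoothCharts M) {y : Plane} (hy : y ∈ e.target) (i : Fin 2) :
    0 < gram g e y i i := by
  have h0 := gram_quadratic_pos g he hy (c := coordVec i) (by
    intro h; have := congrArg (fun v : Plane => v i) h; simp [coordVec] at this)
  fin_cases i <;> simpa [coordVec, Fin.sum_univ_two] using h0

/-! ### Curves in a chart -/

theorem symmDeriv_deriv_eq_velocity {γ : ℝ → M} (hγ : ContMDiff 𝓘(ℝ, ℝ) (𝓡 2) ∞ γ)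
    {e : OpenPartialHomeomorph M Plane} (he : e ∈ smoothCharts M) {t : ℝ} (ht : γ t ∈ e.source) :
    symmDeriv e (e (γ t)) (deriv (fun s => e (γ s)) t) = (velocity γ t : Plane) := by
  have hγt : MDifferentiableAt 𝓘(ℝ, ℝ) (𝓡 2) γ t := hγ.mdifferentiableAt (by simp)
  have hcomp : MDifferentiableAt 𝓘(ℝ, ℝ) (𝓡 2) (fun s => e (γ s)) t :=
    (mdifferentiableAt_chart he ht).comp t hγt
  have hsymm : MDifferentiableAt (𝓡 2) (𝓡 2) e.symm (e (γ t)) :=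
    mdifferentiableAt_chart_symm he (e.map_source ht)
  have h1 := mfderiv_comp (I := 𝓘(ℝ, ℝ)) (I' := 𝓡 2) (I'' := 𝓡 2) t hsymm hcomp
  have h2 : (e.symm ∘ fun s => e (γ s)) =ᶠ[𝓝 t] γ := by
    filter_upwards [hγ.continuous.continuousAt.preimage_mem_nhds (e.open_source.mem_nhds ht)]
      with s hs using e.left_inv hs
  have h3 := h2.mfderiv_eq (I := 𝓘(ℝ, ℝ)) (I' := 𝓡 2)
  have h5 := congrArg (fun L : ℝ →L[ℝ] Plane => L 1) (h1.symm.trans h3)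
  refine Eq.trans ?_ h5
  have h4 : (mfderiv 𝓘(ℝ, ℝ) (𝓡 2) (fun s => e (γ s)) t : ℝ →L[ℝ] Plane) 1
      = deriv (fun s => e (γ s)) t := by
    rw [mfderiv_eq_fderiv]; rfl
  exact congrArg (symmDeriv e (e (γ t))) h4.symm

theorem speed_eq (g : Metric M) {γ : ℝ → M} (hγ : ContMDiff 𝓘(ℝ, ℝ) (𝓡 2) ∞ γ)
    {e : OpenPartialHomeomorph M Plane} (he : e ∈ smoothCharts M) {t : ℝ} (ht : γ t ∈ e.source) :
    speed g γ t = √(∑ i, ∑ j, deriv (fun s => e (γ s)) t i * deriv (fun s => e (γ s)) t j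
        * gram g e (e (γ t)) i j) := by
  rw [← form_symmDeriv, symmDeriv_deriv_eq_velocity hγ he ht, e.left_inv ht]
  rfl

theorem contDiffAt_chart_comp {γ : ℝ → M} (hγ : ContMDiff 𝓘(ℝ, ℝ) (𝓡 2) ∞ γ)
    {e : OpenPartialHomeomorph M Plane} (he : e ∈ smoothCharts M) {t : ℝ} (ht : γ t ∈ e.source) :
    ContDiffAt ℝ ∞ (fun s => e (γ s)) t := by
  rw [← contMDiffAt_iff_contDiffAt]
  exact ((contMDiffOn_chart he).contMDiffAt (e.open_source.mem_nhds ht)).comp t hγ.contMDiffAt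

/-! ### Partial derivatives and divergence form operators in the plane -/

theorem partialDeriv_congr {i : Fin 2} {f g : Plane → ℝ} {y : Plane} (h : f =ᶠ[𝓝 y] g) :
    partialDeriv i f y = partialDeriv i g y := by
  rw [partialDeriv, partialDeriv, h.fderiv_eq]

theorem partialDeriv_add {i : Fin 2} {f g : Plane → ℝ} {y : Plane} (hf : DifferentiableAt ℝ f y)
    (hg : DifferentiableAt ℝ g y) :
    partialDeriv i (fun z => f z + g z) y = partialDeriv i f y + partialDeriv i g y := by
  simp only [partialDeriv]
  rw [fderiv_fun_add hf hg]; rfl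

theorem partialDeriv_sub {i : Fin 2} {f g : Plane → ℝ} {y : Plane} (hf : DifferentiableAt ℝ f y)
    (hg : DifferentiableAt ℝ g y) :
    partialDeriv i (fun z => f z - g z) y = partialDeriv i f y - partialDeriv i g y := by
  simp only [partialDeriv]
  rw [fderiv_fun_sub hf hg]; rfl

theorem partialDeriv_const_sub {i : Fin 2} {f : Plane → ℝ} {y : Plane} (c : ℝ) :
    partialDeriv i (fun z => c - f z) y = - partialDeriv i f y := by
  simp only [partialDeriv]
  rw [fderiv_const_sub]; rfl

theorem partialDeriv_mul {i : Fin 2} {f g : Plane → ℝ} {y : Plane} (hf : DifferentiableAt ℝ f y)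
    (hg : DifferentiableAt ℝ g y) :
    partialDeriv i (fun z => f z * g z) y
      = partialDeriv i f y * g y + f y * partialDeriv i g y := by
  simp only [partialDeriv]
  rw [fderiv_fun_mul hf hg]
  simp only [add_apply, smul_apply, smul_eq_mul]
  ring

theorem partialDeriv_const {i : Fin 2} {y : Plane} (c : ℝ) :
    partialDeriv i (fun _ => c) y = 0 := by
  simp [partialDeriv]

theorem partialDeriv_comp {i : Fin 2} {f : Plane → ℝ} {y : Plane} {F : ℝ → ℝ} {F' : ℝ}
    (hF : HasDerivAt F F' (f y)) (hf : DifferentiableAt ℝ f y) :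
    partialDeriv i (fun z => F (f z)) y = F' * partialDeriv i f y := by
  simp only [partialDeriv]
  have h : HasFDerivAt (fun z => F (f z)) (F' • fderiv ℝ f y) y :=
    hF.comp_hasFDerivAt y hf.hasFDerivAt
  rw [h.fderiv]
  simp

theorem contDiffAt_partialDeriv {n m : WithTop ℕ∞} {f : Plane → ℝ} {y : Plane}
    (hf : ContDiffAt ℝ n f y) (hmn : m + 1 ≤ n) (i : Fin 2) :
    ContDiffAt ℝ m (partialDeriv i f) y :=
  (hf.fderiv_right hmn).clm_apply contDiffAt_const

theorem partialDeriv_comm {f : Plane → ℝ} {y : Plane} (hf : ContDiffAt ℝ 2 f y) (i j : Fin 2) :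
    partialDeriv i (partialDeriv j f) y = partialDeriv j (partialDeriv i f) y := by
  have h1 : DifferentiableAt ℝ (fderiv ℝ f) y :=
    (hf.fderiv_right (m := 1) (by norm_num)).differentiableAt (by norm_num)
  have h2 : ∀ i j, partialDeriv i (partialDeriv j f) y
      = fderiv ℝ (fderiv ℝ f) y (coordVec i) (coordVec j) := by
    intro i j
    change fderiv ℝ (fun z => fderiv ℝ f z (coordVec j)) y (coordVec i) = _
    rw [fderiv_clm_apply h1 (differentiableAt_const _)]
    simp
  rw [h2, h2]
  exact hf.isSymmSndFDerivAt (by simp) (coordVec i) (coordVec j)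

theorem hasFDerivAt_coord (k : Fin 2) (y : Plane) :
    HasFDerivAt (fun z : Plane => z k) (EuclideanSpace.proj k : Plane →L[ℝ] ℝ) y :=
  (EuclideanSpace.proj k : Plane →L[ℝ] ℝ).hasFDerivAt

theorem contDiff_coord {n : WithTop ℕ∞} (k : Fin 2) : ContDiff ℝ n (fun z : Plane => z k) :=
  (EuclideanSpace.proj k : Plane →L[ℝ] ℝ).contDiff

theorem partialDeriv_coord (i k : Fin 2) (y : Plane) :
    partialDeriv i (fun z : Plane => z k) y = if k = i then 1 else 0 := by
  rw [partialDeriv, (hasFDerivAt_coord k y).fderiv]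
  simp [coordVec]

/-- The operator `f ↦ ∑ᵢ ∂ᵢ (∑ⱼ aᵢⱼ ∂ⱼ f)` in divergence form with coefficients `a`. -/
def divOp (a : Plane → Matrix (Fin 2) (Fin 2) ℝ) (f : Plane → ℝ) (y : Plane) : ℝ :=
  ∑ i, partialDeriv i (fun z => ∑ j, a z i j * partialDeriv j f z) y

theorem divOp_congr {a : Plane → Matrix (Fin 2) (Fin 2) ℝ} {f g : Plane → ℝ} {y : Plane}
    (h : f =ᶠ[𝓝 y] g) : divOp a f y = divOp a g y := by
  refine Finset.sum_congr rfl fun i _ => partialDeriv_congr ?_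
  filter_upwards [h.eventuallyEq_nhds] with z hz
  simp only [partialDeriv_congr hz]

theorem divOp_apply {a : Plane → Matrix (Fin 2) (Fin 2) ℝ} {f : Plane → ℝ} {y : Plane}
    (ha : ∀ i j, DifferentiableAt ℝ (fun z => a z i j) y) (hf : ContDiffAt ℝ 2 f y) :
    divOp a f y = ∑ i, ∑ j, (partialDeriv i (fun z => a z i j) y * partialDeriv j f y
      + a y i j * partialDeriv i (partialDeriv j f) y) := by
  have h : ∀ j, DifferentiableAt ℝ (partialDeriv j f) y := fun j =>
    (contDiffAt_partialDeriv hf (m := 1) (by norm_num) j).differentiableAt (by norm_num)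
  refine Finset.sum_congr rfl fun i _ => ?_
  simp only [Fin.sum_univ_two]
  rw [partialDeriv_add ((ha i 0).fun_mul (h 0)) ((ha i 1).fun_mul (h 1)),
    partialDeriv_mul (ha i 0) (h 0), partialDeriv_mul (ha i 1) (h 1)]

theorem divOp_mul {a : Plane → Matrix (Fin 2) (Fin 2) ℝ} {f g : Plane → ℝ} {y : Plane}
    (ha : ∀ i j, DifferentiableAt ℝ (fun z => a z i j) y) (hf : ContDiffAt ℝ 2 f y)
    (hg : ContDiffAt ℝ 2 g y) :
    divOp a (fun z => f z * g z) y = f y * divOp a g y + g y * divOp a f y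
      + ∑ i, ∑ j, a y i j * (partialDeriv i f y * partialDeriv j g y
        + partialDeriv i g y * partialDeriv j f y) := by
  have h1 : ∀ j, DifferentiableAt ℝ (partialDeriv j f) y := fun j =>
    (contDiffAt_partialDeriv hf (m := 1) (by norm_num) j).differentiableAt (by norm_num)
  have h2 : ∀ j, DifferentiableAt ℝ (partialDeriv j g) y := fun j =>
    (contDiffAt_partialDeriv hg (m := 1) (by norm_num) j).differentiableAt (by norm_num)
  have hfd := hf.differentiableAt (by norm_num)
  have hgd := hg.differentiableAt (by norm_num)
  have h3 : ∀ j, partialDeriv j (fun z => f z * g z) =ᶠ[𝓝 y]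
      fun z => partialDeriv j f z * g z + f z * partialDeriv j g z := by
    intro j
    filter_upwards [hf.eventually (by simp), hg.eventually (by simp)] with z hz hz'
    exact partialDeriv_mul (hz.differentiableAt (by norm_num)) (hz'.differentiableAt (by norm_num))
  have h4 : ∀ i j, partialDeriv i (partialDeriv j (fun z => f z * g z)) y
      = partialDeriv i (partialDeriv j f) y * g y + partialDeriv j f y * partialDeriv i g y
        + (partialDeriv i f y * partialDeriv j g y + f y * partialDeriv i (partialDeriv j g) y) := by
    intro i j
    rw [partialDeriv_congr (h3 j), partialDeriv_add ((h1 j).fun_mul hgd) (hfd.fun_mul (h2 j)),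
      partialDeriv_mul (h1 j) hgd, partialDeriv_mul hfd (h2 j)]
  rw [divOp_apply ha (hf.mul hg), divOp_apply ha hf, divOp_apply ha hg]
  simp only [h4, fun j => (h3 j).eq_of_nhds, Fin.sum_univ_two]
  ring

theorem divOp_comp {a : Plane → Matrix (Fin 2) (Fin 2) ℝ} {f : Plane → ℝ} {y : Plane}
    (ha : ∀ i j, DifferentiableAt ℝ (fun z => a z i j) y) (hf : ContDiffAt ℝ 2 f y)
    {F F₁ : ℝ → ℝ} {F₂ : ℝ} (hF : ∀ᶠ s in 𝓝 (f y), HasDerivAt F (F₁ s) s)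
    (hF₁ : HasDerivAt F₁ F₂ (f y)) (hFc : ContDiffAt ℝ 2 F (f y)) :
    divOp a (fun z => F (f z)) y = F₁ (f y) * divOp a f y
      + F₂ * ∑ i, ∑ j, a y i j * partialDeriv i f y * partialDeriv j f y := by
  have h1 : ∀ j, DifferentiableAt ℝ (partialDeriv j f) y := fun j =>
    (contDiffAt_partialDeriv hf (m := 1) (by norm_num) j).differentiableAt (by norm_num)
  have hfd := hf.differentiableAt (by norm_num)
  have h3 : ∀ j, partialDeriv j (fun z => F (f z)) =ᶠ[𝓝 y]
      fun z => F₁ (f z) * partialDeriv j f z := by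
    intro j
    filter_upwards [hf.eventually (by simp), hf.continuousAt.eventually hF] with z hz hz'
    exact partialDeriv_comp hz' (hz.differentiableAt (by norm_num))
  have h4 : ∀ i j, partialDeriv i (partialDeriv j (fun z => F (f z))) y
      = F₂ * partialDeriv i f y * partialDeriv j f y
        + F₁ (f y) * partialDeriv i (partialDeriv j f) y := by
    intro i j
    rw [partialDeriv_congr (h3 j), partialDeriv_mul
      (hF₁.differentiableAt.fun_comp' y hfd) (h1 j), partialDeriv_comp hF₁ hfd]
  have h5 : ContDiffAt ℝ 2 (fun z => F (f z)) y := ContDiffAt.comp y hFc hf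
  rw [divOp_apply ha h5, divOp_apply ha hf]
  simp only [h4, fun j => (h3 j).eq_of_nhds, Fin.sum_univ_two]
  ring

theorem divOp_const_sub {a : Plane → Matrix (Fin 2) (Fin 2) ℝ} {f : Plane → ℝ} {y : Plane}
    (c : ℝ) : divOp a (fun z => c - f z) y = - divOp a f y := by
  have h : ∀ i : Fin 2, partialDeriv i (fun z => ∑ j, a z i j * -partialDeriv j f z) y
      = - partialDeriv i (fun z => ∑ j, a z i j * partialDeriv j f z) y := by
    intro i
    simp only [mul_neg, Finset.sum_neg_distrib, partialDeriv]
    rw [fderiv_fun_neg]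
    rfl
  simp only [divOp, partialDeriv_const_sub, h, Finset.sum_neg_distrib]

/-! ### Green's identity -/

theorem contDiff_of_contDiffAt_tsupport {n : WithTop ℕ∞} {f : Plane → ℝ}
    (hf : ∀ y ∈ tsupport f, ContDiffAt ℝ n f y) : ContDiff ℝ n f := by
  refine contDiff_iff_contDiffAt.2 fun y => ?_
  by_cases hy : y ∈ tsupport f
  · exact hf y hy
  · exact contDiffAt_const.congr_of_eventuallyEq (notMem_tsupport_iff_eventuallyEq.1 hy)

theorem integral_partialDeriv_eq_zero {X : Plane → ℝ} (hX : ContDiff ℝ 1 X)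
    (hc : HasCompactSupport X) (i : Fin 2) : ∫ y, partialDeriv i X y = 0 := by
  have hd : Differentiable ℝ X := hX.differentiable (by norm_num)
  have hcont : Continuous (fun y => fderiv ℝ X y (coordVec i)) :=
    (hX.continuous_fderiv (by norm_num)).clm_apply continuous_const
  have hint : Integrable (fun y => fderiv ℝ X y (coordVec i)) := by
    refine hcont.integrable_of_hasCompactSupport ?_
    exact (hc.fderiv_apply (𝕜 := ℝ) _)
  have h := integral_mul_fderiv_eq_neg_fderiv_mul_of_integrable (𝕜 := ℝ) (μ := volume)
    (f := fun _ : Plane => (1 : ℝ)) (g := X) (v := coordVec i) (by simp)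
    (by simpa using hint) (by simpa using hX.continuous.integrable_of_hasCompactSupport hc)
    (fun y _ => differentiableAt_const _) (fun y _ => hd y)
  simpa [partialDeriv] using h

/-- Green's identity: `∫ φ L f = ∫ f L φ` for a compactly supported test function `φ`. -/
theorem integral_mul_divOp_comm {a : Plane → Matrix (Fin 2) (Fin 2) ℝ} {f φ : Plane → ℝ}
    (hφ : ContDiff ℝ 2 φ) (hc : HasCompactSupport φ)
    (ha : ∀ y ∈ tsupport φ, ∀ i j, ContDiffAt ℝ 1 (fun z => a z i j) y)
    (hsymm : ∀ y, ∀ i j, a y i j = a y j i)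
    (hf : ∀ y ∈ tsupport φ, ContDiffAt ℝ 2 f y) :
    Integrable (fun y => f y * divOp a φ y) ∧ Integrable (fun y => φ y * divOp a f y) ∧
    ∫ y, f y * divOp a φ y = ∫ y, φ y * divOp a f y := by
  set A : (Plane → ℝ) → Fin 2 → Plane → ℝ := fun h i z => ∑ j, a z i j * partialDeriv j h z
  have hA : ∀ h : Plane → ℝ, ∀ y ∈ tsupport φ, ContDiffAt ℝ 2 h y → ∀ i,
      ContDiffAt ℝ 1 (A h i) y := by
    intro h y hy hh i
    refine ContDiffAt.sum fun j _ => (ha y hy i j).mul ?_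
    exact contDiffAt_partialDeriv hh (by norm_num) j
  have hd : ∀ h : Plane → ℝ, ∀ y ∈ tsupport φ, ContDiffAt ℝ 2 h y →
      ContDiffAt ℝ 0 (divOp a h) y := by
    intro h y hy hh
    exact ContDiffAt.sum fun i _ => contDiffAt_partialDeriv (hA h y hy hh i) (by norm_num) i
  have hzero : ∀ y ∉ tsupport φ, φ =ᶠ[𝓝 y] fun _ => 0 := fun y hy =>
    notMem_tsupport_iff_eventuallyEq.1 hy
  have hpd : ∀ y ∉ tsupport φ, ∀ j, partialDeriv j φ y = 0 := fun y hy j => by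
    rw [partialDeriv_congr (hzero y hy), partialDeriv_const]
  have hdiv : ∀ y ∉ tsupport φ, divOp a φ y = 0 := fun y hy => by
    rw [divOp_congr (hzero y hy)]
    simp [divOp, partialDeriv_const]
  -- the vector field `φ a∇f - f a∇φ`
  set X : Fin 2 → Plane → ℝ := fun i z => φ z * A f i z - f z * A φ i z
  have hsub : ∀ h : Plane → ℝ, (∀ y ∉ tsupport φ, h y = 0) → tsupport h ⊆ tsupport φ := by
    intro h hh
    refine closure_minimal (fun y hy => ?_) (isClosed_tsupport φ)
    by_contra hcon
    exact hy (hh y hcon)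
  have hcs : ∀ h : Plane → ℝ, (∀ y ∉ tsupport φ, h y = 0) → HasCompactSupport h := fun h hh =>
    hc.of_isClosed_subset (isClosed_tsupport h) (hsub h hh)
  have hXz : ∀ i, ∀ y ∉ tsupport φ, X i y = 0 := by
    intro i y hy
    simp [X, A, hpd y hy, (hzero y hy).eq_of_nhds]
  have hX : ∀ i, ContDiff ℝ 1 (X i) := by
    intro i
    refine contDiff_of_contDiffAt_tsupport fun y hy => ?_
    have hy' := hsub _ (hXz i) hy
    exact ((hφ.contDiffAt.of_le (by norm_num)).mul (hA f y hy' (hf y hy') i)).sub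
      (((hf y hy').of_le (by norm_num)).mul (hA φ y hy' hφ.contDiffAt i))
  have hz1 : ∀ y ∉ tsupport φ, f y * divOp a φ y = 0 := fun y hy => by rw [hdiv y hy, mul_zero]
  have hz2 : ∀ y ∉ tsupport φ, φ y * divOp a f y = 0 := fun y hy => by
    rw [(hzero y hy).eq_of_nhds, zero_mul]
  have hc1 : Continuous (fun y => f y * divOp a φ y) := by
    rw [← contDiff_zero (𝕜 := ℝ)]
    refine contDiff_of_contDiffAt_tsupport fun y hy => ?_
    have hy' := hsub _ hz1 hy
    exact ((hf y hy').of_le (by norm_num)).mul (hd φ y hy' hφ.contDiffAt)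
  have hc2 : Continuous (fun y => φ y * divOp a f y) := by
    rw [← contDiff_zero (𝕜 := ℝ)]
    refine contDiff_of_contDiffAt_tsupport fun y hy => ?_
    have hy' := hsub _ hz2 hy
    exact (hφ.contDiffAt.of_le (by norm_num)).mul (hd f y hy' (hf y hy'))
  have hi1 := hc1.integrable_of_hasCompactSupport (μ := volume) (hcs _ hz1)
  have hi2 := hc2.integrable_of_hasCompactSupport (μ := volume) (hcs _ hz2)
  refine ⟨hi1, hi2, ?_⟩
  have hkey : ∀ y, φ y * divOp a f y - f y * divOp a φ y = ∑ i, partialDeriv i (X i) y := by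
    intro y
    by_cases hy : y ∈ tsupport φ
    · have hfd := (hf y hy).differentiableAt (by norm_num)
      have hφd := (hφ.contDiffAt (x := y)).differentiableAt (by norm_num)
      have e : ∀ i, partialDeriv i (X i) y =
          partialDeriv i φ y * A f i y + φ y * partialDeriv i (A f i) y
          - (partialDeriv i f y * A φ i y + f y * partialDeriv i (A φ i) y) := by
        intro i
        have h1 := (hA f y hy (hf y hy) i).differentiableAt (by norm_num)
        have h2 := (hA φ y hy hφ.contDiffAt i).differentiableAt (by norm_num)
        rw [partialDeriv_sub (hφd.fun_mul h1) (hfd.fun_mul h2), partialDeriv_mul hφd h1,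
          partialDeriv_mul hfd h2]
      simp only [e, Fin.sum_univ_two, divOp, A]
      rw [hsymm y 1 0]
      ring
    · rw [hz1 y hy, hz2 y hy]
      have e : ∀ i, X i =ᶠ[𝓝 y] fun _ => 0 := by
        intro i
        exact notMem_tsupport_iff_eventuallyEq.1 fun h => hy (hsub _ (hXz i) h)
      simp [fun i => partialDeriv_congr (i := i) (e i), partialDeriv_const]
  have h1 : ∫ y, (φ y * divOp a f y - f y * divOp a φ y) = 0 := by
    simp only [hkey, Fin.sum_univ_two]
    rw [integral_add, integral_partialDeriv_eq_zero (hX 0) (hcs _ (hXz 0)),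
      integral_partialDeriv_eq_zero (hX 1) (hcs _ (hXz 1)), add_zero]
    all_goals
      refine Continuous.integrable_of_hasCompactSupport ?_ ((hcs _ (hXz _)).fderiv_apply (𝕜 := ℝ) _)
      exact ((hX _).continuous_fderiv (by norm_num)).clm_apply continuous_const
  rw [integral_sub hi2 hi1] at h1
  linarith

/-! ### Conformal change of the curvature -/

/-- The algebra behind the conformal change of the Gaussian curvature. Here `g`, `dg` are the metric
and its first derivatives, `Γ` its Christoffel symbols, `U` the gradient of the conformal factor,
`u` and `p` its first and second derivatives, and `S` is the difference of the Christoffel symbols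
of the two metrics. -/
theorem conformal_curvature_algebra (g : Fin 2 → Fin 2 → ℝ) (Γ : Fin 2 → Fin 2 → Fin 2 → ℝ)
    (U : Fin 2 → ℝ) (dU : Fin 2 → Fin 2 → ℝ) 
    (u : Fin 2 → ℝ) (dg : Fin 2 → Fin 2 → Fin 2 → ℝ) (p : Fin 2 → Fin 2 → ℝ)
    (S : Fin 2 → Fin 2 → Fin 2 → ℝ) (dS : Fin 2 → Fin 2 → Fin 2 → Fin 2 → ℝ)
    (hg : g 1 0 = g 0 1) (hΓ : ∀ k, Γ k 1 0 = Γ k 0 1)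
    (hu : ∀ k, u k = ∑ l, g k l * U l)
    (hdg : ∀ k i j, dg k i j = ∑ m, (Γ m k i * g m j + Γ m k j * g m i))
    (hp : ∀ i j, p i j = ∑ l, (dg i j l * U l + g j l * dU i l))
    (hsym : p 0 1 = p 1 0)
    (hS : ∀ l i j, S l i j = (if l = i then u j else 0) + (if l = j then u i else 0) - g i j * U l)
    (hdS : ∀ k l i j, dS k l i j = (if l = i then p k j else 0) + (if l = j then p k i else 0)
      - (dg k i j * U l + g i j * dU k l)) :
    ∑ l, (dS 0 l 1 1 - dS 1 l 0 1 + ∑ m, (Γ l 0 m * S m 1 1 + S l 0 m * Γ m 1 1 + S l 0 m * S m 1 1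
      - (Γ l 1 m * S m 0 1 + S l 1 m * Γ m 0 1 + S l 1 m * S m 0 1))) * g l 0
    = -(g 0 0 * g 1 1 - g 0 1 * g 0 1) * (∑ k, (dU k k + ∑ m, Γ m m k * U k)) := by
  simp only [hS, hdS, Fin.sum_univ_two, hp, hdg, hu, Fin.isValue, hΓ, hg] at hsym ⊢
  simp only [Fin.isValue, if_true, if_false, Fin.reduceEq] at hsym ⊢
  linear_combination (g 0 1) * hsym

section Chart

variable (g : Metric M) {e : OpenPartialHomeomorph M Plane} (he : e ∈ smoothCharts M)
  {y : Plane} (hy : y ∈ e.target)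
include he hy

theorem contDiffAt_gram (i j : Fin 2) : ContDiffAt ℝ ∞ (fun z => gram g e z i j) y :=
  (contDiffOn_gram g he i j).contDiffAt (e.open_target.mem_nhds hy)

theorem gram_inv_mul (k j : Fin 2) :
    ∑ l, (gram g e y)⁻¹ k l * gram g e y l j = if k = j then 1 else 0 := by
  have h := Matrix.nonsing_inv_mul (gram g e y) (gram_det_pos g he hy).ne'.isUnit
  have := congrFun (congrFun h k) j
  rwa [Matrix.mul_apply, Matrix.one_apply] at this

theorem gram_mul_inv (k j : Fin 2) :
    ∑ l, gram g e y k l * (gram g e y)⁻¹ l j = if k = j then 1 else 0 := by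
  have h := Matrix.mul_nonsing_inv (gram g e y) (gram_det_pos g he hy).ne'.isUnit
  have := congrFun (congrFun h k) j
  rwa [Matrix.mul_apply, Matrix.one_apply] at this

omit he hy in
theorem gram_inv_apply (z : Plane) (k l : Fin 2) :
    (gram g e z)⁻¹ k l = (gram g e z).det⁻¹ * (gram g e z).adjugate k l := by
  rw [Matrix.inv_def, Ring.inverse_eq_inv']; rfl

theorem contDiffAt_gram_det : ContDiffAt ℝ ∞ (fun z => (gram g e z).det) y := by
  simp only [Matrix.det_fin_two]
  have h := contDiffAt_gram g he hy
  exact ((h 0 0).mul (h 1 1)).sub ((h 0 1).mul (h 1 0))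

theorem contDiffAt_gram_inv (k l : Fin 2) : ContDiffAt ℝ ∞ (fun z => (gram g e z)⁻¹ k l) y := by
  simp only [gram_inv_apply]
  refine ((contDiffAt_gram_det g he hy).inv (gram_det_pos g he hy).ne').mul ?_
  have h := contDiffAt_gram g he hy
  fin_cases k <;> fin_cases l <;> simp [Matrix.adjugate_fin_two]
  · exact h 1 1
  · exact (h 0 1).neg
  · exact (h 1 0).neg
  · exact h 0 0

theorem contDiffAt_christoffel (k i j : Fin 2) : ContDiffAt ℝ ∞ (christoffel g e k i j) y := by
  have h : ∀ i j l, ContDiffAt ℝ ∞ (partialDeriv i (fun z => gram g e z j l)) y := fun i j l =>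
    contDiffAt_partialDeriv (contDiffAt_gram g he hy j l) (by norm_cast) i
  refine contDiffAt_const.mul (ContDiffAt.sum fun l _ => (contDiffAt_gram_inv g he hy k l).mul ?_)
  exact ((h _ _ _).add (h _ _ _)).sub (h _ _ _)

omit he hy in
theorem partialDeriv_gram_symm (k i j : Fin 2) (z : Plane) :
    partialDeriv k (fun z => gram g e z i j) z = partialDeriv k (fun z => gram g e z j i) z := by
  simp only [gram_symm g e _ i j]

omit he hy in
theorem christoffel_symm (k i j : Fin 2) (z : Plane) :
    christoffel g e k i j z = christoffel g e k j i z := by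
  simp only [christoffel, partialDeriv_gram_symm g _ i j]
  congr 1
  refine Finset.sum_congr rfl fun l _ => ?_
  ring

theorem sum_gram_mul_christoffel (i j n : Fin 2) :
    ∑ k, gram g e y n k * christoffel g e k i j y = (1 / 2) *
      (partialDeriv i (fun z => gram g e z j n) y + partialDeriv j (fun z => gram g e z i n) y
      - partialDeriv n (fun z => gram g e z i j) y) := by
  have h0 := gram_mul_inv g he hy n 0
  have h1 := gram_mul_inv g he hy n 1
  simp only [christoffel, Fin.sum_univ_two] at h0 h1 ⊢
  fin_cases n
  all_goals
    simp only [Fin.zero_eta, Fin.mk_one, Fin.isValue, if_true, if_false, Fin.reduceEq] at h0 h1 ⊢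
    linear_combination
      (1 / 2) * (partialDeriv i (fun z => gram g e z j 0) y
        + partialDeriv j (fun z => gram g e z i 0) y
        - partialDeriv 0 (fun z => gram g e z i j) y) * h0
      + (1 / 2) * (partialDeriv i (fun z => gram g e z j 1) y
        + partialDeriv j (fun z => gram g e z i 1) y
        - partialDeriv 1 (fun z => gram g e z i j) y) * h1

/-- Compatibility of the Levi-Civita connection with the metric. -/
theorem partialDeriv_gram (k i j : Fin 2) :
    partialDeriv k (fun z => gram g e z i j) y = ∑ m, (christoffel g e m k i y * gram g e y m j
      + christoffel g e m k j y * gram g e y m i) := by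
  have h1 := sum_gram_mul_christoffel g he hy k i j
  have h2 := sum_gram_mul_christoffel g he hy k j i
  rw [partialDeriv_gram_symm g k j i, partialDeriv_gram_symm g j k i] at h2
  rw [partialDeriv_gram_symm g i k j] at h1
  rw [partialDeriv_gram_symm g j i k, partialDeriv_gram_symm g i j k] at *
  simp only [Fin.sum_univ_two, gram_symm g e y _ i, gram_symm g e y _ j] at h1 h2 ⊢
  linear_combination -h1 - h2

/-- The `k`-th component `∑ₗ gᵏˡ ∂ₗ f` of the gradient of the function `f` in the chart `e`. -/
def gradComponent (g : Metric M) (e : OpenPartialHomeomorph M Plane) (f : Plane → ℝ) (k : Fin 2)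
    (y : Plane) : ℝ :=
  ∑ l, (gram g e y)⁻¹ k l * partialDeriv l f y

theorem contDiffAt_gradComponent {f : Plane → ℝ} (hf : ContDiffAt ℝ ∞ f y) (k : Fin 2) :
    ContDiffAt ℝ ∞ (gradComponent g e f k) y :=
  ContDiffAt.sum fun l _ => (contDiffAt_gram_inv g he hy k l).mul
    (contDiffAt_partialDeriv hf (by norm_cast) l)

theorem sum_gram_mul_gradComponent (f : Plane → ℝ) (k : Fin 2) :
    ∑ l, gram g e y k l * gradComponent g e f l y = partialDeriv k f y := by
  have h0 := gram_mul_inv g he hy k 0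
  have h1 := gram_mul_inv g he hy k 1
  simp only [gradComponent, Fin.sum_univ_two] at h0 h1 ⊢
  fin_cases k
  all_goals
    simp only [Fin.zero_eta, Fin.mk_one, Fin.isValue, if_true, if_false, Fin.reduceEq] at h0 h1 ⊢
    linear_combination partialDeriv 0 f y * h0 + partialDeriv 1 f y * h1

/-- The coefficients `√(det g) gⁱʲ` of the Laplace operator of `g` in the chart `e`, written in
divergence form. -/
def laplaceCoeff (g : Metric M) (e : OpenPartialHomeomorph M Plane) (y : Plane) :
    Matrix (Fin 2) (Fin 2) ℝ :=
  Matrix.of fun i j => √(gram g e y).det * (gram g e y)⁻¹ i j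

theorem contDiffAt_sqrt_det : ContDiffAt ℝ ∞ (fun z => √(gram g e z).det) y :=
  (contDiffAt_gram_det g he hy).sqrt (gram_det_pos g he hy).ne'

theorem contDiffAt_laplaceCoeff (i j : Fin 2) :
    ContDiffAt ℝ ∞ (fun z => laplaceCoeff g e z i j) y :=
  (contDiffAt_sqrt_det g he hy).mul (contDiffAt_gram_inv g he hy i j)

theorem partialDeriv_sqrt_det (k : Fin 2) :
    partialDeriv k (fun z => √(gram g e z).det) y
      = √(gram g e y).det * ∑ m, christoffel g e m m k y := by
  have hpos := gram_det_pos g he hy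
  have hd := fun i j => (contDiffAt_gram g he hy i j).differentiableAt (by simp)
  have h1 : partialDeriv k (fun z => (gram g e z).det) y
      = 2 * (gram g e y).det * ∑ m, christoffel g e m m k y := by
    simp only [Matrix.det_fin_two]
    rw [partialDeriv_sub ((hd 0 0).fun_mul (hd 1 1)) ((hd 0 1).fun_mul (hd 1 0)),
      partialDeriv_mul (hd 0 0) (hd 1 1), partialDeriv_mul (hd 0 1) (hd 1 0)]
    simp only [partialDeriv_gram g he hy, Fin.sum_univ_two, gram_symm g e y 1 0,
      christoffel_symm g _ k]
    fin_cases k <;> simp only [Fin.zero_eta, Fin.mk_one, Fin.isValue, christoffel_symm g _ 1 0] <;>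
      ring
  have h2 : HasDerivAt Real.sqrt (1 / (2 * √(gram g e y).det)) (gram g e y).det :=
    Real.hasDerivAt_sqrt hpos.ne'
  rw [partialDeriv_comp (f := fun z => (gram g e z).det) h2
    ((contDiffAt_gram_det g he hy).differentiableAt (by simp)), h1]
  have h3 := Real.sqrt_pos.2 hpos
  have h4 := Real.mul_self_sqrt hpos.le
  field_simp
  rw [sq, h4]

/-- The Laplace operator `√(det g) Δ f` in terms of the gradient and the Christoffel symbols. -/
theorem divOp_laplaceCoeff {f : Plane → ℝ} (hf : ContDiffAt ℝ ∞ f y) :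
    divOp (laplaceCoeff g e) f y = √(gram g e y).det *
      ∑ k, (partialDeriv k (gradComponent g e f k) y
        + ∑ m, christoffel g e m m k y * gradComponent g e f k y) := by
  have h : ∀ i : Fin 2, (fun z => ∑ j, laplaceCoeff g e z i j * partialDeriv j f z)
      = fun z => √(gram g e z).det * gradComponent g e f i z := by
    intro i
    funext z
    simp only [laplaceCoeff, Matrix.of_apply, gradComponent, Finset.mul_sum, mul_assoc]
  simp only [divOp, h]
  rw [Finset.mul_sum]
  refine Finset.sum_congr rfl fun k _ => ?_
  rw [partialDeriv_mul ((contDiffAt_sqrt_det g he hy).differentiableAt (by simp))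
    ((contDiffAt_gradComponent g he hy hf k).differentiableAt (by simp)),
    partialDeriv_sqrt_det g he hy, ← Finset.sum_mul]
  ring

end Chart

section Conformal

variable {σ g : Metric M} {u : M → ℝ} (hc : IsConformalFactor σ g u)
  {e : OpenPartialHomeomorph M Plane} (he : e ∈ smoothCharts M) {y : Plane} (hy : y ∈ e.target)
include hc

theorem gram_conformal (z : Plane) (i j : Fin 2) :
    gram g e z i j = Real.exp (2 * u (e.symm z)) * gram σ e z i j := hc.inner_eq _ _ _

theorem gram_conformal_eq_smul (z : Plane) :
    gram g e z = Real.exp (2 * u (e.symm z)) • gram σ e z := by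
  ext i j
  exact gram_conformal hc z i j

include he hy

theorem contDiffAt_conformalFactor : ContDiffAt ℝ ∞ (fun z => u (e.symm z)) y := by
  rw [← contMDiffAt_iff_contDiffAt]
  exact hc.smooth.contMDiffAt.comp y
    ((contMDiffOn_chart_symm he).contMDiffAt (e.open_target.mem_nhds hy))

theorem christoffel_conformal (k i j : Fin 2) :
    christoffel g e k i j y = christoffel σ e k i j y
      + ((if k = i then partialDeriv j (fun z => u (e.symm z)) y else 0)
        + (if k = j then partialDeriv i (fun z => u (e.symm z)) y else 0)
        - gram σ e y i j * gradComponent σ e (fun z => u (e.symm z)) k y) := by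
  have hu := (contDiffAt_conformalFactor hc he hy).differentiableAt (by simp)
  have hexp : ∀ k, partialDeriv k (fun z => Real.exp (2 * u (e.symm z))) y
      = Real.exp (2 * u (e.symm y)) * (2 * partialDeriv k (fun z => u (e.symm z)) y) := by
    intro k
    have h : HasDerivAt (fun s : ℝ => Real.exp (2 * s)) (Real.exp (2 * u (e.symm y)) * 2)
        (u (e.symm y)) := by
      have := ((hasDerivAt_id (u (e.symm y))).const_mul 2).exp
      simpa using this
    rw [partialDeriv_comp (F := fun s : ℝ => Real.exp (2 * s)) h hu]
    ring
  have hder : ∀ k i j, partialDeriv k (fun z => gram g e z i j) y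
      = Real.exp (2 * u (e.symm y)) * (2 * partialDeriv k (fun z => u (e.symm z)) y
        * gram σ e y i j + partialDeriv k (fun z => gram σ e z i j) y) := by
    intro k i j
    simp only [gram_conformal hc]
    rw [partialDeriv_mul (hu.const_mul 2).exp
      ((contDiffAt_gram σ he hy i j).differentiableAt (by simp)), hexp]
    ring
  have hpos := Real.exp_pos (2 * u (e.symm y))
  have hinv : ∀ k l, (gram g e y)⁻¹ k l
      = (Real.exp (2 * u (e.symm y)))⁻¹ * (gram σ e y)⁻¹ k l := by
    intro k l
    have h := Matrix.inv_smul' (A := gram σ e y) (Units.mk0 _ hpos.ne')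
      (gram_det_pos σ he hy).ne'.isUnit
    rw [gram_conformal_eq_smul hc]
    exact congrFun (congrFun h k) l
  have hmi := gram_inv_mul σ he hy k i
  have hmj := gram_inv_mul σ he hy k j
  have hE : (Real.exp (2 * u (e.symm y)))⁻¹ * Real.exp (2 * u (e.symm y)) = 1 :=
    inv_mul_cancel₀ hpos.ne'
  have hite : ∀ (P : Prop) [Decidable P] (x : ℝ), (if P then x else 0) = x * if P then 1 else 0 := by
    intro P _ x
    simp
  rw [hite (k = i), hite (k = j)]
  simp only [christoffel, gradComponent, hder, hinv, Fin.sum_univ_two] at hmi hmj ⊢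
  rw [gram_symm σ e y 0 i, gram_symm σ e y 1 i] at hmi
  rw [gram_symm σ e y 0 j, gram_symm σ e y 1 j] at hmj
  generalize (Real.exp (2 * u (e.symm y)))⁻¹ = F at *
  generalize Real.exp (2 * u (e.symm y)) = E at *
  generalize partialDeriv i (fun z => u (e.symm z)) y = ui
  generalize partialDeriv j (fun z => u (e.symm z)) y = uj
  generalize partialDeriv 0 (fun z => u (e.symm z)) y = u0
  generalize partialDeriv 1 (fun z => u (e.symm z)) y = u1
  linear_combination ui * hmj + uj * hmi + (1 / 2) * ((gram σ e y)⁻¹ k 0 *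
    ((2 * ui * gram σ e y j 0 + partialDeriv i (fun z => gram σ e z j 0) y)
      + (2 * uj * gram σ e y i 0 + partialDeriv j (fun z => gram σ e z i 0) y)
      - (2 * u0 * gram σ e y i j + partialDeriv 0 (fun z => gram σ e z i j) y))
    + (gram σ e y)⁻¹ k 1 *
    ((2 * ui * gram σ e y j 1 + partialDeriv i (fun z => gram σ e z j 1) y)
      + (2 * uj * gram σ e y i 1 + partialDeriv j (fun z => gram σ e z i 1) y)
      - (2 * u1 * gram σ e y i j + partialDeriv 1 (fun z => gram σ e z i j) y))) * hE

/-- The conformal change of the Gaussian curvature: `e²ᵘ K_g = K_σ - Δ_σ u`, multiplied by the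
area density of `σ`. -/
theorem divOp_conformalFactor :
    divOp (laplaceCoeff σ e) (fun z => u (e.symm z)) y = √(gram σ e y).det *
      (gaussCurvature σ e y - Real.exp (2 * u (e.symm y)) * gaussCurvature g e y) := by
  set f : Plane → ℝ := fun z => u (e.symm z) with hf_def
  have hf : ContDiffAt ℝ ∞ f y := contDiffAt_conformalFactor hc he hy
  have hnear : ∀ᶠ z in 𝓝 y, z ∈ e.target := e.open_target.mem_nhds hy
  rw [divOp_laplaceCoeff σ he hy hf]
  congr 1
  have hdet := gram_det_pos σ he hy
  have hdf : ∀ i, DifferentiableAt ℝ (partialDeriv i f) y := fun i =>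
    (contDiffAt_partialDeriv hf (m := ∞) (by norm_cast) i).differentiableAt (by simp)
  have hdU : ∀ k, DifferentiableAt ℝ (gradComponent σ e f k) y := fun k =>
    (contDiffAt_gradComponent σ he hy hf k).differentiableAt (by simp)
  have hdg : ∀ i j, DifferentiableAt ℝ (fun z => gram σ e z i j) y := fun i j =>
    (contDiffAt_gram σ he hy i j).differentiableAt (by simp)
  have hdΓ : ∀ k i j, DifferentiableAt ℝ (christoffel σ e k i j) y := fun k i j =>
    (contDiffAt_christoffel σ he hy k i j).differentiableAt (by simp)
  have hite : ∀ (k : Fin 2) (P : Prop) [Decidable P] (j : Fin 2),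
      DifferentiableAt ℝ (fun z => if P then partialDeriv j f z else 0) y ∧
      partialDeriv k (fun z => if P then partialDeriv j f z else 0) y
        = if P then partialDeriv k (partialDeriv j f) y else 0 := by
    intro k P _ j
    by_cases h : P
    · simp only [h, if_true]; exact ⟨hdf j, trivial⟩
    · simp only [h, if_false]; exact ⟨differentiableAt_const _, partialDeriv_const 0⟩
  have hdchr : ∀ k l i j, partialDeriv k (christoffel g e l i j) y
      = partialDeriv k (christoffel σ e l i j) y
        + ((if l = i then partialDeriv k (partialDeriv j f) y else 0)
          + (if l = j then partialDeriv k (partialDeriv i f) y else 0)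
          - (partialDeriv k (fun z => gram σ e z i j) y * gradComponent σ e f l y
            + gram σ e y i j * partialDeriv k (gradComponent σ e f l) y)) := by
    intro k l i j
    have h1 : christoffel g e l i j =ᶠ[𝓝 y] fun z => christoffel σ e l i j z
      + ((if l = i then partialDeriv j f z else 0) + (if l = j then partialDeriv i f z else 0)
        - gram σ e z i j * gradComponent σ e f l z) := by
      filter_upwards [hnear] with z hz using christoffel_conformal hc he hz l i j
    rw [partialDeriv_congr h1, partialDeriv_add (hdΓ l i j)
      (((hite k _ j).1.fun_add (hite k _ i).1).fun_sub ((hdg i j).fun_mul (hdU l))),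
      partialDeriv_sub ((hite k _ j).1.fun_add (hite k _ i).1) ((hdg i j).fun_mul (hdU l)),
      partialDeriv_add (hite k _ j).1 (hite k _ i).1, partialDeriv_mul (hdg i j) (hdU l),
      (hite k _ j).2, (hite k _ i).2]
  have hp : ∀ i j, partialDeriv i (partialDeriv j f) y
      = ∑ l, (partialDeriv i (fun z => gram σ e z j l) y * gradComponent σ e f l y
        + gram σ e y j l * partialDeriv i (gradComponent σ e f l) y) := by
    intro i j
    have h1 : partialDeriv j f =ᶠ[𝓝 y] fun z => ∑ l, gram σ e z j l * gradComponent σ e f l z := by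
      filter_upwards [hnear] with z hz using (sum_gram_mul_gradComponent σ he hz f j).symm
    rw [partialDeriv_congr h1]
    simp only [Fin.sum_univ_two]
    rw [partialDeriv_add ((hdg j 0).fun_mul (hdU 0)) ((hdg j 1).fun_mul (hdU 1)),
      partialDeriv_mul (hdg j 0) (hdU 0), partialDeriv_mul (hdg j 1) (hdU 1)]
  have key := conformal_curvature_algebra (gram σ e y) (fun k i j => christoffel σ e k i j y)
    (fun k => gradComponent σ e f k y) (fun k l => partialDeriv k (gradComponent σ e f l) y)
    (fun k => partialDeriv k f y) (fun k i j => partialDeriv k (fun z => gram σ e z i j) y)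
    (fun i j => partialDeriv i (partialDeriv j f) y) _ _ (gram_symm σ e y 1 0)
    (fun k => christoffel_symm σ k 1 0 y)
    (fun k => (sum_gram_mul_gradComponent σ he hy f k).symm) (partialDeriv_gram σ he hy) hp
    (partialDeriv_comm (hf.of_le (by norm_cast)) 0 1)
    (fun l i j => rfl) (fun k l i j => rfl)
  have hdet2 : (gram σ e y).det = gram σ e y 0 0 * gram σ e y 1 1
      - gram σ e y 0 1 * gram σ e y 0 1 := by
    rw [Matrix.det_fin_two, gram_symm σ e y 1 0]
  rw [← hdet2] at key
  have hdet3 : (gram g e y).det = Real.exp (2 * f y) ^ 2 * (gram σ e y).det := by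
    simp only [Matrix.det_fin_two, gram_conformal hc, hf_def]
    ring
  have hpos := Real.exp_pos (2 * f y)
  have hK : gaussCurvature σ e y - Real.exp (2 * u (e.symm y)) * gaussCurvature g e y
      = (∑ l, curvComponent σ e l y * gram σ e y l 0
        - ∑ l, curvComponent g e l y * gram σ e y l 0) / (gram σ e y).det := by
    have h1 : ∀ l, gram g e y l 0 = Real.exp (2 * f y) * gram σ e y l 0 := fun l =>
      gram_conformal hc y l 0
    simp only [gaussCurvature, hdet3, h1, Fin.sum_univ_two]
    change _ - Real.exp (2 * f y) * _ = _
    field_simp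
  rw [hK, eq_div_iff hdet.ne']
  simp only [curvComponent, hdchr, christoffel_conformal hc he hy]
  simp only [Fin.sum_univ_two] at key ⊢
  linear_combination key

/-- Nonpositive curvature of `e²ᵘ σ` over a hyperbolic metric `σ` means that `Δ_σ u ≥ -1`. -/
theorem neg_sqrt_det_le_divOp (hσ : IsHyperbolic σ) (hg : IsNonpositivelyCurved g) :
    -√(gram σ e y).det ≤ divOp (laplaceCoeff σ e) (fun z => u (e.symm z)) y := by
  rw [divOp_conformalFactor hc he hy, hσ e he y hy]
  have h1 := hg e he y hy
  have h2 := Real.exp_pos (2 * u (e.symm y))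
  have h3 := Real.sqrt_nonneg (gram σ e y).det
  nlinarith [mul_nonneg h3 (mul_nonneg h2.le (neg_nonneg.2 h1))]

end Conformal

/-! ### The cube of the positive part -/

theorem hasDerivAt_max_zero_pow_succ (n : ℕ) (hn : 1 ≤ n) (s : ℝ) :
    HasDerivAt (fun s : ℝ => max s 0 ^ (n + 1)) ((n + 1) * max s 0 ^ n) s := by
  rcases lt_trichotomy s 0 with hs | rfl | hs
  · have h : (fun s : ℝ => max s 0 ^ (n + 1)) =ᶠ[𝓝 s] fun _ => 0 := by
      filter_upwards [Iio_mem_nhds hs] with t ht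
      rw [max_eq_right (le_of_lt ht)]; simp
    rw [max_eq_right hs.le, zero_pow (by omega), mul_zero]
    exact (hasDerivAt_const s 0).congr_of_eventuallyEq h
  · rw [max_self, zero_pow (by omega), mul_zero]
    rw [hasDerivAt_iff_isLittleO_nhds_zero]
    simp only [zero_add, max_self, ne_eq, Nat.add_eq_zero_iff, one_ne_zero, and_false,
      not_false_eq_true, zero_pow, sub_zero, smul_zero]
    refine Asymptotics.IsBigO.trans_isLittleO (g := fun h : ℝ => |h| ^ (n + 1)) ?_ ?_
    · refine Asymptotics.IsBigO.of_bound 1 (Eventually.of_forall fun t => ?_)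
      rw [one_mul, Real.norm_of_nonneg (by positivity), Real.norm_of_nonneg (by positivity)]
      exact pow_le_pow_left₀ (le_max_right _ _) (max_le (le_abs_self t) (abs_nonneg t)) _
    · have := (Asymptotics.isLittleO_pow_id (𝕜 := ℝ) (n := n + 1) (by omega)).norm_left
      simpa [norm_pow] using this
  · have h : (fun s : ℝ => max s 0 ^ (n + 1)) =ᶠ[𝓝 s] fun s => s ^ (n + 1) := by
      filter_upwards [Ioi_mem_nhds hs] with t ht
      rw [max_eq_left (le_of_lt ht)]
    rw [max_eq_left hs.le]
    have := (hasDerivAt_pow (n + 1) s).congr_of_eventuallyEq h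
    simpa using this

theorem hasDerivAt_max_zero_pow_three (s : ℝ) :
    HasDerivAt (fun s : ℝ => max s 0 ^ 3) (3 * max s 0 ^ 2) s := by
  have := hasDerivAt_max_zero_pow_succ 2 (by norm_num) s
  norm_num at this
  exact this

theorem hasDerivAt_max_zero_pow_two (s : ℝ) :
    HasDerivAt (fun s : ℝ => max s 0 ^ 2) (2 * max s 0) s := by
  have := hasDerivAt_max_zero_pow_succ 1 le_rfl s
  norm_num at this
  exact this

theorem contDiff_max_zero_pow_three : ContDiff ℝ 2 (fun s : ℝ => max s 0 ^ 3) := by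
  have h1 : deriv (fun s : ℝ => max s 0 ^ 3) = fun s => 3 * max s 0 ^ 2 :=
    funext fun s => (hasDerivAt_max_zero_pow_three s).deriv
  have h2 : deriv (fun s : ℝ => 3 * max s 0 ^ 2) = fun s => 3 * (2 * max s 0) :=
    funext fun s => ((hasDerivAt_max_zero_pow_two s).const_mul 3).deriv
  rw [show (2 : WithTop ℕ∞) = 1 + 1 by norm_num, contDiff_succ_iff_deriv]
  refine ⟨fun s => (hasDerivAt_max_zero_pow_three s).differentiableAt, by simp, ?_⟩
  rw [h1, show (1 : WithTop ℕ∞) = 0 + 1 by norm_num, contDiff_succ_iff_deriv]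
  refine ⟨fun s => ((hasDerivAt_max_zero_pow_two s).const_mul 3).differentiableAt, by simp, ?_⟩
  rw [h2, contDiff_zero]
  fun_prop

/-! ### Coefficients close to those of the flat Laplacian -/

/-- Symmetric coefficients that are close to the identity, together with their first derivatives, on
the ball of radius `5` about the origin. -/
structure NearlyFlat (a : Plane → Matrix (Fin 2) (Fin 2) ℝ) : Prop where
  symm : ∀ y i j, a y i j = a y j i
  contDiffAt : ∀ y ∈ closedBall (0 : Plane) 5, ∀ i j, ContDiffAt ℝ 1 (fun z => a z i j) y
  diag : ∀ y ∈ closedBall (0 : Plane) 5, ∀ i, |a y i i - 1| ≤ 1 / 400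
  off_diag : ∀ y ∈ closedBall (0 : Plane) 5, ∀ i j, i ≠ j → |a y i j| ≤ 1 / 400
  deriv : ∀ y ∈ closedBall (0 : Plane) 5, ∀ k i j,
    |partialDeriv k (fun z => a z i j) y| ≤ 1 / 400

/-- The profile `(16 - s)₊³ / √s` of the test function with a mollified pole, as a function of the
squared distance. The inverse distance, rather than its logarithm, is used because it is strictly
subharmonic in dimension two, which leaves room for a perturbation of the coefficients. -/
def poleProfile (s : ℝ) : ℝ := max (16 - s) 0 ^ 3 * (√s)⁻¹

/-- The derivative of `poleProfile`. -/
def poleProfileDeriv (s : ℝ) : ℝ :=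
  -(3 * max (16 - s) 0 ^ 2 * (√s)⁻¹ + 1 / 2 * max (16 - s) 0 ^ 3 * ((√s)⁻¹ * s⁻¹))

/-- The second derivative of `poleProfile`. -/
def poleProfileDeriv₂ (s : ℝ) : ℝ :=
  6 * max (16 - s) 0 * (√s)⁻¹ + 3 * max (16 - s) 0 ^ 2 * ((√s)⁻¹ * s⁻¹)
    + 3 / 4 * max (16 - s) 0 ^ 3 * ((√s)⁻¹ * s⁻¹ * s⁻¹)

theorem hasDerivAt_inv_sqrt {s : ℝ} (hs : 0 < s) :
    HasDerivAt (fun s => (√s)⁻¹) (-(1 / 2) * ((√s)⁻¹ * s⁻¹)) s := by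
  have h := (Real.hasDerivAt_sqrt hs.ne').fun_inv (Real.sqrt_pos.2 hs).ne'
  convert! h using 1
  have h3 := Real.sqrt_pos.2 hs
  rw [Real.sq_sqrt hs.le]
  field_simp

theorem hasDerivAt_poleProfile {s : ℝ} (hs : 0 < s) :
    HasDerivAt poleProfile (poleProfileDeriv s) s := by
  have h1 : HasDerivAt (fun s : ℝ => max (16 - s) 0 ^ 3) (3 * max (16 - s) 0 ^ 2 * (-1)) s :=
    (hasDerivAt_max_zero_pow_three (16 - s)).comp s ((hasDerivAt_id s).const_sub 16)
  convert! h1.mul (hasDerivAt_inv_sqrt hs) using 1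
  simp only [poleProfileDeriv]
  ring

theorem hasDerivAt_poleProfileDeriv {s : ℝ} (hs : 0 < s) :
    HasDerivAt poleProfileDeriv (poleProfileDeriv₂ s) s := by
  have h1 : HasDerivAt (fun s : ℝ => max (16 - s) 0 ^ 3) (3 * max (16 - s) 0 ^ 2 * (-1)) s :=
    (hasDerivAt_max_zero_pow_three (16 - s)).comp s ((hasDerivAt_id s).const_sub 16)
  have h2 : HasDerivAt (fun s : ℝ => max (16 - s) 0 ^ 2) (2 * max (16 - s) 0 * (-1)) s :=
    (hasDerivAt_max_zero_pow_two (16 - s)).comp s ((hasDerivAt_id s).const_sub 16)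
  have h3 := hasDerivAt_inv_sqrt hs
  have h4 := h3.fun_mul (hasDerivAt_inv hs.ne')
  convert! (((h2.const_mul 3).fun_mul h3).fun_add ((h1.const_mul (1 / 2)).fun_mul h4)).fun_neg using 1
  simp only [poleProfileDeriv₂]
  field_simp
  ring

theorem contDiffAt_poleProfile {s : ℝ} (hs : 0 < s) : ContDiffAt ℝ 2 poleProfile s := by
  refine ContDiffAt.mul ?_ ((Real.contDiffAt_sqrt hs.ne').inv (Real.sqrt_pos.2 hs).ne')
  exact contDiff_max_zero_pow_three.contDiffAt.comp s (contDiffAt_const.sub contDiffAt_id)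

/-- The squared distance to `x`, regularized by `ε²`. -/
def sqDist (x : Plane) (ε : ℝ) (y : Plane) : ℝ := (y 0 - x 0) ^ 2 + (y 1 - x 1) ^ 2 + ε ^ 2

theorem sqDist_eq (x : Plane) (ε : ℝ) (y : Plane) : sqDist x ε y = ‖y - x‖ ^ 2 + ε ^ 2 := by
  rw [EuclideanSpace.norm_sq_eq]
  simp [sqDist, Fin.sum_univ_two]

theorem contDiff_sqDist {n : WithTop ℕ∞} (x : Plane) (ε : ℝ) : ContDiff ℝ n (sqDist x ε) := by
  unfold sqDist
  have := contDiff_coord (n := n)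
  exact ((((this 0).sub contDiff_const).pow 2).add (((this 1).sub contDiff_const).pow 2)).add
    contDiff_const

theorem partialDeriv_sqDist (x : Plane) (ε : ℝ) (i : Fin 2) (y : Plane) :
    partialDeriv i (sqDist x ε) y = 2 * (y i - x i) := by
  have h : ∀ k, HasFDerivAt (fun y : Plane => (y k - x k) ^ 2)
      ((2 * (y k - x k)) • (EuclideanSpace.proj k : Plane →L[ℝ] ℝ)) y := by
    intro k
    have := ((hasFDerivAt_coord k y).sub_const (x k)).pow 2
    convert! this using 1
    ext; simp
  have h2 := (((h 0).add (h 1)).add_const (ε ^ 2)).fderiv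
  have h3 : fderiv ℝ (sqDist x ε) y = _ := h2
  rw [partialDeriv, h3]
  fin_cases i <;> simp [coordVec]

theorem divOp_sqDist {a : Plane → Matrix (Fin 2) (Fin 2) ℝ} {y : Plane}
    (ha : ∀ i j, DifferentiableAt ℝ (fun z => a z i j) y) (x : Plane) (ε : ℝ) :
    divOp a (sqDist x ε) y = ∑ i, ∑ j, (partialDeriv i (fun z => a z i j) y * (2 * (y j - x j)))
      + 2 * (a y 0 0 + a y 1 1) := by
  have h1 : ∀ j, partialDeriv j (sqDist x ε) = fun y => 2 * (y j - x j) := fun j =>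
    funext fun y => partialDeriv_sqDist x ε j y
  have h2 : ∀ i j, partialDeriv i (fun y : Plane => 2 * (y j - x j)) y = if j = i then 2 else 0 := by
    intro i j
    have := (((hasFDerivAt_coord j y).sub_const (x j)).const_mul (2 : ℝ)).fderiv
    rw [partialDeriv, this]
    simp [coordVec]
  rw [divOp_apply ha (contDiff_sqDist x ε).contDiffAt]
  simp only [h1, h2, Fin.sum_univ_two]
  simp
  ring

/-- The test function with a mollified pole at `x`. -/
def poleBump (x : Plane) (ε : ℝ) (y : Plane) : ℝ := poleProfile (sqDist x ε y)

theorem sqDist_pos (x : Plane) {ε : ℝ} (hε : 0 < ε) (y : Plane) : 0 < sqDist x ε y := by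
  unfold sqDist; positivity

theorem contDiff_poleBump (x : Plane) {ε : ℝ} (hε : 0 < ε) : ContDiff ℝ 2 (poleBump x ε) :=
  contDiff_iff_contDiffAt.2 fun y =>
    (contDiffAt_poleProfile (sqDist_pos x hε y)).comp y (contDiff_sqDist x ε).contDiffAt

theorem poleBump_nonneg (x : Plane) (ε : ℝ) (y : Plane) : 0 ≤ poleBump x ε y := by
  unfold poleBump poleProfile; positivity

theorem poleBump_eq_zero {x : Plane} {ε : ℝ} {y : Plane} (h : 4 ≤ ‖y - x‖) :
    poleBump x ε y = 0 := by
  have : 16 - sqDist x ε y ≤ 0 := by rw [sqDist_eq]; nlinarith [sq_nonneg ε]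
  rw [poleBump, poleProfile, max_eq_right this]
  simp

theorem NearlyFlat.differentiableAt {a : Plane → Matrix (Fin 2) (Fin 2) ℝ} (ha : NearlyFlat a)
    {y : Plane} (hy : y ∈ closedBall (0 : Plane) 5) (i j : Fin 2) :
    DifferentiableAt ℝ (fun z => a z i j) y :=
  (ha.contDiffAt y hy i j).differentiableAt (by norm_num)

theorem abs_coord_le (z : Plane) (i : Fin 2) : |z i| ≤ ‖z‖ := by
  have := PiLp.norm_apply_le z i
  simpa using this

/-- The operator takes `F ∘ q` to `F'(q) B + F''(q) A`, where `F` is the profile, `q` the squared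
distance, and where `A` is close to `4 q` and `B` to `4` for nearly flat coefficients. -/
theorem pole_inequality {q A B : ℝ} (hq : 0 < q) (hA : 3.94 * q ≤ A) (hB : B ≤ 4.09) :
    0 ≤ poleProfileDeriv q * B + poleProfileDeriv₂ q * A ∧
    (q ≤ 10 → 1 ≤ poleProfileDeriv q * B + poleProfileDeriv₂ q * A) := by
  unfold poleProfileDeriv poleProfileDeriv₂
  have hr : 0 < √q := Real.sqrt_pos.2 hq
  have hm : 0 ≤ max (16 - q) 0 := le_max_right _ _
  have hmq : max (16 - q) 0 = 0 ∨ max (16 - q) 0 = 16 - q := by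
    rcases le_total (16 - q) 0 with h | h
    · exact Or.inl (max_eq_right h)
    · exact Or.inr (max_eq_left h)
  set m := max (16 - q) 0
  have hF1 : 0 ≤ 3 * m ^ 2 * (√q)⁻¹ + 1 / 2 * m ^ 3 * ((√q)⁻¹ * q⁻¹) := by positivity
  have hF2 : 0 ≤ 6 * m * (√q)⁻¹ + 3 * m ^ 2 * ((√q)⁻¹ * q⁻¹)
    + 3 / 4 * m ^ 3 * ((√q)⁻¹ * q⁻¹ * q⁻¹) := by positivity
  have key : (m * (√q)⁻¹ * q⁻¹) * (20 * q ^ 2 + 0.8 * m ^ 2)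
      ≤ -(3 * m ^ 2 * (√q)⁻¹ + 1 / 2 * m ^ 3 * ((√q)⁻¹ * q⁻¹)) * B
        + (6 * m * (√q)⁻¹ + 3 * m ^ 2 * ((√q)⁻¹ * q⁻¹)
    + 3 / 4 * m ^ 3 * ((√q)⁻¹ * q⁻¹ * q⁻¹)) * A := by
    have h1 := mul_le_mul_of_nonneg_left hB hF1
    have h2 := mul_le_mul_of_nonneg_left hA hF2
    have h3 : (6 * m * (√q)⁻¹ + 3 * m ^ 2 * ((√q)⁻¹ * q⁻¹)
      + 3 / 4 * m ^ 3 * ((√q)⁻¹ * q⁻¹ * q⁻¹)) * (3.94 * q)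
      - (3 * m ^ 2 * (√q)⁻¹ + 1 / 2 * m ^ 3 * ((√q)⁻¹ * q⁻¹)) * 4.09
      = (m * (√q)⁻¹ * q⁻¹) * (23.64 * q ^ 2 - 0.45 * (m * q) + 0.91 * m ^ 2) := by
      field_simp
      ring
    have h4 : 20 * q ^ 2 + 0.8 * m ^ 2 ≤ 23.64 * q ^ 2 - 0.45 * (m * q) + 0.91 * m ^ 2 := by
      nlinarith [sq_nonneg (m - 2 * q), sq_nonneg (m - q)]
    have h5 : 0 ≤ m * (√q)⁻¹ * q⁻¹ := by positivity
    have h6 := mul_le_mul_of_nonneg_left h4 h5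
    linarith
  refine ⟨le_trans (by positivity) key, fun hq10 => le_trans ?_ key⟩
  have hm6 : 6 ≤ m := le_trans (by linarith) (le_max_left (16 - q) 0)
  have hr4 : √q ≤ 4 := by
    rw [Real.sqrt_le_left (by norm_num)]; linarith
  have h1 : m * (√q)⁻¹ * q⁻¹ * (20 * q ^ 2 + 0.8 * m ^ 2)
    = m * (20 * q ^ 2 + 0.8 * m ^ 2) / (√q * q) := by field_simp
  rw [h1, le_div_iff₀ (by positivity), one_mul]
  have h2 : √q * q ≤ 4 * 10 := mul_le_mul hr4 hq10 hq.le (by norm_num)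
  have h3 : (6 : ℝ) * (0.8 * 6 ^ 2) ≤ m * (20 * q ^ 2 + 0.8 * m ^ 2) := by
    apply mul_le_mul hm6 _ (by norm_num) hm
    nlinarith
  linarith

/-- The test function with a pole is a subsolution outside a small ball about the pole, strictly so
up to distance `3`; in the small ball, its image under the operator is bounded below by a negative
power of the radius. -/
theorem divOp_poleBump_ge {a : Plane → Matrix (Fin 2) (Fin 2) ℝ} (ha : NearlyFlat a)
    {x : Plane} (hx : ‖x‖ ≤ 1) {ε : ℝ} (hε : 0 < ε) (hε1 : ε ≤ 1 / 10) (y : Plane) :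
    (closedBall x 3).indicator (fun _ => (1 : ℝ)) y
      - (ball x (10 * ε)).indicator (fun _ => 20000 / ε ^ 3) y ≤ divOp a (poleBump x ε) y := by
  have hqpos := sqDist_pos x hε y
  by_cases hy4 : 4 < ‖y - x‖
  · have h0 : poleBump x ε =ᶠ[𝓝 y] fun _ => 0 := by
      have : ∀ᶠ z in 𝓝 y, 4 < ‖z - x‖ :=
        (continuous_id.sub continuous_const).norm.continuousAt.eventually (lt_mem_nhds hy4)
      filter_upwards [this] with z hz using poleBump_eq_zero hz.le
    rw [divOp_congr h0]
    rw [indicator_of_notMem (by simp [dist_eq_norm]; linarith), indicator_of_notMem]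
    · simp [divOp, partialDeriv_const]
    · simp only [mem_ball, dist_eq_norm]; linarith
  push Not at hy4
  have hy5 : y ∈ closedBall (0 : Plane) 5 := by
    rw [mem_closedBall, dist_zero_right]
    calc ‖y‖ = ‖(y - x) + x‖ := by simp
      _ ≤ ‖y - x‖ + ‖x‖ := norm_add_le _ _
      _ ≤ 5 := by linarith
  have hda := ha.differentiableAt hy5
  have hL : divOp a (poleBump x ε) y = poleProfileDeriv (sqDist x ε y) * divOp a (sqDist x ε) y
      + poleProfileDeriv₂ (sqDist x ε y) * ∑ i, ∑ j, a y i j * partialDeriv i (sqDist x ε) y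
        * partialDeriv j (sqDist x ε) y := by
    refine divOp_comp hda (contDiff_sqDist x ε).contDiffAt ?_
      (hasDerivAt_poleProfileDeriv hqpos) (contDiffAt_poleProfile hqpos)
    filter_upwards [lt_mem_nhds hqpos] with s hs using hasDerivAt_poleProfile hs
  rw [hL, divOp_sqDist hda]
  simp only [partialDeriv_sqDist]
  set Q := ∑ i, ∑ j, a y i j * (2 * (y i - x i)) * (2 * (y j - x j)) with hQ
  set D := ∑ i, ∑ j, partialDeriv i (fun z => a z i j) y * (2 * (y j - x j))
    + 2 * (a y 0 0 + a y 1 1) with hD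
  have hz : ∀ i, |y i - x i| ≤ 4 := fun i => (abs_coord_le (y - x) i).trans hy4
  have hDle : D ≤ 4.09 := by
    have h1 : ∀ i j, partialDeriv i (fun z => a z i j) y * (2 * (y j - x j))
        ≤ 1 / 400 * (2 * 4) := by
      intro i j
      refine (le_abs_self _).trans ?_
      rw [abs_mul, abs_mul, abs_two]
      exact mul_le_mul (ha.deriv y hy5 i i j) (by linarith [hz j]) (by positivity) (by norm_num)
    have h2 := (abs_le.1 (ha.diag y hy5 0)).2
    have h3 := (abs_le.1 (ha.diag y hy5 1)).2
    simp only [hD, Fin.sum_univ_two]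
    linarith [h1 0 0, h1 0 1, h1 1 0, h1 1 1]
  have hnorm : ‖y - x‖ ^ 2 = (y 0 - x 0) ^ 2 + (y 1 - x 1) ^ 2 := by
    rw [EuclideanSpace.norm_sq_eq]; simp [Fin.sum_univ_two]
  have hQge : 3.98 * ‖y - x‖ ^ 2 ≤ Q := by
    have h2 := (abs_le.1 (ha.diag y hy5 0)).1
    have h3 := (abs_le.1 (ha.diag y hy5 1)).1
    have h4 := abs_le.1 (ha.off_diag y hy5 0 1 (by decide))
    rw [hnorm, hQ]
    simp only [Fin.sum_univ_two, ha.symm y 1 0]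
    generalize y 0 - x 0 = p
    generalize y 1 - x 1 = r
    nlinarith [sq_nonneg (p - r), sq_nonneg (p + r), sq_nonneg p, sq_nonneg r]
  have hQ0 : 0 ≤ Q := le_trans (by positivity) hQge
  by_cases hy10 : ‖y - x‖ < 10 * ε
  · rw [indicator_of_mem (show y ∈ ball x (10 * ε) by rwa [mem_ball, dist_eq_norm])]
    have hind : (closedBall x 3).indicator (fun _ => (1 : ℝ)) y ≤ 1 :=
      indicator_le_self' (fun _ _ => zero_le_one) y
    have hF2 : 0 ≤ poleProfileDeriv₂ (sqDist x ε y) := by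
      unfold poleProfileDeriv₂; positivity
    have hqε : ε ^ 2 ≤ sqDist x ε y := by rw [sqDist_eq]; nlinarith [sq_nonneg ‖y - x‖]
    have hrε : ε ≤ √(sqDist x ε y) := Real.le_sqrt_of_sq_le hqε
    have hF1 : -(2100 / ε ^ 3) ≤ poleProfileDeriv (sqDist x ε y) := by
      unfold poleProfileDeriv
      have hm : max (16 - sqDist x ε y) 0 ≤ 16 := max_le (by linarith) (by norm_num)
      have hm0 : 0 ≤ max (16 - sqDist x ε y) 0 := le_max_right _ _
      have i1 : (√(sqDist x ε y))⁻¹ ≤ ε⁻¹ := inv_anti₀ hε hrε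
      have i2 : (sqDist x ε y)⁻¹ ≤ (ε ^ 2)⁻¹ := inv_anti₀ (by positivity) hqε
      have b1 : 3 * max (16 - sqDist x ε y) 0 ^ 2 * (√(sqDist x ε y))⁻¹ ≤ 3 * 16 ^ 2 * ε⁻¹ := by
        gcongr
      have b2 : 1 / 2 * max (16 - sqDist x ε y) 0 ^ 3 * ((√(sqDist x ε y))⁻¹ * (sqDist x ε y)⁻¹)
          ≤ 1 / 2 * 16 ^ 3 * (ε⁻¹ * (ε ^ 2)⁻¹) := by gcongr
      have b3 : 3 * 16 ^ 2 * ε⁻¹ + 1 / 2 * 16 ^ 3 * (ε⁻¹ * (ε ^ 2)⁻¹) ≤ 2100 / ε ^ 3 := by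
        have : 3 * 16 ^ 2 * ε⁻¹ + 1 / 2 * 16 ^ 3 * (ε⁻¹ * (ε ^ 2)⁻¹)
          = (768 * ε ^ 2 + 2048) / ε ^ 3 := by field_simp; ring
        rw [this]
        gcongr
        nlinarith
      linarith
    have hF1neg : poleProfileDeriv (sqDist x ε y) ≤ 0 := by
      unfold poleProfileDeriv
      rw [neg_nonpos]
      positivity
    have hε3 : 1 ≤ 1 / ε ^ 3 := by
      rw [le_div_iff₀ (by positivity), one_mul]
      exact pow_le_one₀ hε.le (by linarith)
    have e1 : (20000 : ℝ) / ε ^ 3 = 20000 * (1 / ε ^ 3) := by ring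
    have e2 : (2100 : ℝ) / ε ^ 3 = 2100 * (1 / ε ^ 3) := by ring
    rw [e2] at hF1
    rw [e1]
    nlinarith [mul_nonneg hF2 hQ0, mul_le_mul_of_nonpos_left hDle hF1neg]
  · rw [indicator_of_notMem (show y ∉ ball x (10 * ε) by rwa [mem_ball, dist_eq_norm]), sub_zero]
    push Not at hy10
    have hq := sqDist_eq x ε y
    have hA : 3.94 * sqDist x ε y ≤ Q := by nlinarith
    obtain ⟨h1, h2⟩ := pole_inequality hqpos hA hDle
    by_cases hy3 : y ∈ closedBall x 3
    · rw [indicator_of_mem hy3]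
      apply h2
      rw [mem_closedBall, dist_eq_norm] at hy3
      rw [hq]
      nlinarith [norm_nonneg (y - x)]
    · rwa [indicator_of_notMem hy3]

/-- The integrals of the test functions with a mollified pole are uniformly bounded. -/
theorem exists_integral_poleBump_le :
    ∃ C : ℝ, 0 < C ∧ ∀ (x : Plane) (ε : ℝ), 0 < ε → ∫ y, poleBump x ε y ≤ C := by
  refine ⟨2 * volume.real (ball (0 : Plane) 1) * 16384 + 1, by positivity, fun x ε hε => ?_⟩
  have h1 : ∫ y, poleBump x ε y = ∫ z : Plane, poleProfile (‖z‖ ^ 2 + ε ^ 2) := by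
    rw [← integral_sub_right_eq_self (fun z : Plane => poleProfile (‖z‖ ^ 2 + ε ^ 2)) x]
    simp only [poleBump, sqDist_eq]
  rw [h1, integral_fun_norm_addHaar volume (fun t : ℝ => poleProfile (t ^ 2 + ε ^ 2))]
  have hdim : Module.finrank ℝ Plane = 2 := by simp
  rw [hdim]
  have h2 : ∫ t in Ioi (0 : ℝ), t ^ (2 - 1) • poleProfile (t ^ 2 + ε ^ 2) ≤ 16384 := by
    have hle : ∀ t ∈ Ioi (0 : ℝ), t ^ (2 - 1) • poleProfile (t ^ 2 + ε ^ 2)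
        ≤ (Ioc (0 : ℝ) 4).indicator (fun _ => 4096) t := by
      intro t ht
      have ht0 : 0 < t := ht
      by_cases h4 : t ≤ 4
      · rw [indicator_of_mem (show t ∈ Ioc (0 : ℝ) 4 from ⟨ht0, h4⟩)]
        have hm : max (16 - (t ^ 2 + ε ^ 2)) 0 ≤ 16 := max_le (by nlinarith [sq_nonneg ε]) (by norm_num)
        have hr : t ≤ √(t ^ 2 + ε ^ 2) := Real.le_sqrt_of_sq_le (by nlinarith [sq_nonneg ε])
        have hi : (√(t ^ 2 + ε ^ 2))⁻¹ ≤ t⁻¹ := inv_anti₀ ht0 hr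
        have hm3 : max (16 - (t ^ 2 + ε ^ 2)) 0 ^ 3 ≤ 16 ^ 3 :=
          pow_le_pow_left₀ (le_max_right _ _) hm 3
        unfold poleProfile
        simp only [smul_eq_mul]
        norm_num only [pow_one]
        calc t * (max (16 - (t ^ 2 + ε ^ 2)) 0 ^ 3 * (√(t ^ 2 + ε ^ 2))⁻¹)
            ≤ t * (16 ^ 3 * t⁻¹) := by gcongr
          _ = 4096 := by field_simp; norm_num
      · rw [indicator_of_notMem (fun h => h4 h.2)]
        unfold poleProfile
        rw [max_eq_right (by nlinarith [sq_nonneg ε])]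
        simp
    calc ∫ t in Ioi (0 : ℝ), t ^ (2 - 1) • poleProfile (t ^ 2 + ε ^ 2)
        ≤ ∫ t in Ioi (0 : ℝ), (Ioc (0 : ℝ) 4).indicator (fun _ => (4096 : ℝ)) t := by
          refine integral_mono_of_nonneg ?_ ?_ ?_
          · refine (ae_restrict_iff' measurableSet_Ioi).2 (Eventually.of_forall fun t ht => ?_)
            have : 0 < t := ht
            simp only [smul_eq_mul, poleProfile]
            positivity
          · refine Integrable.integrableOn ?_
            exact (integrable_indicator_iff measurableSet_Ioc).2 (by simp)
          · exact (ae_restrict_iff' measurableSet_Ioi).2 (Eventually.of_forall hle)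
      _ = 16384 := by
          rw [integral_indicator measurableSet_Ioc, Measure.restrict_restrict measurableSet_Ioc]
          rw [inter_eq_left.2 Ioc_subset_Ioi_self]
          simp
          norm_num
  have h3 : 0 ≤ volume.real (ball (0 : Plane) 1) := measureReal_nonneg
  simp only [nsmul_eq_mul, smul_eq_mul] at h2 ⊢
  push_cast
  nlinarith

/-- A nonnegative function `v` with `L v ≤ 1`. -/
structure IsNonnegSupersolution (a : Plane → Matrix (Fin 2) (Fin 2) ℝ) (v : Plane → ℝ) : Prop where
  contDiffAt : ∀ y ∈ closedBall (0 : Plane) 5, ContDiffAt ℝ 2 v y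
  nonneg : ∀ y, 0 ≤ v y
  divOp_le : ∀ y ∈ closedBall (0 : Plane) 5, divOp a v y ≤ 1

theorem IsNonnegSupersolution.continuousOn {a : Plane → Matrix (Fin 2) (Fin 2) ℝ} {v : Plane → ℝ}
    (hv : IsNonnegSupersolution a v) : ContinuousOn v (closedBall 0 5) := fun y hy =>
  (hv.contDiffAt y hy).continuousAt.continuousWithinAt

theorem IsNonnegSupersolution.integrableOn {a : Plane → Matrix (Fin 2) (Fin 2) ℝ} {v : Plane → ℝ}
    (hv : IsNonnegSupersolution a v) {s : Set Plane} (hs : s ⊆ closedBall 0 5) :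
    IntegrableOn v s :=
  (hv.continuousOn.integrableOn_compact (isCompact_closedBall 0 5)).mono_set hs

/-- Testing the inequality `L v ≤ 1`. -/
theorem IsNonnegSupersolution.integral_mul_divOp_le {a : Plane → Matrix (Fin 2) (Fin 2) ℝ}
    {v : Plane → ℝ} (ha : NearlyFlat a) (hv : IsNonnegSupersolution a v) {φ : Plane → ℝ}
    (hφ : ContDiff ℝ 2 φ) (hφ0 : ∀ y, 0 ≤ φ y) (hs : ∀ y ∉ closedBall (0 : Plane) 5, φ y = 0) :
    Integrable (fun y => v y * divOp a φ y) ∧ ∫ y, v y * divOp a φ y ≤ ∫ y, φ y := by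
  have hts : tsupport φ ⊆ closedBall (0 : Plane) 5 := by
    refine closure_minimal (fun y hy => ?_) isClosed_closedBall
    by_contra hcon
    exact hy (hs y hcon)
  have hc : HasCompactSupport φ :=
    (isCompact_closedBall (0 : Plane) 5).of_isClosed_subset (isClosed_tsupport φ) hts
  obtain ⟨h1, h2, h3⟩ := integral_mul_divOp_comm hφ hc (fun y hy => ha.contDiffAt y (hts hy))
    ha.symm (fun y hy => hv.contDiffAt y (hts hy))
  refine ⟨h1, ?_⟩
  rw [h3]
  refine integral_mono h2 (hφ.continuous.integrable_of_hasCompactSupport hc) fun y => ?_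
  by_cases hy : y ∈ closedBall (0 : Plane) 5
  · have := mul_le_mul_of_nonneg_left (hv.divOp_le y hy) (hφ0 y)
    simpa using this
  · simp [hs y hy]

/-- The integral of a nonnegative supersolution over a ball is controlled by its integral over a
small concentric ball. -/
theorem exists_integral_closedBall_le :
    ∃ C : ℝ, 0 < C ∧ ∀ (a : Plane → Matrix (Fin 2) (Fin 2) ℝ) (v : Plane → ℝ) (x : Plane) (ε : ℝ),
      NearlyFlat a → IsNonnegSupersolution a v → ‖x‖ ≤ 1 → 0 < ε → ε ≤ 1 / 10 →
      ∫ y in closedBall x 3, v y ≤ C + 20000 / ε ^ 3 * ∫ y in ball x (10 * ε), v y := by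
  obtain ⟨C, hC, hCle⟩ := exists_integral_poleBump_le
  refine ⟨C, hC, fun a v x ε ha hv hx hε hε1 => ?_⟩
  have hsub : ∀ r ≤ 4, closedBall x r ⊆ closedBall (0 : Plane) 5 := by
    intro r hr
    apply closedBall_subset_closedBall'
    rw [dist_zero_right]; linarith
  obtain ⟨h1, h2⟩ := hv.integral_mul_divOp_le ha (contDiff_poleBump x hε) (poleBump_nonneg x ε)
    (fun y hy => poleBump_eq_zero (by
      by_contra hcon
      push Not at hcon
      exact hy (hsub 4 le_rfl (by rw [mem_closedBall, dist_eq_norm]; exact hcon.le))))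
  have hi1 : IntegrableOn v (closedBall x 3) := hv.integrableOn (hsub 3 (by norm_num))
  have hi2 : IntegrableOn v (ball x (10 * ε)) := hv.integrableOn
    (ball_subset_closedBall.trans (hsub _ (by linarith)))
  have hj1 := (integrable_indicator_iff measurableSet_closedBall).2 hi1
  have hj2 := ((integrable_indicator_iff measurableSet_ball).2 hi2).const_mul (20000 / ε ^ 3)
  have h3 : ∫ y, ((closedBall x 3).indicator v y - 20000 / ε ^ 3 * (ball x (10 * ε)).indicator v y)
      ≤ ∫ y, v y * divOp a (poleBump x ε) y := by
    refine integral_mono (hj1.sub hj2) h1 fun y => ?_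
    have := mul_le_mul_of_nonneg_left (divOp_poleBump_ge ha hx hε hε1 y) (hv.nonneg y)
    refine le_trans (le_of_eq ?_) this
    by_cases ha : y ∈ closedBall x 3 <;> by_cases hb : y ∈ ball x (10 * ε) <;>
      simp only [ha, hb, indicator_of_mem, indicator_of_notMem, not_false_eq_true] <;> ring
  rw [integral_sub hj1 hj2, integral_const_mul, integral_indicator measurableSet_closedBall,
    integral_indicator measurableSet_ball] at h3
  linarith [hCle x ε hε]

/-- If a nonnegative supersolution vanishes at a point then its integral over a ball about this
point is bounded by a universal constant. -/
theorem exists_integral_closedBall_le_of_zero :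
    ∃ C : ℝ, 0 < C ∧ ∀ (a : Plane → Matrix (Fin 2) (Fin 2) ℝ) (v : Plane → ℝ) (x : Plane),
      NearlyFlat a → IsNonnegSupersolution a v → ‖x‖ ≤ 1 → v x = 0 →
      ∫ y in closedBall x 3, v y ≤ C := by
  obtain ⟨C, hC, h⟩ := exists_integral_closedBall_le
  refine ⟨C, hC, fun a v x ha hv hx hx0 => le_of_forall_pos_le_add fun δ hδ => ?_⟩
  have hx5 : x ∈ closedBall (0 : Plane) 5 := by
    rw [mem_closedBall, dist_zero_right]; linarith
  -- the differential of `v` vanishes at the minimum point `x`, so that `v y = o(‖y - x‖)`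
  have hmin : IsLocalMin v x := Eventually.of_forall fun y => by rw [hx0]; exact hv.nonneg y
  have hd := ((hv.contDiffAt x hx5).differentiableAt (by norm_num)).hasFDerivAt
  rw [hmin.fderiv_eq_zero, hasFDerivAt_iff_isLittleO] at hd
  simp only [hx0, zero_apply, sub_zero] at hd
  have hη : 0 < δ / (20000 * 10 * 100 * Real.pi) := by positivity
  obtain ⟨r, hr, hball⟩ := Metric.eventually_nhds_iff_ball.1 (hd.def hη)
  set ε := min (1 / 10) (r / 10) with hε_def
  have hε : 0 < ε := lt_min (by norm_num) (by positivity)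
  have hε1 : ε ≤ 1 / 10 := min_le_left _ _
  have hεr : 10 * ε ≤ r := by have := min_le_right (1 / 10) (r / 10); linarith
  refine (h a v x ε ha hv hx hε hε1).trans ?_
  gcongr
  have hvol : volume.real (ball x (10 * ε)) = (10 * ε) ^ 2 * Real.pi := by
    rw [measureReal_def, EuclideanSpace.volume_ball_fin_two, ENNReal.toReal_mul, ENNReal.toReal_pow,
      ENNReal.toReal_ofReal (by positivity), ENNReal.toReal_ofReal Real.pi_nonneg]
  have hle : ∫ y in ball x (10 * ε), v y
      ≤ δ / (20000 * 10 * 100 * Real.pi) * (10 * ε) * volume.real (ball x (10 * ε)) := by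
    have := norm_setIntegral_le_of_norm_le_const (μ := volume) (s := ball x (10 * ε)) (f := v)
      (C := δ / (20000 * 10 * 100 * Real.pi) * (10 * ε)) measure_ball_lt_top (fun y hy => by
        refine (hball y (ball_subset_ball hεr hy)).trans ?_
        rw [mem_ball, dist_eq_norm] at hy
        gcongr)
    exact (le_abs_self _).trans this
  calc 20000 / ε ^ 3 * ∫ y in ball x (10 * ε), v y
      ≤ 20000 / ε ^ 3 * (δ / (20000 * 10 * 100 * Real.pi) * (10 * ε)
        * volume.real (ball x (10 * ε))) := by gcongr
    _ = δ := by
      rw [hvol]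
      have := Real.pi_pos
      field_simp
      norm_num

/-! ### Integrals over graphs -/

theorem divOp_sub {a : Plane → Matrix (Fin 2) (Fin 2) ℝ} {f g : Plane → ℝ} {y : Plane}
    (ha : ∀ i j, DifferentiableAt ℝ (fun z => a z i j) y) (hf : ContDiffAt ℝ 2 f y)
    (hg : ContDiffAt ℝ 2 g y) :
    divOp a (fun z => f z - g z) y = divOp a f y - divOp a g y := by
  have h1 : ∀ j, DifferentiableAt ℝ (partialDeriv j f) y := fun j =>
    (contDiffAt_partialDeriv hf (m := 1) (by norm_num) j).differentiableAt (by norm_num)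
  have h2 : ∀ j, DifferentiableAt ℝ (partialDeriv j g) y := fun j =>
    (contDiffAt_partialDeriv hg (m := 1) (by norm_num) j).differentiableAt (by norm_num)
  have h3 : ∀ j, partialDeriv j (fun z => f z - g z) =ᶠ[𝓝 y]
      fun z => partialDeriv j f z - partialDeriv j g z := by
    intro j
    filter_upwards [hf.eventually (by simp), hg.eventually (by simp)] with z hz hz'
    exact partialDeriv_sub (hz.differentiableAt (by norm_num)) (hz'.differentiableAt (by norm_num))
  have h4 : ∀ i j, partialDeriv i (partialDeriv j (fun z => f z - g z)) y
      = partialDeriv i (partialDeriv j f) y - partialDeriv i (partialDeriv j g) y := by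
    intro i j
    rw [partialDeriv_congr (h3 j), partialDeriv_sub (h1 j) (h2 j)]
  rw [divOp_apply ha (hf.sub hg), divOp_apply ha hf, divOp_apply ha hg]
  simp only [h4, fun j => (h3 j).eq_of_nhds, Fin.sum_univ_two]
  ring

theorem divOp_coord {a : Plane → Matrix (Fin 2) (Fin 2) ℝ} {y : Plane}
    (ha : ∀ i j, DifferentiableAt ℝ (fun z => a z i j) y) (k : Fin 2) :
    divOp a (fun z => z k) y = ∑ i, partialDeriv i (fun z => a z i k) y := by
  have h : ∀ j, partialDeriv j (fun z : Plane => z k) = fun _ => if k = j then 1 else 0 :=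
    fun j => funext fun z => partialDeriv_coord j k z
  rw [divOp_apply ha (contDiff_coord k).contDiffAt]
  simp only [h, partialDeriv_const, mul_zero, add_zero]
  simp

/-- The even bump function `(w² - s²)₊³`. -/
def cubeBump (w s : ℝ) : ℝ := max (w ^ 2 - s ^ 2) 0 ^ 3

/-- The derivative of `cubeBump`. -/
def cubeBumpDeriv (w s : ℝ) : ℝ := -(6 * s * max (w ^ 2 - s ^ 2) 0 ^ 2)

/-- The second derivative of `cubeBump`. -/
def cubeBumpDeriv₂ (w s : ℝ) : ℝ :=
  24 * s ^ 2 * max (w ^ 2 - s ^ 2) 0 - 6 * max (w ^ 2 - s ^ 2) 0 ^ 2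

theorem hasDerivAt_cubeBump (w s : ℝ) : HasDerivAt (cubeBump w) (cubeBumpDeriv w s) s := by
  have h0 : HasDerivAt (fun s : ℝ => w ^ 2 - s ^ 2) (-(2 * s)) s := by
    simpa using (hasDerivAt_pow 2 s).const_sub (w ^ 2)
  convert! (hasDerivAt_max_zero_pow_three (w ^ 2 - s ^ 2)).comp s h0 using 1
  simp only [cubeBumpDeriv]; ring

theorem hasDerivAt_cubeBumpDeriv (w s : ℝ) :
    HasDerivAt (cubeBumpDeriv w) (cubeBumpDeriv₂ w s) s := by
  have h0 : HasDerivAt (fun s : ℝ => w ^ 2 - s ^ 2) (-(2 * s)) s := by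
    simpa using (hasDerivAt_pow 2 s).const_sub (w ^ 2)
  have h1 : HasDerivAt (fun s : ℝ => max (w ^ 2 - s ^ 2) 0 ^ 2)
      (2 * max (w ^ 2 - s ^ 2) 0 * -(2 * s)) s :=
    HasDerivAt.comp s (h₂ := fun s : ℝ => max s 0 ^ 2) (hasDerivAt_max_zero_pow_two _) h0
  convert! (((hasDerivAt_id s).const_mul 6).fun_mul h1).fun_neg using 1
  simp only [cubeBumpDeriv₂, id]; ring

theorem contDiff_cubeBump (w : ℝ) : ContDiff ℝ 2 (cubeBump w) :=
  contDiff_max_zero_pow_three.comp (contDiff_const.sub (contDiff_id.pow 2))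

theorem cubeBump_eq_zero {w s : ℝ} (hw : 0 ≤ w) (hs : w ≤ |s|) : cubeBump w s = 0 := by
  have : w ^ 2 - s ^ 2 ≤ 0 := by rw [← sq_abs s]; nlinarith
  rw [cubeBump, max_eq_right this]; simp

theorem cubeBump_bounds {w s : ℝ} (hw : 0 ≤ w) (hw1 : w ≤ 1) (hs : |s| ≤ w) :
    0 ≤ cubeBump w s ∧ cubeBump w s ≤ 1 ∧ |cubeBumpDeriv w s| ≤ 6 ∧ |cubeBumpDeriv₂ w s| ≤ 24 := by
  have h0 : 0 ≤ max (w ^ 2 - s ^ 2) 0 := le_max_right _ _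
  have h1 : max (w ^ 2 - s ^ 2) 0 ≤ 1 := max_le (by nlinarith [sq_nonneg s]) zero_le_one
  have hs1 : |s| ≤ 1 := hs.trans hw1
  have hs2 : s ^ 2 ≤ 1 := by rw [← sq_abs]; nlinarith [abs_nonneg s]
  unfold cubeBump cubeBumpDeriv cubeBumpDeriv₂
  set m := max (w ^ 2 - s ^ 2) 0
  have hm2 : m ^ 2 ≤ 1 := pow_le_one₀ h0 h1
  refine ⟨by positivity, pow_le_one₀ h0 h1, ?_, ?_⟩
  · rw [abs_neg, abs_mul, abs_mul, abs_of_pos (by norm_num : (0 : ℝ) < 6),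
      abs_of_nonneg (sq_nonneg m)]
    nlinarith [abs_nonneg s, sq_nonneg m, mul_le_mul hs1 hm2 (sq_nonneg m) zero_le_one]
  · rw [abs_le]
    have := mul_le_mul hs2 h1 h0 zero_le_one
    constructor <;> nlinarith [sq_nonneg m, mul_nonneg (sq_nonneg s) h0]

/-- A smooth approximation of `s ↦ |s|`, localized by a bump function. -/
def ridge (w ε s : ℝ) : ℝ := √(s ^ 2 + ε ^ 2) * cubeBump w s

/-- The derivative of `ridge`. -/
def ridgeDeriv (w ε s : ℝ) : ℝ :=
  s * (√(s ^ 2 + ε ^ 2))⁻¹ * cubeBump w s + √(s ^ 2 + ε ^ 2) * cubeBumpDeriv w s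

/-- The second derivative of `ridge`. -/
def ridgeDeriv₂ (w ε s : ℝ) : ℝ :=
  ε ^ 2 * (√(s ^ 2 + ε ^ 2) ^ 3)⁻¹ * cubeBump w s
    + 2 * (s * (√(s ^ 2 + ε ^ 2))⁻¹ * cubeBumpDeriv w s) + √(s ^ 2 + ε ^ 2) * cubeBumpDeriv₂ w s

section Ridge
variable {w ε : ℝ} (hε : 0 < ε) (s : ℝ)
include hε

theorem hasDerivAt_sqrt_sq_add : HasDerivAt (fun s => √(s ^ 2 + ε ^ 2))
    (s * (√(s ^ 2 + ε ^ 2))⁻¹) s := by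
  have h0 : HasDerivAt (fun s : ℝ => s ^ 2 + ε ^ 2) (2 * s) s := by
    simpa using (hasDerivAt_pow 2 s).add_const (ε ^ 2)
  convert! h0.sqrt (by positivity) using 1
  field_simp

theorem hasDerivAt_ridge : HasDerivAt (ridge w ε) (ridgeDeriv w ε s) s :=
  (hasDerivAt_sqrt_sq_add hε s).mul (hasDerivAt_cubeBump w s)

theorem hasDerivAt_ridgeDeriv : HasDerivAt (ridgeDeriv w ε) (ridgeDeriv₂ w ε s) s := by
  have h1 := hasDerivAt_sqrt_sq_add hε s
  have hpos : 0 < √(s ^ 2 + ε ^ 2) := Real.sqrt_pos.2 (by positivity)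
  have hsq : √(s ^ 2 + ε ^ 2) ^ 2 = s ^ 2 + ε ^ 2 := Real.sq_sqrt (by positivity)
  have h2 := (hasDerivAt_id s).fun_mul (h1.fun_inv hpos.ne')
  convert! (h2.fun_mul (hasDerivAt_cubeBump w s)).fun_add
    (h1.fun_mul (hasDerivAt_cubeBumpDeriv w s)) using 1
  simp only [ridgeDeriv₂, id]
  have h3 : ε ^ 2 * (√(s ^ 2 + ε ^ 2) ^ 3)⁻¹ = 1 * (√(s ^ 2 + ε ^ 2))⁻¹ +
      s * (-(s * (√(s ^ 2 + ε ^ 2))⁻¹) / √(s ^ 2 + ε ^ 2) ^ 2) := by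
    generalize √(s ^ 2 + ε ^ 2) = r at *
    have : ε ^ 2 = r ^ 2 - s ^ 2 := by linarith
    rw [this]
    field_simp
    ring
  rw [h3]
  ring

theorem contDiff_ridge : ContDiff ℝ 2 (ridge w ε) := by
  refine ContDiff.mul ?_ (contDiff_cubeBump w)
  refine contDiff_iff_contDiffAt.2 fun s => ContDiffAt.sqrt ?_ ?_
  · exact ((contDiff_id.pow 2).add contDiff_const).contDiffAt
  · have : s ^ 2 + ε ^ 2 ≠ 0 := by positivity
    exact this

theorem ridge_bounds (hε1 : ε ≤ 1) (hw : 0 ≤ w) (hw1 : w ≤ 1) (hs : |s| ≤ w) :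
    0 ≤ ridge w ε s ∧ ridge w ε s ≤ 2 ∧ |ridgeDeriv w ε s| ≤ 13 ∧
    0 ≤ ε ^ 2 * (√(s ^ 2 + ε ^ 2) ^ 3)⁻¹ * cubeBump w s ∧
    |ridgeDeriv₂ w ε s - ε ^ 2 * (√(s ^ 2 + ε ^ 2) ^ 3)⁻¹ * cubeBump w s| ≤ 60 := by
  obtain ⟨b0, b1, b2, b3⟩ := cubeBump_bounds hw hw1 hs
  have hpos : 0 < √(s ^ 2 + ε ^ 2) := Real.sqrt_pos.2 (by positivity)
  have hsr : |s| ≤ √(s ^ 2 + ε ^ 2) := Real.abs_le_sqrt (by nlinarith [sq_nonneg ε])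
  have hr2 : √(s ^ 2 + ε ^ 2) ≤ 2 := by
    rw [Real.sqrt_le_left (by norm_num), ← sq_abs s]
    nlinarith [abs_nonneg s]
  have hR' : |s * (√(s ^ 2 + ε ^ 2))⁻¹| ≤ 1 := by
    rw [abs_mul, abs_inv, abs_of_pos hpos, ← div_eq_mul_inv]
    exact (div_le_one hpos).2 hsr
  have m1 : |s * (√(s ^ 2 + ε ^ 2))⁻¹ * cubeBump w s| ≤ 1 * 1 := by
    rw [abs_mul]
    exact mul_le_mul hR' (by rwa [abs_of_nonneg b0]) (abs_nonneg _) zero_le_one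
  have m2 : |√(s ^ 2 + ε ^ 2) * cubeBumpDeriv w s| ≤ 2 * 6 := by
    rw [abs_mul, abs_of_pos hpos]
    exact mul_le_mul hr2 b2 (abs_nonneg _) zero_le_two
  have m3 : |s * (√(s ^ 2 + ε ^ 2))⁻¹ * cubeBumpDeriv w s| ≤ 1 * 6 := by
    rw [abs_mul]
    exact mul_le_mul hR' b2 (abs_nonneg _) zero_le_one
  have m4 : |√(s ^ 2 + ε ^ 2) * cubeBumpDeriv₂ w s| ≤ 2 * 24 := by
    rw [abs_mul, abs_of_pos hpos]
    exact mul_le_mul hr2 b3 (abs_nonneg _) zero_le_two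
  refine ⟨mul_nonneg hpos.le b0, ?_, ?_, by positivity, ?_⟩
  · exact (mul_le_mul hr2 b1 b0 zero_le_two).trans (by norm_num)
  · exact (abs_add_le _ _).trans (by linarith)
  · have : ridgeDeriv₂ w ε s - ε ^ 2 * (√(s ^ 2 + ε ^ 2) ^ 3)⁻¹ * cubeBump w s
      = 2 * (s * (√(s ^ 2 + ε ^ 2))⁻¹ * cubeBumpDeriv w s)
        + √(s ^ 2 + ε ^ 2) * cubeBumpDeriv₂ w s := by unfold ridgeDeriv₂; ring
    rw [this]
    refine (abs_add_le _ _).trans ?_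
    rw [abs_mul, abs_two]
    linarith

end Ridge

/-- A function `h` with bounded first and second derivatives on the interval of half-length `2 * w`
about `m`, whose graph over the `i`-th coordinate axis has a tubular neighbourhood in the ball of
radius `2`. -/
structure IsTameGraph (i j : Fin 2) (m w : ℝ) (h : ℝ → ℝ) : Prop where
  ne : i ≠ j
  width_pos : 0 < w
  width_le : w ≤ 1
  contDiffAt : ∀ s ∈ Ioo (m - 2 * w) (m + 2 * w), ContDiffAt ℝ 2 h s
  deriv_le : ∀ s ∈ Ioo (m - 2 * w) (m + 2 * w), |deriv h s| ≤ 8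
  deriv₂_le : ∀ s ∈ Ioo (m - 2 * w) (m + 2 * w), |deriv (deriv h) s| ≤ 150
  tube : ∀ y : Plane, |y i - m| ≤ w → |y j - h (y i)| ≤ w → y ∈ closedBall (0 : Plane) 2

/-- The test function concentrated near a graph. -/
def graphBump (i j : Fin 2) (m w : ℝ) (h : ℝ → ℝ) (ε : ℝ) (y : Plane) : ℝ :=
  cubeBump w (y i - m) * ridge w ε (y j - h (y i))

theorem fin_two_cases : ∀ i j : Fin 2, i ≠ j → (i = 0 ∧ j = 1) ∨ (i = 1 ∧ j = 0) := by decide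

theorem abs_mul_le_of_le {x y b c : ℝ} (hx : |x| ≤ b) (hy : |y| ≤ c) : |x * y| ≤ b * c := by
  rw [abs_mul]
  exact mul_le_mul hx hy (abs_nonneg _) ((abs_nonneg _).trans hx)

/-- The numerical estimate behind `divOp_graphBump_ge`. -/
theorem graph_inequality {p p₁ p₂ q q₁ q₂ e ci cj aii ajj aij d d₂ : ℝ} (hp0 : 0 ≤ p) (hp1 : p ≤ 1)
    (hp₁ : |p₁| ≤ 6) (hp₂ : |p₂| ≤ 24) (hq0 : 0 ≤ q) (hq2 : q ≤ 2) (hq₁ : |q₁| ≤ 13) (he : 0 ≤ e)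
    (hq₂ : |q₂ - e| ≤ 60) (hci : |ci| ≤ 1 / 200) (hcj : |cj| ≤ 1 / 200) (haii : |aii - 1| ≤ 1 / 400)
    (hajj : |ajj - 1| ≤ 1 / 400) (haij : |aij| ≤ 1 / 400) (hd : |d| ≤ 8) (hd₂ : |d₂| ≤ 150) :
    1 / 2 * (p * e) - 10000 ≤ p * (q₁ * (cj - (d * ci + d₂ * aii))
      + q₂ * (ajj - 2 * d * aij + d ^ 2 * aii)) + q * (p₁ * ci + p₂ * aii)
      + 2 * (p₁ * q₁ * (aij - d * aii)) := by
  have haii' : |aii| ≤ 401 / 400 := by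
    rw [abs_le] at haii ⊢; constructor <;> linarith
  have hpa : |p| ≤ 1 := by rwa [abs_of_nonneg hp0]
  have hqa : |q| ≤ 2 := by rwa [abs_of_nonneg hq0]
  have t1 : |cj - (d * ci + d₂ * aii)| ≤ 151 := by
    have e1 := abs_le.1 (abs_mul_le_of_le hd hci)
    have e2 := abs_le.1 (abs_mul_le_of_le hd₂ haii')
    have e3 := abs_le.1 hcj
    rw [abs_le]; constructor <;> linarith [e1.1, e1.2, e2.1, e2.2, e3.1, e3.2]
  have hd2 : |d ^ 2| ≤ 64 := by
    rw [sq]; exact (abs_mul_le_of_le hd hd).trans (by norm_num)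
  have edij := abs_le.1 (abs_mul_le_of_le hd haij)
  have t2 : |ajj - 2 * d * aij + d ^ 2 * aii| ≤ 70 := by
    have e2 := abs_le.1 (abs_mul_le_of_le hd2 haii')
    have e3 := abs_le.1 hajj
    rw [abs_le]; constructor <;> linarith [edij.1, edij.2, e2.1, e2.2, e3.1, e3.2]
  have t3 : 1 / 2 ≤ ajj - 2 * d * aij + d ^ 2 * aii := by
    have e1 := abs_le.1 haii
    have e3 := abs_le.1 hajj
    have h0 : 0 ≤ d ^ 2 * aii := mul_nonneg (sq_nonneg d) (by linarith [e1.1])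
    linarith [edij.1, edij.2, e3.1, e3.2]
  have t4 : |aij - d * aii| ≤ 9 := by
    have e1 := abs_le.1 (abs_mul_le_of_le hd haii')
    have e3 := abs_le.1 haij
    rw [abs_le]; constructor <;> linarith [e1.1, e1.2, e3.1, e3.2]
  have t5 : |p₁ * ci + p₂ * aii| ≤ 25 := by
    have e1 := abs_le.1 (abs_mul_le_of_le hp₁ hci)
    have e2 := abs_le.1 (abs_mul_le_of_le hp₂ haii')
    rw [abs_le]; constructor <;> linarith [e1.1, e1.2, e2.1, e2.2]
  have u1 := abs_le.1 (abs_mul_le_of_le hpa (abs_mul_le_of_le hq₁ t1))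
  have u2 := abs_le.1 (abs_mul_le_of_le hpa (abs_mul_le_of_le hq₂ t2))
  have u3 := abs_le.1 (abs_mul_le_of_le hqa t5)
  have u4 := abs_le.1 (abs_mul_le_of_le (abs_mul_le_of_le hp₁ hq₁) t4)
  have u5 : 1 / 2 * (p * e) ≤ p * e * (ajj - 2 * d * aij + d ^ 2 * aii) := by
    have := mul_le_mul_of_nonneg_left t3 (mul_nonneg hp0 he)
    linarith
  linarith [u1.1, u2.1, u3.1, u4.1]

section Graph

variable {i j : Fin 2} {m w : ℝ} {h : ℝ → ℝ} (hg : IsTameGraph i j m w h) {ε : ℝ} (hε : 0 < ε)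
include hg

theorem graphBump_eq_zero {y : Plane} (hy : ¬ (|y i - m| ≤ w ∧ |y j - h (y i)| ≤ w)) :
    graphBump i j m w h ε y = 0 := by
  by_cases h1 : |y i - m| ≤ w
  · have h2 : w ≤ |y j - h (y i)| := by
      by_contra hcon
      exact hy ⟨h1, (not_le.1 hcon).le⟩
    rw [graphBump, ridge, cubeBump_eq_zero hg.width_pos.le h2]; simp
  · rw [graphBump, cubeBump_eq_zero hg.width_pos.le (not_le.1 h1).le, zero_mul]

theorem contDiffAt_graphFun {y : Plane} (hy : y i ∈ Ioo (m - 2 * w) (m + 2 * w)) :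
    ContDiffAt ℝ 2 (fun y : Plane => y j - h (y i)) y :=
  (contDiff_coord j).contDiffAt.sub
    (ContDiffAt.comp y (hg.contDiffAt _ hy) (contDiff_coord i).contDiffAt)

include hε

theorem contDiff_graphBump : ContDiff ℝ 2 (graphBump i j m w h ε) := by
  refine contDiff_iff_contDiffAt.2 fun y => ?_
  by_cases hy : |y i - m| ≤ w
  · have hy' : y i ∈ Ioo (m - 2 * w) (m + 2 * w) := by
      have := abs_le.1 hy
      have := hg.width_pos
      constructor <;> linarith
    refine ContDiffAt.mul ?_ ?_
    · exact (contDiff_cubeBump w).contDiffAt.comp y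
        ((contDiff_coord i).contDiffAt.sub contDiffAt_const)
    · exact (contDiff_ridge hε).contDiffAt.comp y (contDiffAt_graphFun hg hy')
  · have hopen : ∀ᶠ z : Plane in 𝓝 y, w < |z i - m| := by
      have hcont : ContinuousAt (fun z : Plane => |z i - m|) y :=
        (((contDiff_coord (n := 0) i).continuous.sub continuous_const).abs).continuousAt
      exact hcont.eventually (lt_mem_nhds (not_le.1 hy))
    refine contDiffAt_const (c := 0) |>.congr_of_eventuallyEq ?_
    filter_upwards [hopen] with z hz
    exact graphBump_eq_zero hg fun h => absurd h.1 (not_le.2 hz)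

/-- The main term of `L φ` for the test function `φ` concentrated near a graph, with an explicit bound
for the remainder. -/
theorem divOp_graphBump_ge {a : Plane → Matrix (Fin 2) (Fin 2) ℝ} (ha : NearlyFlat a)
    (hε1 : ε ≤ 1) {y : Plane} (hy : |y i - m| ≤ w ∧ |y j - h (y i)| ≤ w) :
    1 / 2 * (cubeBump w (y i - m) * (ε ^ 2 * (√((y j - h (y i)) ^ 2 + ε ^ 2) ^ 3)⁻¹
      * cubeBump w (y j - h (y i)))) - 10000 ≤ divOp a (graphBump i j m w h ε) y := by
  have hy5 : y ∈ closedBall (0 : Plane) 5 :=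
    closedBall_subset_closedBall (by norm_num) (hg.tube y hy.1 hy.2)
  have hyI : y i ∈ Ioo (m - 2 * w) (m + 2 * w) := by
    have := abs_le.1 hy.1
    have := hg.width_pos
    constructor <;> linarith
  have hda := ha.differentiableAt hy5
  have hci : ContDiffAt ℝ 2 (fun z : Plane => z i) y := (contDiff_coord i).contDiffAt
  have hcj : ContDiffAt ℝ 2 (fun z : Plane => z j) y := (contDiff_coord j).contDiffAt
  have hcm : ContDiffAt ℝ 2 (fun z : Plane => z i - m) y := hci.sub contDiffAt_const
  have hcf := contDiffAt_graphFun hg hyI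
  have hch : ContDiffAt ℝ 2 (fun z : Plane => h (z i)) y :=
    ContDiffAt.comp y (hg.contDiffAt _ hyI) hci
  have hhd : ∀ᶠ s in 𝓝 (y i), HasDerivAt h (deriv h s) s := by
    filter_upwards [isOpen_Ioo.mem_nhds hyI] with s hs
    exact ((hg.contDiffAt s hs).differentiableAt (by norm_num)).hasDerivAt
  have hhd2 : HasDerivAt (deriv h) (deriv (deriv h) (y i)) (y i) := by
    have h1 : ContDiffAt ℝ 1 (deriv h) (y i) :=
      ((hg.contDiffAt _ hyI).fderiv_right (m := 1) (by norm_num)).clm_apply contDiffAt_const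
    exact (h1.differentiableAt (by norm_num)).hasDerivAt
  have hdh := divOp_comp hda hci hhd hhd2 (hg.contDiffAt _ hyI)
  have hdf := divOp_sub hda hcj hch
  have hdm : divOp a (fun z : Plane => z i - m) y = divOp a (fun z : Plane => z i) y := by
    rw [divOp_sub hda hci contDiffAt_const]
    simp [divOp, partialDeriv_const]
  have hdP := divOp_comp hda hcm (Eventually.of_forall (hasDerivAt_cubeBump w))
    (hasDerivAt_cubeBumpDeriv w _) (contDiff_cubeBump w).contDiffAt
  have hdQ := divOp_comp hda hcf (Eventually.of_forall (hasDerivAt_ridge (w := w) hε))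
    (hasDerivAt_ridgeDeriv hε _) (contDiff_ridge hε).contDiffAt
  have hmul := divOp_mul hda ((contDiff_cubeBump w).contDiffAt.comp y hcm)
    ((contDiff_ridge (w := w) hε).contDiffAt.comp y hcf)
  have pm : ∀ k, partialDeriv k (fun z : Plane => z i - m) y = if i = k then 1 else 0 := by
    intro k
    rw [partialDeriv_sub (hci.differentiableAt (by norm_num)) (differentiableAt_const _),
      partialDeriv_const, partialDeriv_coord, sub_zero]
  have pf : ∀ k, partialDeriv k (fun z : Plane => z j - h (z i)) y
      = (if j = k then 1 else 0) - deriv h (y i) * (if i = k then 1 else 0) := by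
    intro k
    rw [partialDeriv_sub (hcj.differentiableAt (by norm_num)) (hch.differentiableAt (by norm_num)),
      partialDeriv_comp hhd.self_of_nhds (hci.differentiableAt (by norm_num)), partialDeriv_coord,
      partialDeriv_coord]
  have pP : ∀ k, partialDeriv k (cubeBump w ∘ fun z : Plane => z i - m) y
      = cubeBumpDeriv w (y i - m) * (if i = k then 1 else 0) := by
    intro k
    rw [← pm k]
    exact partialDeriv_comp (hasDerivAt_cubeBump w _) (hcm.differentiableAt (by norm_num))
  have pQ : ∀ k, partialDeriv k (ridge w ε ∘ fun z : Plane => z j - h (z i)) y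
      = ridgeDeriv w ε (y j - h (y i)) *
        ((if j = k then 1 else 0) - deriv h (y i) * (if i = k then 1 else 0)) := by
    intro k
    rw [← pf k]
    exact partialDeriv_comp (hasDerivAt_ridge hε _) (hcf.differentiableAt (by norm_num))
  obtain ⟨p0, p1, p2, p3⟩ := cubeBump_bounds hg.width_pos.le hg.width_le hy.1
  obtain ⟨q0, q1, q2, q3, q4⟩ := ridge_bounds hε _ hε1 hg.width_pos.le hg.width_le hy.2
  have hc : ∀ k, |∑ l, partialDeriv l (fun z => a z l k) y| ≤ 1 / 200 := by
    intro k
    rw [Fin.sum_univ_two]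
    exact (abs_add_le _ _).trans (by linarith [ha.deriv y hy5 0 0 k, ha.deriv y hy5 1 1 k])
  have key := graph_inequality p0 p1 p2 p3 q0 q1 q2 q3 q4 (hc i) (hc j) (ha.diag y hy5 i)
    (ha.diag y hy5 j) (ha.off_diag y hy5 i j hg.ne) (hg.deriv_le _ hyI) (hg.deriv₂_le _ hyI)
  refine key.trans (le_of_eq ?_)
  have hφ : graphBump i j m w h ε = fun z => (cubeBump w ∘ fun z : Plane => z i - m) z
    * (ridge w ε ∘ fun z : Plane => z j - h (z i)) z := rfl
  rw [hφ, hmul]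
  have hdP' : divOp a (cubeBump w ∘ fun z : Plane => z i - m) y = _ := hdP
  have hdQ' : divOp a (ridge w ε ∘ fun z : Plane => z j - h (z i)) y = _ := hdQ
  rw [hdP', hdQ', hdf, hdh, hdm, divOp_coord hda, divOp_coord hda]
  simp only [pP, pQ, pm, pf, partialDeriv_coord, Function.comp]
  rcases fin_two_cases i j hg.ne with ⟨rfl, rfl⟩ | ⟨rfl, rfl⟩
  · simp only [Fin.sum_univ_two, Fin.isValue, if_true, if_false, Fin.reduceEq, ha.symm y 1 0]
    ring
  · simp only [Fin.sum_univ_two, Fin.isValue, if_true, if_false, Fin.reduceEq, ha.symm y 0 1]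
    ring

theorem divOp_graphBump_eq_zero (a : Plane → Matrix (Fin 2) (Fin 2) ℝ) {y : Plane}
    (hy : ¬ (|y i - m| ≤ w ∧ |y j - h (y i)| ≤ w)) : divOp a (graphBump i j m w h ε) y = 0 := by
  have hnear : ∀ᶠ z : Plane in 𝓝 y, ¬ (|z i - m| ≤ w ∧ |z j - h (z i)| ≤ w) := by
    by_cases h1 : |y i - m| ≤ w
    · have hyI : y i ∈ Ioo (m - 2 * w) (m + 2 * w) := by
        have := abs_le.1 h1
        have := hg.width_pos
        constructor <;> linarith
      have hcont := (contDiffAt_graphFun hg hyI).continuousAt.abs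
      have h2 : w < |y j - h (y i)| := not_le.1 fun h2 => hy ⟨h1, h2⟩
      filter_upwards [hcont.eventually (lt_mem_nhds h2)] with z hz h3
      exact absurd h3.2 (not_le.2 hz)
    · have hcont : ContinuousAt (fun z : Plane => |z i - m|) y :=
        (((contDiff_coord (n := 0) i).continuous.sub continuous_const).abs).continuousAt
      filter_upwards [hcont.eventually (lt_mem_nhds (not_le.1 h1))] with z hz h3
      exact absurd h3.1 (not_le.2 hz)
  have h0 : graphBump i j m w h ε =ᶠ[𝓝 y] fun _ => 0 := by
    filter_upwards [hnear] with z hz using graphBump_eq_zero hg hz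
  rw [divOp_congr h0]
  simp [divOp, partialDeriv_const]

/-- The integral of a nonnegative supersolution over a thin strip about a graph. -/
theorem setIntegral_strip_le {a : Plane → Matrix (Fin 2) (Fin 2) ℝ} {v : Plane → ℝ}
    (ha : NearlyFlat a) (hv : IsNonnegSupersolution a v) (hεw : ε ≤ w / 2)
    {E : Set Plane} (hE : MeasurableSet E)
    (hEsub : ∀ y ∈ E, |y i - m| ≤ w / 2 ∧ |y j - h (y i)| ≤ ε) :
    1 / 16 * (w ^ 2 / 2) ^ 6 / ε * ∫ y in E, v y
      ≤ 30 + 10000 * ∫ y in closedBall (0 : Plane) 2, v y := by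
  have hw := hg.width_pos
  have hε1 : ε ≤ 1 := by linarith [hg.width_le]
  set φ := graphBump i j m w h ε with hφ
  have hsub25 : closedBall (0 : Plane) 2 ⊆ closedBall 0 5 := closedBall_subset_closedBall (by norm_num)
  have hEtube : ∀ y ∈ E, |y i - m| ≤ w ∧ |y j - h (y i)| ≤ w := fun y hy =>
    ⟨(hEsub y hy).1.trans (by linarith), (hEsub y hy).2.trans (by linarith)⟩
  have hE2 : E ⊆ closedBall (0 : Plane) 2 := fun y hy => hg.tube y (hEtube y hy).1 (hEtube y hy).2
  have hφ0 : ∀ y, 0 ≤ φ y := by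
    intro y
    simp only [hφ, graphBump, ridge, cubeBump]
    positivity
  have hφz : ∀ y ∉ closedBall (0 : Plane) 2, φ y = 0 := fun y hy =>
    graphBump_eq_zero hg fun h => hy (hg.tube y h.1 h.2)
  have hφ2 : ∀ y, φ y ≤ (closedBall (0 : Plane) 2).indicator (fun _ => 2) y := by
    intro y
    by_cases hy : |y i - m| ≤ w ∧ |y j - h (y i)| ≤ w
    · rw [indicator_of_mem (hg.tube y hy.1 hy.2)]
      obtain ⟨p0, p1, -, -⟩ := cubeBump_bounds hg.width_pos.le hg.width_le hy.1
      obtain ⟨q0, q1, -⟩ := ridge_bounds hε _ hε1 hg.width_pos.le hg.width_le hy.2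
      calc φ y ≤ 1 * 2 := mul_le_mul p1 q1 q0 zero_le_one
        _ = 2 := one_mul _
    · rw [hφ, graphBump_eq_zero hg hy]
      exact indicator_nonneg (fun _ _ => zero_le_two) y
  obtain ⟨h1, h2⟩ := hv.integral_mul_divOp_le ha (contDiff_graphBump hg hε) hφ0
    (fun y hy => hφz y fun h => hy (hsub25 h))
  have hi2 : IntegrableOn v (closedBall 0 2) := hv.integrableOn hsub25
  have hj1 := ((integrable_indicator_iff hE).2 (hi2.mono_set hE2)).const_mul
    (1 / 16 * (w ^ 2 / 2) ^ 6 / ε)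
  have hj2 := ((integrable_indicator_iff measurableSet_closedBall).2 hi2).const_mul 10000
  have h3 : ∫ y, (1 / 16 * (w ^ 2 / 2) ^ 6 / ε * E.indicator v y
      - 10000 * (closedBall (0 : Plane) 2).indicator v y) ≤ ∫ y, v y * divOp a φ y := by
    refine integral_mono (hj1.sub hj2) h1 fun y => ?_
    have hv0 := hv.nonneg y
    by_cases hy : |y i - m| ≤ w ∧ |y j - h (y i)| ≤ w
    · have key := divOp_graphBump_ge hg hε ha hε1 hy
      simp only
      rw [indicator_of_mem (hg.tube y hy.1 hy.2)]
      have hmain : (1 / 16 * (w ^ 2 / 2) ^ 6 / ε) * E.indicator (fun _ => (1 : ℝ)) y ≤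
          1 / 2 * (cubeBump w (y i - m) * (ε ^ 2 * (√((y j - h (y i)) ^ 2 + ε ^ 2) ^ 3)⁻¹
            * cubeBump w (y j - h (y i)))) := by
        by_cases hyE : y ∈ E
        · rw [indicator_of_mem hyE, mul_one]
          obtain ⟨e1, e2⟩ := hEsub y hyE
          have hb : ∀ s, |s| ≤ w / 2 → (w ^ 2 / 2) ^ 3 ≤ cubeBump w s := by
            intro s hs
            refine pow_le_pow_left₀ (by positivity) (le_trans ?_ (le_max_left _ _)) 3
            rw [← sq_abs s]
            nlinarith [abs_nonneg s]
          have hb1 := hb _ e1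
          have hb2 := hb _ (e2.trans hεw)
          have hp0 : 0 ≤ cubeBump w (y i - m) := le_trans (by positivity) hb1
          have hsqrt : √((y j - h (y i)) ^ 2 + ε ^ 2) ≤ 2 * ε := by
            rw [Real.sqrt_le_left (by positivity), ← sq_abs]
            nlinarith [abs_nonneg (y j - h (y i))]
          have hspos : 0 < √((y j - h (y i)) ^ 2 + ε ^ 2) := Real.sqrt_pos.2 (by positivity)
          have hinv : ((2 * ε) ^ 3)⁻¹ ≤ (√((y j - h (y i)) ^ 2 + ε ^ 2) ^ 3)⁻¹ :=
            inv_anti₀ (by positivity) (pow_le_pow_left₀ hspos.le hsqrt 3)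
          calc 1 / 16 * (w ^ 2 / 2) ^ 6 / ε
              = 1 / 2 * ((w ^ 2 / 2) ^ 3 * (ε ^ 2 * ((2 * ε) ^ 3)⁻¹ * (w ^ 2 / 2) ^ 3)) := by
                field_simp; norm_num
            _ ≤ _ := by gcongr
        · rw [indicator_of_notMem hyE, mul_zero]
          obtain ⟨p0, -⟩ := cubeBump_bounds hg.width_pos.le hg.width_le hy.1
          obtain ⟨-, -, -, q3, -⟩ := ridge_bounds hε _ hε1 hg.width_pos.le hg.width_le hy.2
          positivity
      have hEv : E.indicator v y = v y * E.indicator (fun _ => (1 : ℝ)) y := by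
        by_cases hyE : y ∈ E <;> simp [hyE]
      rw [hEv]
      have := mul_le_mul_of_nonneg_left (le_trans (sub_le_sub_right hmain 10000) key) hv0
      linarith
    · simp only
      rw [hφ, divOp_graphBump_eq_zero hg hε a hy,
        indicator_of_notMem (fun hyE => hy (hEtube y hyE))]
      have : 0 ≤ (closedBall (0 : Plane) 2).indicator v y := indicator_nonneg (fun y _ => hv.nonneg y) y
      linarith
  have h4 : ∫ y, φ y ≤ 30 := by
    have hic : Integrable ((closedBall (0 : Plane) 2).indicator fun _ => (2 : ℝ)) :=
      (integrable_indicator_iff measurableSet_closedBall).2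
        (integrableOn_const measure_closedBall_lt_top.ne)
    calc ∫ y, φ y ≤ ∫ y, (closedBall (0 : Plane) 2).indicator (fun _ => (2 : ℝ)) y :=
          integral_mono_of_nonneg (Eventually.of_forall hφ0) hic (Eventually.of_forall hφ2)
      _ = 8 * Real.pi := by
          rw [integral_indicator measurableSet_closedBall, setIntegral_const, measureReal_def,
            EuclideanSpace.volume_closedBall_fin_two, ENNReal.toReal_mul, ENNReal.toReal_pow,
            ENNReal.toReal_ofReal (by positivity), ENNReal.toReal_ofReal Real.pi_nonneg]
          simp only [smul_eq_mul]
          ring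
      _ ≤ 30 := by linarith [Real.pi_lt_d2]
  rw [integral_sub hj1 hj2, integral_const_mul, integral_const_mul, integral_indicator hE,
    integral_indicator measurableSet_closedBall] at h3
  linarith

end Graph

/-- The point of the plane whose `i`-th coordinate is `s` and whose other coordinate is `t`. -/
def graphPoint (i : Fin 2) (s t : ℝ) : Plane := WithLp.toLp 2 fun k => if k = i then s else t

theorem graphPoint_self (i : Fin 2) (s t : ℝ) : graphPoint i s t i = s := by simp [graphPoint]

theorem graphPoint_ne {i j : Fin 2} (hij : i ≠ j) (s t : ℝ) : graphPoint i s t j = t := by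
  simp [graphPoint, hij.symm]

theorem continuous_graphPoint (i : Fin 2) : Continuous fun p : ℝ × ℝ => graphPoint i p.1 p.2 := by
  unfold graphPoint
  refine (PiLp.continuous_toLp 2 _).comp (continuous_pi fun k => ?_)
  by_cases hk : k = i
  · simp only [hk, if_true]; exact continuous_fst
  · simp only [hk, if_false]; exact continuous_snd

theorem dist_graphPoint (i : Fin 2) (s t t' : ℝ) :
    dist (graphPoint i s t) (graphPoint i s t') = |t - t'| := by
  rw [EuclideanSpace.dist_eq, Fin.sum_univ_two]
  fin_cases i <;> simp [graphPoint, Real.dist_eq, Real.sqrt_sq_eq_abs]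

theorem measurePreserving_graphPoint (i : Fin 2) :
    MeasurePreserving (fun p : ℝ × ℝ => graphPoint i p.1 p.2) := by
  have h0 : MeasurePreserving (fun p : ℝ × ℝ => graphPoint 0 p.1 p.2) := by
    have := (PiLp.volume_preserving_toLp (Fin 2)).comp ((volume_preserving_finTwoArrow ℝ).symm _)
    convert! this using 1
    funext p
    ext k
    fin_cases k <;> simp [graphPoint]
  fin_cases i
  · exact h0
  · have := h0.comp (Measure.measurePreserving_swap (μ := (volume : Measure ℝ)) (ν := volume))
    convert! this using 1
    funext p
    ext k
    fin_cases k <;> simp [graphPoint]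

theorem graphPoint_injective (i : Fin 2) :
    Function.Injective fun p : ℝ × ℝ => graphPoint i p.1 p.2 := by
  obtain ⟨j, hij⟩ := exists_ne i
  intro p q hpq
  have h1 := congrArg (fun y : Plane => y i) hpq
  have h2 := congrArg (fun y : Plane => y j) hpq
  simp only [graphPoint_self, graphPoint_ne hij.symm] at h1 h2
  exact Prod.ext h1 h2

/-- The integral of a nonnegative supersolution along a tame graph is controlled by its integral over
a disc. -/
theorem exists_integral_graph_le {w : ℝ} (hw : 0 < w) :
    ∃ C : ℝ, 0 < C ∧ ∀ (a : Plane → Matrix (Fin 2) (Fin 2) ℝ) (v : Plane → ℝ) (i j : Fin 2) (m : ℝ)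
      (h : ℝ → ℝ), NearlyFlat a → IsNonnegSupersolution a v → IsTameGraph i j m w h →
      ∫ s in Icc (m - w / 2) (m + w / 2), v (graphPoint i s (h s))
        ≤ C * (1 + ∫ y in closedBall (0 : Plane) 2, v y) := by
  set κ := 1 / 16 * (w ^ 2 / 2) ^ 6 with hκ
  have hκ0 : 0 < κ := by positivity
  refine ⟨(10000 / κ) / 2 + w, by positivity, fun a v i j m h ha hv hg => ?_⟩
  set I := Icc (m - w / 2) (m + w / 2) with hI
  have hIJ : ∀ s ∈ I, s ∈ Ioo (m - 2 * w) (m + 2 * w) := fun s hs =>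
    ⟨by linarith [hs.1], by linarith [hs.2]⟩
  have hIabs : ∀ s, s ∈ I ↔ |s - m| ≤ w / 2 := fun s => by
    rw [hI, mem_Icc, abs_le]; constructor <;> rintro ⟨h1, h2⟩ <;> constructor <;> linarith
  have hhc : ContinuousOn h I := fun s hs =>
    (hg.contDiffAt s (hIJ s hs)).continuousAt.continuousWithinAt
  have hsub25 : closedBall (0 : Plane) 2 ⊆ closedBall 0 5 := closedBall_subset_closedBall (by norm_num)
  have htube : ∀ s ∈ I, ∀ t, |t - h s| ≤ w → graphPoint i s t ∈ closedBall (0 : Plane) 2 := by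
    intro s hs t ht
    refine hg.tube _ ?_ ?_
    · rw [graphPoint_self]; exact ((hIabs s).1 hs).trans (by linarith)
    · rwa [graphPoint_self, graphPoint_ne hg.ne]
  -- in a thin strip about the graph, `v` is at least its value on the graph minus one
  have huc := (isCompact_closedBall (0 : Plane) 5).uniformContinuousOn_of_continuous hv.continuousOn
  obtain ⟨r, hr, hru⟩ := Metric.uniformContinuousOn_iff_le.1 huc 1 one_pos
  set ε := min r (w / 2) with hε_def
  have hε : 0 < ε := lt_min hr (by positivity)
  have hεw : ε ≤ w / 2 := min_le_right _ _
  set g : ℝ → ℝ := fun s => v (graphPoint i s (h s)) with hg_def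
  have hgcont : ContinuousOn g I := by
    refine hv.continuousOn.comp ?_ fun s hs => hsub25 (htube s hs _ (by simpa using hw.le))
    exact (continuous_graphPoint i).comp_continuousOn (continuousOn_id.prodMk hhc)
  set E' : Set (ℝ × ℝ) := {p | p.1 ∈ I ∧ |p.2 - h p.1| ≤ ε} with hE'
  have hE'closed : IsClosed E' := by
    have h1 : IsClosed {p : ℝ × ℝ | p.1 ∈ I} := isClosed_Icc.preimage continuous_fst
    have h2 : ContinuousOn (fun p : ℝ × ℝ => |p.2 - h p.1|) {p : ℝ × ℝ | p.1 ∈ I} :=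
      (continuous_snd.continuousOn.sub
        (hhc.comp continuous_fst.continuousOn fun p hp => hp)).abs
    exact h2.preimage_isClosed_of_isClosed h1 isClosed_Iic
  have hmp := measurePreserving_graphPoint i
  have hemb : MeasurableEmbedding (fun p : ℝ × ℝ => graphPoint i p.1 p.2) :=
    (continuous_graphPoint i).measurableEmbedding (graphPoint_injective i)
  set E : Set Plane := (fun p : ℝ × ℝ => graphPoint i p.1 p.2) '' E' with hE
  have hEm : MeasurableSet E := hemb.measurableSet_image.2 hE'closed.measurableSet
  have hEsub : ∀ y ∈ E, |y i - m| ≤ w / 2 ∧ |y j - h (y i)| ≤ ε := by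
    rintro _ ⟨p, hp, rfl⟩
    simp only [graphPoint_self, graphPoint_ne hg.ne]
    exact ⟨(hIabs _).1 hp.1, hp.2⟩
  have hkey := setIntegral_strip_le hg hε ha hv hεw hEm hEsub
  have hE2 : E ⊆ closedBall (0 : Plane) 2 := by
    rintro _ ⟨p, hp, rfl⟩
    exact htube _ hp.1 _ (hp.2.trans (by linarith))
  have hint : IntegrableOn v E := hv.integrableOn (hE2.trans hsub25)
  have htrans : ∫ y in E, v y = ∫ p in E', v (graphPoint i p.1 p.2) :=
    hmp.setIntegral_image_emb hemb v E'
  have hint' : IntegrableOn (fun p : ℝ × ℝ => v (graphPoint i p.1 p.2)) E' :=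
    (hmp.integrableOn_image hemb).1 hint
  -- the strip has width `2 * ε` over every point of the interval
  have hind : ∀ s t, E'.indicator (fun p : ℝ × ℝ => g p.1 - 1) (s, t)
      = I.indicator (fun s => (Icc (h s - ε) (h s + ε)).indicator (fun _ => g s - 1) t) s := by
    intro s t
    by_cases hs : s ∈ I
    · have : (s, t) ∈ E' ↔ t ∈ Icc (h s - ε) (h s + ε) := by
        simp only [hE', mem_ofPred_eq, hs, true_and, abs_le, mem_Icc]
        constructor <;> rintro ⟨h1, h2⟩ <;> constructor <;> linarith
      by_cases ht : t ∈ Icc (h s - ε) (h s + ε)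
      · rw [indicator_of_mem hs, indicator_of_mem ht, indicator_of_mem (this.2 ht)]
      · rw [indicator_of_mem hs, indicator_of_notMem ht,
          indicator_of_notMem (fun h' => ht (this.1 h'))]
    · rw [indicator_of_notMem hs, indicator_of_notMem (fun h' => hs h'.1)]
  have hE'fin : volume E' < ⊤ := by
    rw [← hemb.injective.preimage_image E', hmp.measure_preimage hEm.nullMeasurableSet]
    exact (measure_mono hE2).trans_lt measure_closedBall_lt_top
  obtain ⟨B, hB⟩ := isCompact_Icc.exists_bound_of_continuousOn
    (hgcont.sub (continuousOn_const (c := (1 : ℝ))))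
  have hgE' : IntegrableOn (fun p : ℝ × ℝ => g p.1 - 1) E' := by
    have h0 : ContinuousOn (fun p : ℝ × ℝ => g p.1 - 1) E' :=
      (hgcont.comp continuous_fst.continuousOn fun p hp => hp.1).sub continuousOn_const
    have : IsFiniteMeasure (volume.restrict E') := ⟨by simpa using hE'fin⟩
    exact Integrable.of_bound (h0.aestronglyMeasurable hE'closed.measurableSet) B
      ((ae_restrict_iff' hE'closed.measurableSet).2
        (Eventually.of_forall fun p hp => hB p.1 hp.1))
  have h5 : ∫ p in E', (g p.1 - 1) ≤ ∫ p in E', v (graphPoint i p.1 p.2) := by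
    refine setIntegral_mono_on hgE' hint' hE'closed.measurableSet fun p hp => ?_
    have h1 := hru _ (hsub25 (htube p.1 hp.1 (h p.1) (by simpa using hw.le)))
      _ (hsub25 (htube p.1 hp.1 p.2 (hp.2.trans (by linarith)))) (by
        rw [dist_graphPoint, abs_sub_comm]
        exact hp.2.trans (min_le_left _ _))
    rw [Real.dist_eq] at h1
    have := (abs_le.1 h1).2
    simp only [hg_def]
    linarith
  have hgI : IntegrableOn g I := hgcont.integrableOn_compact isCompact_Icc
  have h6 : ∫ p in E', (g p.1 - 1) = 2 * ε * ((∫ s in I, g s) - w) := by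
    rw [← integral_indicator hE'closed.measurableSet, Measure.volume_eq_prod, integral_prod _
      ((integrable_indicator_iff hE'closed.measurableSet).2 hgE')]
    simp only [hind]
    have h7 : ∀ s, ∫ t, I.indicator
        (fun s => (Icc (h s - ε) (h s + ε)).indicator (fun _ => g s - 1) t) s
        = I.indicator (fun s => 2 * ε * (g s - 1)) s := by
      intro s
      by_cases hs : s ∈ I
      · simp only [indicator_of_mem hs]
        rw [integral_indicator measurableSet_Icc, setIntegral_const, Real.volume_real_Icc_of_le
          (by linarith), smul_eq_mul]
        ring
      · simp only [indicator_of_notMem hs, integral_zero]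
    simp only [h7]
    rw [integral_indicator measurableSet_Icc, integral_const_mul, integral_sub hgI
      (integrableOn_const (by simp [hI])), setIntegral_const,
      Real.volume_real_Icc_of_le (by linarith), smul_eq_mul]
    ring
  have hV : 0 ≤ ∫ y in closedBall (0 : Plane) 2, v y :=
    setIntegral_nonneg measurableSet_closedBall fun y _ => hv.nonneg y
  set V := ∫ y in closedBall (0 : Plane) 2, v y
  have h8 : ∫ y in E, v y ≤ ε / κ * (30 + 10000 * V) := by
    rw [div_mul_eq_mul_div, div_le_iff₀ hε, ← hκ] at hkey
    rw [div_mul_eq_mul_div, le_div_iff₀ hκ0]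
    linarith
  have h9 : 2 * ε * ((∫ s in I, g s) - w) ≤ ε / κ * (30 + 10000 * V) := by
    rw [← h6]; exact (h5.trans_eq htrans.symm).trans h8
  have h10 : 2 * ((∫ s in I, g s) - w) ≤ 1 / κ * (30 + 10000 * V) := by
    have : ε * (2 * ((∫ s in I, g s) - w)) ≤ ε * (1 / κ * (30 + 10000 * V)) := by
      calc ε * (2 * ((∫ s in I, g s) - w)) = 2 * ε * ((∫ s in I, g s) - w) := by ring
        _ ≤ _ := h9
        _ = _ := by ring
    exact le_of_mul_le_mul_left this hε
  have h11 : 1 / κ * (30 + 10000 * V) ≤ 10000 / κ * (1 + V) := by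
    rw [show 10000 / κ * (1 + V) = 1 / κ * (10000 + 10000 * V) by ring]
    gcongr
    norm_num
  have h12 : 0 ≤ w * V := mul_nonneg hw.le hV
  have h13 : ∫ s in I, g s ≤ (10000 / κ / 2 + w) * (1 + V) := by nlinarith
  exact h13

/-! ### Charts in which the metric is nearly flat -/

/-- The chart `e` followed by the affine change of coordinates `y ↦ B⁻¹ (y - y₀)`. -/
def affineChart (e : OpenPartialHomeomorph M Plane) (y₀ : Plane) (B : Plane ≃L[ℝ] Plane) :
    OpenPartialHomeomorph M Plane :=
  e.transHomeomorph ((Homeomorph.subRight y₀).trans B.symm.toHomeomorph)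

section AffineChart

variable {e : OpenPartialHomeomorph M Plane} {y₀ : Plane} {B : Plane ≃L[ℝ] Plane}

theorem affineChart_apply (x : M) : affineChart e y₀ B x = B.symm (e x - y₀) := rfl

theorem affineChart_symm_apply (z : Plane) : (affineChart e y₀ B).symm z = e.symm (B z + y₀) := rfl

theorem affineChart_mem_smoothCharts (he : e ∈ smoothCharts M) :
    affineChart e y₀ B ∈ smoothCharts M := by
  set φ : OpenPartialHomeomorph Plane Plane :=
    ((Homeomorph.subRight y₀).trans B.symm.toHomeomorph).toOpenPartialHomeomorph with hφdef
  have hφ : φ ∈ contDiffGroupoid ∞ (𝓡 2) := by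
    have h1 : ContDiff ℝ ∞ (fun y : Plane => B.symm (y - y₀)) :=
      B.symm.contDiff.comp (contDiff_id.sub contDiff_const)
    have h2 : ContDiff ℝ ∞ (fun y : Plane => B y + y₀) :=
      B.contDiff.add contDiff_const
    rw [contDiffGroupoid, mem_groupoid_of_pregroupoid]
    exact ⟨h1.contDiffOn, h2.contDiffOn⟩
  have h3 : affineChart e y₀ B = e.trans φ := OpenPartialHomeomorph.transHomeomorph_eq_trans _ _
  rw [h3, IsManifold.mem_maximalAtlas_iff]
  rw [IsManifold.mem_maximalAtlas_iff] at he
  rw [mem_maximalAtlas_iff] at he ⊢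
  intro e' he'
  obtain ⟨h4, h5⟩ := he e' he'
  constructor
  · rw [OpenPartialHomeomorph.trans_symm_eq_symm_trans_symm, OpenPartialHomeomorph.trans_assoc]
    exact (contDiffGroupoid ∞ (𝓡 2)).trans ((contDiffGroupoid ∞ (𝓡 2)).symm hφ) h4
  · rw [← OpenPartialHomeomorph.trans_assoc]
    exact (contDiffGroupoid ∞ (𝓡 2)).trans h5 hφ

theorem symmDeriv_affineChart (he : e ∈ smoothCharts M) {z : Plane} (hz : B z + y₀ ∈ e.target)
    (c : Plane) : symmDeriv (affineChart e y₀ B) z c = symmDeriv e (B z + y₀) (B c) := by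
  have hd : HasFDerivAt (fun z : Plane => B z + y₀) (B : Plane →L[ℝ] Plane) z :=
    (B.hasFDerivAt).add_const y₀
  have h1 := mfderiv_comp (I := 𝓡 2) (I' := 𝓡 2) (I'' := 𝓡 2) z
    (g := e.symm) (f := fun z : Plane => B z + y₀)
    (mdifferentiableAt_chart_symm he hz) hd.differentiableAt.mdifferentiableAt
  rw [mfderiv_eq_fderiv, hd.fderiv] at h1
  exact congrArg (fun L : Plane →L[ℝ] Plane => L c) h1

theorem gram_affineChart (g : Metric M) (he : e ∈ smoothCharts M) {z : Plane}
    (hz : B z + y₀ ∈ e.target) (i j : Fin 2) :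
    gram g (affineChart e y₀ B) z i j
      = ∑ k, ∑ l, B (coordVec i) k * B (coordVec j) l * gram g e (B z + y₀) k l := by
  rw [gram_eq_form, symmDeriv_affineChart he hz, symmDeriv_affineChart he hz,
    affineChart_symm_apply, form_symmDeriv]

end AffineChart

/-- The metric `σ` is nearly flat in the chart `e`, at scale `ρ`: over the ball of radius `5` the
matrix of `ρ⁻² σ` differs little from the identity, in the `C¹` norm. -/
structure IsFlatChart (σ : Metric M) (e : OpenPartialHomeomorph M Plane) (ρ : ℝ) : Prop where
  mem : e ∈ smoothCharts M
  pos : 0 < ρ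
  le_half : ρ ≤ 1 / 2
  subset_target : closedBall 0 5 ⊆ e.target
  gram_sub_le : ∀ y ∈ closedBall (0 : Plane) 5, ∀ i j,
    |gram σ e y i j - ρ ^ 2 * (1 : Matrix (Fin 2) (Fin 2) ℝ) i j| ≤ 1 / 2000 * ρ ^ 2
  deriv_gram_le : ∀ y ∈ closedBall (0 : Plane) 5, ∀ k i j,
    |partialDeriv k (fun z => gram σ e z i j) y| ≤ 1 / 2000 * ρ ^ 2

/-- A linear change of coordinates that makes a positive definite quadratic form, with diagonal
entries `a`, `c` and off-diagonal entry `b`, the standard one. -/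
theorem exists_orthonormalizing {a b c : ℝ} (ha : 0 < a) (hD : 0 < a * c - b * b) :
    ∃ F : Plane →L[ℝ] Plane, (∀ z, F z = 0 → z = 0) ∧
      ∀ i j, ∑ k, ∑ l, F (coordVec i) k * F (coordVec j) l
        * (!![a, b; b, c] : Matrix (Fin 2) (Fin 2) ℝ) k l
        = (1 : Matrix (Fin 2) (Fin 2) ℝ) i j := by
  set p := √a with hp
  set q := √(a * c - b * b) with hq
  have hp0 : 0 < p := Real.sqrt_pos.2 ha
  have hq0 : 0 < q := Real.sqrt_pos.2 hD
  have hpa : p * p = a := Real.mul_self_sqrt ha.le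
  have hqa : q * q = a * c - b * b := Real.mul_self_sqrt hD.le
  let F : Plane →ₗ[ℝ] Plane :=
    { toFun := fun z => !₂[z 0 * p⁻¹ - z 1 * (b / (p * q)), z 1 * (p / q)]
      map_add' := fun z w => by
        ext k; fin_cases k <;> simp <;> ring
      map_smul' := fun r z => by
        ext k; fin_cases k <;> simp <;> ring }
  have hF0 : ∀ z, F z 0 = z 0 * p⁻¹ - z 1 * (b / (p * q)) := fun z => rfl
  have hF1 : ∀ z, F z 1 = z 1 * (p / q) := fun z => rfl
  refine ⟨LinearMap.toContinuousLinearMap F, ?_, ?_⟩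
  · intro z hz
    have h0 : F z 0 = 0 := congrArg (fun v : Plane => v 0) hz
    have h1 : F z 1 = 0 := congrArg (fun v : Plane => v 1) hz
    rw [hF1] at h1
    have h2 : z 1 = 0 := by
      rcases mul_eq_zero.1 h1 with h | h
      · exact h
      · exact absurd h (div_pos hp0 hq0).ne'
    rw [hF0, h2, zero_mul, sub_zero] at h0
    have h3 : z 0 = 0 := by
      rcases mul_eq_zero.1 h0 with h | h
      · exact h
      · exact absurd h (inv_pos.2 hp0).ne'
    ext k
    fin_cases k
    · exact h3
    · exact h2
  · have e0 : ∀ i k, (coordVec i : Plane) k = if k = i then 1 else 0 := by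
      intro i k; simp [coordVec]
    have hc : c = (q * q + b * b) / (p * p) := by
      rw [hqa, hpa]; field_simp; ring
    intro i j
    simp only [LinearMap.coe_toContinuousLinearMap', Fin.sum_univ_two, hF0, hF1, e0]
    rw [hc, ← hpa]
    fin_cases i <;> fin_cases j <;> simp <;> field_simp <;> ring

/-- Every point is the centre of a nearly flat chart: normalize the metric at the point by a linear
change of coordinates, and zoom in. -/
theorem exists_isFlatChart (σ : Metric M) (p : M) :
    ∃ e ρ, IsFlatChart σ e ρ ∧ p ∈ e.source ∧ e p = 0 := by
  set e := chartAt Plane p with he_def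
  have he : e ∈ smoothCharts M := IsManifold.chart_mem_maximalAtlas p
  have hp : p ∈ e.source := mem_chart_source Plane p
  set y₀ := e p with hy₀
  have hy : y₀ ∈ e.target := e.map_source hp
  obtain ⟨F, hF, hFG⟩ := exists_orthonormalizing (gram_diag_pos σ he hy 0)
    (by have := gram_det_pos σ he hy
        rwa [Matrix.det_fin_two, gram_symm σ e y₀ 1 0] at this)
  have hG : (!![gram σ e y₀ 0 0, gram σ e y₀ 0 1; gram σ e y₀ 0 1, gram σ e y₀ 1 1] :
      Matrix (Fin 2) (Fin 2) ℝ) = gram σ e y₀ := by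
    ext i j
    fin_cases i <;> fin_cases j <;> simp [gram_symm σ e y₀ 1 0]
  rw [hG] at hFG
  set H : Fin 2 → Fin 2 → Plane → ℝ := fun i j w =>
    ∑ k, ∑ l, F (coordVec i) k * F (coordVec j) l * gram σ e w k l with hH
  have hHs : ∀ i j, ∀ w ∈ e.target, ContDiffAt ℝ ∞ (H i j) w := by
    intro i j w hw
    refine ContDiffAt.sum fun k _ => ContDiffAt.sum fun l _ => ?_
    exact contDiffAt_const.mul (contDiffAt_gram σ he hw k l)
  obtain ⟨K, hK⟩ : ∃ K : ℝ, ∀ i j, ‖fderiv ℝ (H i j) y₀‖ < K := by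
    refine ⟨∑ i, ∑ j, ‖fderiv ℝ (H i j) y₀‖ + 1, fun i j => ?_⟩
    have h1 := Finset.single_le_sum (f := fun j => ‖fderiv ℝ (H i j) y₀‖)
      (fun j _ => norm_nonneg _) (Finset.mem_univ j)
    have h2 := Finset.single_le_sum (f := fun i => ∑ j, ‖fderiv ℝ (H i j) y₀‖)
      (fun i _ => Finset.sum_nonneg fun j _ => norm_nonneg _) (Finset.mem_univ i)
    linarith
  have hev : ∀ᶠ w in 𝓝 y₀, w ∈ e.target ∧ ∀ i j,
      |H i j w - (1 : Matrix (Fin 2) (Fin 2) ℝ) i j| < 1 / 2000 ∧ ‖fderiv ℝ (H i j) w‖ < K := by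
    refine (e.open_target.eventually_mem hy).and (eventually_all.2 fun i => eventually_all.2 fun j => ?_)
    have h1 : ContinuousAt (fun w => |H i j w - (1 : Matrix (Fin 2) (Fin 2) ℝ) i j|) y₀ :=
      ((hHs i j y₀ hy).continuousAt.sub continuousAt_const).abs
    have h2 : ContinuousAt (fun w => ‖fderiv ℝ (H i j) w‖) y₀ :=
      ((hHs i j y₀ hy).fderiv_right (m := 0) (by simp)).continuousAt.norm
    refine (h1.eventually_lt continuousAt_const ?_).and (h2.eventually_lt continuousAt_const (hK i j))
    rw [show H i j y₀ = _ from hFG i j]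
    norm_num
  obtain ⟨r, hr, hball⟩ := Metric.eventually_nhds_iff_ball.1 hev
  have hK0 : 0 < K := (norm_nonneg _).trans_lt (hK 0 0)
  -- the scale: the ball of radius `5` has to land in the good neighbourhood of `y₀`
  obtain ⟨ρ, hρ, hρ2, hρr, hρK⟩ : ∃ ρ : ℝ, 0 < ρ ∧ ρ ≤ 1 / 2 ∧ ρ * (‖F‖ * 5) < r ∧
      ρ * (K * ‖F‖) < 1 / 2000 := by
    have h1 : ∀ᶠ ρ : ℝ in 𝓝[>] 0, ρ * (‖F‖ * 5) < r := by
      refine nhdsWithin_le_nhds (ContinuousAt.eventually_lt (by fun_prop) continuousAt_const ?_)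
      simpa using hr
    have h2 : ∀ᶠ ρ : ℝ in 𝓝[>] 0, ρ * (K * ‖F‖) < 1 / 2000 := by
      refine nhdsWithin_le_nhds (ContinuousAt.eventually_lt (by fun_prop) continuousAt_const ?_)
      norm_num
    have h3 : ∀ᶠ ρ : ℝ in 𝓝[>] 0, ρ ≤ 1 / 2 :=
      nhdsWithin_le_nhds (eventually_le_nhds (by norm_num))
    obtain ⟨ρ, h⟩ := (((h1.and h2).and h3).and self_mem_nhdsWithin).exists
    exact ⟨ρ, h.2, h.1.2, h.1.1.1, h.1.1.2⟩
  have hinj : Function.Injective (ρ • (F : Plane →ₗ[ℝ] Plane)) := by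
    rw [← LinearMap.ker_eq_bot, LinearMap.ker_eq_bot']
    intro z hz
    exact hF z ((smul_eq_zero.1 hz).resolve_left hρ.ne')
  set B : Plane ≃L[ℝ] Plane :=
    (LinearEquiv.ofInjectiveEndo _ hinj).toContinuousLinearEquiv
  have hB : ∀ z, B z = ρ • F z := fun z => rfl
  have hBmem : ∀ z ∈ closedBall (0 : Plane) 5, B z + y₀ ∈ ball y₀ r := by
    intro z hz
    rw [mem_ball, dist_eq_norm, add_sub_cancel_right, hB, norm_smul, Real.norm_of_nonneg hρ.le]
    refine lt_of_le_of_lt ?_ hρr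
    gcongr
    exact (F.le_opNorm z).trans (by gcongr; simpa using hz)
  have hgram : ∀ z, B z + y₀ ∈ e.target → ∀ i j,
      gram σ (affineChart e y₀ B) z i j = ρ ^ 2 * H i j (B z + y₀) := by
    intro z hz i j
    rw [gram_affineChart σ he hz]
    simp only [hB, hH, Finset.mul_sum, PiLp.smul_apply, smul_eq_mul]
    exact Finset.sum_congr rfl fun k _ => Finset.sum_congr rfl fun l _ => by ring
  refine ⟨affineChart e y₀ B, ρ, ⟨affineChart_mem_smoothCharts he, hρ, hρ2, fun z hz =>
    (hball _ (hBmem z hz)).1, ?_, ?_⟩, hp, ?_⟩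
  · intro z hz i j
    obtain ⟨h1, h2⟩ := hball _ (hBmem z hz)
    rw [hgram z h1, ← mul_sub, abs_mul, abs_of_pos (by positivity), mul_comm]
    gcongr
    exact (h2 i j).1.le
  · intro z hz k i j
    obtain ⟨h1, h2⟩ := hball _ (hBmem z hz)
    have h3 : HasFDerivAt (fun w => ρ ^ 2 * H i j (B w + y₀))
        (ρ ^ 2 • (fderiv ℝ (H i j) (B z + y₀)).comp (B : Plane →L[ℝ] Plane)) z := by
      have h5 := ((hHs i j _ h1).differentiableAt (by simp)).hasFDerivAt
      have h6 : HasFDerivAt (fun z : Plane => B z + y₀) (B : Plane →L[ℝ] Plane) z :=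
        (B.hasFDerivAt).add_const y₀
      exact (h5.comp z h6).const_mul _
    have h4 : (fun w => gram σ (affineChart e y₀ B) w i j)
        =ᶠ[𝓝 z] fun w => ρ ^ 2 * H i j (B w + y₀) := by
      filter_upwards [(affineChart e y₀ B).open_target.mem_nhds h1] with w hw using hgram w hw i j
    rw [partialDeriv, h4.fderiv_eq, h3.fderiv]
    simp only [smul_apply, ContinuousLinearMap.comp_apply, smul_eq_mul]
    rw [abs_mul, abs_of_pos (by positivity : 0 < ρ ^ 2), mul_comm]
    gcongr
    have h5 : ‖(coordVec k : Plane)‖ = 1 := by simp [coordVec]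
    have h6 : ‖B (coordVec k)‖ ≤ ρ * ‖F‖ := by
      rw [hB, norm_smul, Real.norm_of_nonneg hρ.le]
      gcongr
      simpa [h5] using F.le_opNorm (coordVec k)
    calc |fderiv ℝ (H i j) (B z + y₀) (B (coordVec k))|
        ≤ ‖fderiv ℝ (H i j) (B z + y₀)‖ * ‖B (coordVec k)‖ := by
          rw [← Real.norm_eq_abs]
          exact ContinuousLinearMap.le_opNorm _ _
      _ ≤ K * (ρ * ‖F‖) := by
          have := (h2 i j).2.le
          gcongr
      _ ≤ 1 / 2000 := by linarith [hρK.le]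
  · rw [affineChart_apply, sub_self, map_zero]

section IsFlatChart

variable {σ : Metric M} {e : OpenPartialHomeomorph M Plane} {ρ : ℝ}

/-- In a nearly flat chart, the area element is `ρ² s` with `s` close to `1`, and its first
derivatives are small compared to `ρ²`. -/
theorem IsFlatChart.exists_normalized (h : IsFlatChart σ e ρ) {y : Plane}
    (hy : y ∈ closedBall (0 : Plane) 5) :
    ∃ s : ℝ, √(gram σ e y).det = ρ ^ 2 * s ∧ |s - 1| ≤ 3 / 2000 ∧
      ∀ k, |partialDeriv k (fun z => √(gram σ e z).det) y| ≤ 2 / 2000 * ρ ^ 2 := by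
  have hyt := h.subset_target hy
  have hρ : 0 < ρ ^ 2 := by have := h.pos; positivity
  have hρ0 : ρ ≠ 0 := h.pos.ne'
  have hdet : ∀ z, (gram σ e z).det
      = gram σ e z 0 0 * gram σ e z 1 1 - gram σ e z 0 1 * gram σ e z 0 1 := by
    intro z
    rw [Matrix.det_fin_two, gram_symm σ e z 1 0]
  have hn : ∀ i j, ∃ x, gram σ e y i j = ρ ^ 2 * x ∧
      |x - (1 : Matrix (Fin 2) (Fin 2) ℝ) i j| ≤ 1 / 2000 := by
    intro i j
    refine ⟨gram σ e y i j / ρ ^ 2, by field_simp, ?_⟩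
    have h1 := h.gram_sub_le y hy i j
    rw [show gram σ e y i j - ρ ^ 2 * (1 : Matrix (Fin 2) (Fin 2) ℝ) i j
      = ρ ^ 2 * (gram σ e y i j / ρ ^ 2 - (1 : Matrix (Fin 2) (Fin 2) ℝ) i j) by field_simp,
      abs_mul, abs_of_pos hρ, mul_comm] at h1
    exact le_of_mul_le_mul_right h1 hρ
  have hn' : ∀ k i j, ∃ x, partialDeriv k (fun z => gram σ e z i j) y = ρ ^ 2 * x ∧
      |x| ≤ 1 / 2000 := by
    intro k i j
    refine ⟨partialDeriv k (fun z => gram σ e z i j) y / ρ ^ 2, by field_simp, ?_⟩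
    rw [abs_div, abs_of_pos hρ, div_le_iff₀ hρ]
    exact h.deriv_gram_le y hy k i j
  obtain ⟨x, hx, hx1⟩ := hn 0 0
  obtain ⟨w, hw, hw1⟩ := hn 0 1
  obtain ⟨z, hz, hz1⟩ := hn 1 1
  simp only [Matrix.one_apply_eq, ne_eq, zero_ne_one, not_false_eq_true, Matrix.one_apply_ne,
    sub_zero] at hx1 hw1 hz1
  rw [abs_le] at hx1 hw1 hz1
  have hpos := gram_det_pos σ h.mem hyt
  set S := √(gram σ e y).det with hS
  have hS0 : 0 < S := Real.sqrt_pos.2 hpos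
  have hSS : S * S = gram σ e y 0 0 * gram σ e y 1 1 - gram σ e y 0 1 * gram σ e y 0 1 := by
    rw [← hdet]; exact Real.mul_self_sqrt hpos.le
  have hs : S = ρ ^ 2 * (S / ρ ^ 2) := by field_simp
  have hs0 : 0 < S / ρ ^ 2 := by positivity
  generalize S / ρ ^ 2 = s at hs hs0
  have hss : s * s = x * z - w * w := by
    rw [hs, hx, hz, hw] at hSS
    have : (ρ ^ 2 * ρ ^ 2) * (s * s) = (ρ ^ 2 * ρ ^ 2) * (x * z - w * w) := by linarith
    exact mul_left_cancel₀ (by positivity) this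
  have hs1 : |s - 1| ≤ 3 / 2000 := by
    rw [abs_le]
    constructor <;> nlinarith
  refine ⟨s, hs, hs1, fun k => ?_⟩
  obtain ⟨x', hx', hx1'⟩ := hn' k 0 0
  obtain ⟨w', hw', hw1'⟩ := hn' k 0 1
  obtain ⟨z', hz', hz1'⟩ := hn' k 1 1
  have hd : ∀ i j, DifferentiableAt ℝ (fun z => gram σ e z i j) y := fun i j =>
    (contDiffAt_gram σ h.mem hyt i j).differentiableAt (by simp)
  have hdS : DifferentiableAt ℝ (fun z => √(gram σ e z).det) y :=
    (contDiffAt_sqrt_det σ h.mem hyt).differentiableAt (by simp)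
  have hev : (fun z => √(gram σ e z).det * √(gram σ e z).det) =ᶠ[𝓝 y] fun z =>
      gram σ e z 0 0 * gram σ e z 1 1 - gram σ e z 0 1 * gram σ e z 0 1 := by
    filter_upwards [e.open_target.mem_nhds hyt] with z hz
    rw [← hdet]
    exact Real.mul_self_sqrt (gram_det_pos σ h.mem hz).le
  have hder := partialDeriv_congr (i := k) hev
  rw [partialDeriv_mul hdS hdS, partialDeriv_sub ((hd 0 0).fun_mul (hd 1 1)) ((hd 0 1).fun_mul (hd 0 1)),
    partialDeriv_mul (hd 0 0) (hd 1 1), partialDeriv_mul (hd 0 1) (hd 0 1), hx', hw', hz', hx, hw,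
    hz, ← hS, hs] at hder
  set D := partialDeriv k (fun z => √(gram σ e z).det) y
  have hD : 2 * s * D = ρ ^ 2 * (x' * z + x * z' - 2 * (w * w')) := by
    have : ρ ^ 2 * (2 * s * D) = ρ ^ 2 * (ρ ^ 2 * (x' * z + x * z' - 2 * (w * w'))) := by
      linarith
    exact mul_left_cancel₀ hρ.ne' this
  have hb : |x' * z + x * z' - 2 * (w * w')| ≤ 3 / 2000 := by
    have hx2 : |x| ≤ 2001 / 2000 := abs_le.2 ⟨by linarith, by linarith⟩
    have hz2 : |z| ≤ 2001 / 2000 := abs_le.2 ⟨by linarith, by linarith⟩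
    have hw2 : |w| ≤ 1 / 2000 := abs_le.2 ⟨by linarith, by linarith⟩
    calc |x' * z + x * z' - 2 * (w * w')| ≤ |x' * z| + |x * z'| + |2 * (w * w')| :=
          (abs_sub _ _).trans (add_le_add_left (abs_add_le _ _) _)
      _ = |x'| * |z| + |x| * |z'| + 2 * (|w| * |w'|) := by simp [abs_mul]
      _ ≤ 1 / 2000 * (2001 / 2000) + 2001 / 2000 * (1 / 2000) + 2 * (1 / 2000 * (1 / 2000)) := by
          gcongr
      _ ≤ 3 / 2000 := by norm_num
  have h1 : |2 * s * D| ≤ ρ ^ 2 * (3 / 2000) := by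
    rw [hD, abs_mul, abs_of_pos hρ]; gcongr
  rw [abs_le] at hs1
  rw [abs_mul, abs_of_pos (by positivity : 0 < 2 * s)] at h1
  nlinarith [abs_nonneg D]

theorem IsFlatChart.sqrt_det_le_one (h : IsFlatChart σ e ρ) {y : Plane}
    (hy : y ∈ closedBall (0 : Plane) 5) : √(gram σ e y).det ≤ 1 := by
  obtain ⟨s, hs, hs1, -⟩ := h.exists_normalized hy
  rw [abs_le] at hs1
  rw [hs]
  have h1 := h.pos
  have h2 := h.le_half
  have h3 : ρ ^ 2 ≤ 1 / 4 := by nlinarith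
  nlinarith [sq_nonneg ρ]

theorem laplaceCoeff_mul_sqrt_det (h : IsFlatChart σ e ρ) {y : Plane} (hy : y ∈ e.target)
    (i j : Fin 2) :
    laplaceCoeff σ e y i j * √(gram σ e y).det = (gram σ e y).adjugate i j := by
  have hpos := gram_det_pos σ h.mem hy
  rw [laplaceCoeff, Matrix.of_apply, gram_inv_apply]
  have h1 : √(gram σ e y).det * √(gram σ e y).det = (gram σ e y).det :=
    Real.mul_self_sqrt hpos.le
  calc _ = (√(gram σ e y).det * √(gram σ e y).det) * (gram σ e y).det⁻¹
        * (gram σ e y).adjugate i j := by ring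
    _ = _ := by rw [h1, mul_inv_cancel₀ hpos.ne', one_mul]

/-- The Laplace operator is conformally invariant in dimension two, so its coefficients are nearly
those of the flat Laplacian, at every scale. -/
theorem IsFlatChart.nearlyFlat (h : IsFlatChart σ e ρ) : NearlyFlat (laplaceCoeff σ e) := by
  have hρ : 0 < ρ ^ 2 := by have := h.pos; positivity
  -- up to sign and permutation, the entries of the adjugate matrix are those of the matrix
  have hadj : ∀ i j, ∃ i' j' : Fin 2, ∃ c : ℝ, |c| = 1 ∧
      (∀ z, (gram σ e z).adjugate i j = c * gram σ e z i' j') ∧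
      c * (1 : Matrix (Fin 2) (Fin 2) ℝ) i' j' = (1 : Matrix (Fin 2) (Fin 2) ℝ) i j := by
    intro i j
    fin_cases i <;> fin_cases j
    · exact ⟨1, 1, 1, by simp, fun z => by simp [Matrix.adjugate_fin_two], by simp⟩
    · exact ⟨0, 1, -1, by simp, fun z => by simp [Matrix.adjugate_fin_two], by simp⟩
    · exact ⟨1, 0, -1, by simp, fun z => by simp [Matrix.adjugate_fin_two], by simp⟩
    · exact ⟨0, 0, 1, by simp, fun z => by simp [Matrix.adjugate_fin_two], by simp⟩
  have hclose : ∀ y ∈ closedBall (0 : Plane) 5, ∀ i j,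
      |laplaceCoeff σ e y i j - (1 : Matrix (Fin 2) (Fin 2) ℝ) i j| ≤ 1 / 400 := by
    intro y hy i j
    obtain ⟨s, hs, hs1, -⟩ := h.exists_normalized hy
    obtain ⟨i', j', c, hc, hc1, hc2⟩ := hadj i j
    have h1 := laplaceCoeff_mul_sqrt_det h (h.subset_target hy) i j
    have h2 := h.gram_sub_le y hy i' j'
    set E := (1 : Matrix (Fin 2) (Fin 2) ℝ) i j with hE
    have h3 : ρ ^ 2 * ((laplaceCoeff σ e y i j - E) * s)
        = c * (gram σ e y i' j' - ρ ^ 2 * (1 : Matrix (Fin 2) (Fin 2) ℝ) i' j')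
          + ρ ^ 2 * (E * (1 - s)) := by
      rw [hc1, hs] at h1
      linear_combination h1 + ρ ^ 2 * hc2
    have hE1 : |E| ≤ 1 := by
      rw [hE, Matrix.one_apply]; split_ifs <;> simp
    have h4 : ρ ^ 2 * |(laplaceCoeff σ e y i j - E) * s| ≤ ρ ^ 2 * (4 / 2000) := by
      calc ρ ^ 2 * |(laplaceCoeff σ e y i j - E) * s|
          = |ρ ^ 2 * ((laplaceCoeff σ e y i j - E) * s)| := by
            rw [abs_mul (ρ ^ 2), abs_of_pos hρ]
        _ ≤ |c| * |gram σ e y i' j' - ρ ^ 2 * (1 : Matrix (Fin 2) (Fin 2) ℝ) i' j'|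
            + ρ ^ 2 * (|E| * |1 - s|) := by
            rw [h3]
            refine (abs_add_le _ _).trans ?_
            rw [abs_mul c, abs_mul (ρ ^ 2), abs_of_pos hρ, abs_mul E]
        _ ≤ 1 * (1 / 2000 * ρ ^ 2) + ρ ^ 2 * (1 * (3 / 2000)) := by
            rw [hc, abs_sub_comm 1 s]; gcongr
        _ = ρ ^ 2 * (4 / 2000) := by ring
    have h5 := le_of_mul_le_mul_left h4 hρ
    rw [abs_le] at hs1
    rw [abs_mul, abs_of_pos (by linarith : 0 < s)] at h5
    nlinarith [abs_nonneg (laplaceCoeff σ e y i j - E)]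
  refine ⟨fun y i j => ?_, fun y hy i j => ?_, fun y hy i => ?_, fun y hy i j hij => ?_,
    fun y hy k i j => ?_⟩
  · rw [laplaceCoeff, Matrix.of_apply, Matrix.of_apply, gram_inv_apply, gram_inv_apply]
    congr 2
    have hs := gram_symm σ e y 0 1
    fin_cases i <;> fin_cases j <;> simp [Matrix.adjugate_fin_two, hs]
  · exact (contDiffAt_laplaceCoeff σ h.mem (h.subset_target hy) i j).of_le (by simp)
  · simpa using hclose y hy i i
  · simpa [hij] using hclose y hy i j
  · obtain ⟨s, hs, hs1, hs2⟩ := h.exists_normalized hy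
    obtain ⟨i', j', c, hc, hc1, -⟩ := hadj i j
    have hyt := h.subset_target hy
    have hev : (fun z => laplaceCoeff σ e z i j * √(gram σ e z).det)
        =ᶠ[𝓝 y] fun z => c * gram σ e z i' j' := by
      filter_upwards [e.open_target.mem_nhds hyt] with z hz
      rw [laplaceCoeff_mul_sqrt_det h hz, hc1]
    have hder := partialDeriv_congr (i := k) hev
    rw [partialDeriv_mul
      ((contDiffAt_laplaceCoeff σ h.mem hyt i j).differentiableAt (by simp))
      ((contDiffAt_sqrt_det σ h.mem hyt).differentiableAt (by simp)),
      partialDeriv_mul (differentiableAt_const c)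
      ((contDiffAt_gram σ h.mem hyt i' j').differentiableAt (by simp)), partialDeriv_const,
      zero_mul, zero_add, hs] at hder
    have h1 := h.deriv_gram_le y hy k i' j'
    have h2 := hs2 k
    have h3 : |laplaceCoeff σ e y i j| ≤ 401 / 400 := by
      have h4 := hclose y hy i j
      have hE1 : |(1 : Matrix (Fin 2) (Fin 2) ℝ) i j| ≤ 1 := by
        rw [Matrix.one_apply]; split_ifs <;> simp
      have h5 := abs_sub_abs_le_abs_sub (laplaceCoeff σ e y i j)
        ((1 : Matrix (Fin 2) (Fin 2) ℝ) i j)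
      linarith
    set D := partialDeriv k (fun z => laplaceCoeff σ e z i j) y
    have h6 : ρ ^ 2 * |D * s| ≤ ρ ^ 2 * (1 / 2000 + 401 / 400 * (2 / 2000)) := by
      calc ρ ^ 2 * |D * s| = |D * (ρ ^ 2 * s)| := by
            rw [abs_mul, abs_mul, abs_mul, abs_of_pos hρ]; ring
        _ = |c * partialDeriv k (fun z => gram σ e z i' j') y
            - laplaceCoeff σ e y i j * partialDeriv k (fun z => √(gram σ e z).det) y| := by
            rw [← hder]; congr 1; ring
        _ ≤ |c| * |partialDeriv k (fun z => gram σ e z i' j') y|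
            + |laplaceCoeff σ e y i j| * |partialDeriv k (fun z => √(gram σ e z).det) y| := by
            rw [← abs_mul, ← abs_mul]; exact abs_sub _ _
        _ ≤ 1 * (1 / 2000 * ρ ^ 2) + 401 / 400 * (2 / 2000 * ρ ^ 2) := by
            rw [hc]; gcongr
        _ = _ := by ring
    have h7 := le_of_mul_le_mul_left h6 hρ
    rw [abs_le] at hs1
    rw [abs_mul, abs_of_pos (by linarith : 0 < s)] at h7
    nlinarith [abs_nonneg D]

/-- The Christoffel symbols are scale invariant, too. -/
theorem IsFlatChart.abs_christoffel_le (h : IsFlatChart σ e ρ) {y : Plane}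
    (hy : y ∈ closedBall (0 : Plane) 5) (k i j : Fin 2) :
    |christoffel σ e k i j y| ≤ 1 / 1000 := by
  have hρ : 0 < ρ ^ 2 := by have := h.pos; positivity
  obtain ⟨s, hs, hs1, -⟩ := h.exists_normalized hy
  have hinv : ∀ k l, ρ ^ 2 * |(gram σ e y)⁻¹ k l|
      ≤ (if k = l then 1 else 0) + 1 / 100 := by
    intro k l
    have h1 : laplaceCoeff σ e y k l = ρ ^ 2 * s * (gram σ e y)⁻¹ k l := by
      rw [laplaceCoeff, Matrix.of_apply, hs]
    have h2 : |laplaceCoeff σ e y k l| ≤ (if k = l then 1 else 0) + 1 / 400 := by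
      split_ifs with hkl
      · subst hkl
        have := h.nearlyFlat.diag y hy k
        rw [abs_le] at this ⊢
        constructor <;> linarith
      · simpa using h.nearlyFlat.off_diag y hy k l hkl
    rw [abs_le] at hs1
    rw [h1, abs_mul, abs_mul, abs_of_pos hρ, abs_of_pos (by linarith : 0 < s)] at h2
    have h3 : 0 ≤ ρ ^ 2 * |(gram σ e y)⁻¹ k l| := by positivity
    split_ifs at h2 ⊢ <;> nlinarith
  set X : Fin 2 → ℝ := fun l => partialDeriv i (fun z => gram σ e z j l) y
    + partialDeriv j (fun z => gram σ e z i l) y - partialDeriv l (fun z => gram σ e z i j) y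
    with hX
  have hXb : ∀ l, |X l| ≤ 3 / 2000 * ρ ^ 2 := by
    intro l
    have h1 := h.deriv_gram_le y hy i j l
    have h2 := h.deriv_gram_le y hy j i l
    have h3 := h.deriv_gram_le y hy l i j
    have h4 := (abs_sub (partialDeriv i (fun z => gram σ e z j l) y
      + partialDeriv j (fun z => gram σ e z i l) y)
      (partialDeriv l (fun z => gram σ e z i j) y)).trans (add_le_add_left (abs_add_le _ _) _)
    simp only [hX]
    linarith
  have hsum : ∀ l, |(gram σ e y)⁻¹ k l * X l|
      ≤ 3 / 2000 * ((if k = l then 1 else 0) + 1 / 100) := by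
    intro l
    calc |(gram σ e y)⁻¹ k l * X l| = |(gram σ e y)⁻¹ k l| * |X l| := abs_mul _ _
      _ ≤ |(gram σ e y)⁻¹ k l| * (3 / 2000 * ρ ^ 2) := by gcongr; exact hXb l
      _ = 3 / 2000 * (ρ ^ 2 * |(gram σ e y)⁻¹ k l|) := by ring
      _ ≤ _ := by gcongr; exact hinv k l
  have h0 : christoffel σ e k i j y
      = 1 / 2 * ((gram σ e y)⁻¹ k 0 * X 0 + (gram σ e y)⁻¹ k 1 * X 1) := by
    rw [christoffel, Fin.sum_univ_two]
  rw [h0, abs_mul, abs_of_pos (by norm_num : (0 : ℝ) < 1 / 2)]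
  have h1 := abs_add_le ((gram σ e y)⁻¹ k 0 * X 0) ((gram σ e y)⁻¹ k 1 * X 1)
  have h2 := hsum 0
  have h3 := hsum 1
  fin_cases k <;> norm_num at h1 h2 h3 ⊢ <;> linarith

end IsFlatChart

/-! ### Chains of nearly flat charts -/

/-- The functions `v` to which the estimates apply: `v ≥ 0` vanishes somewhere, and `Δ_σ v ≤ 1`.
The example is `v = max u - u` for the conformal factor `u` of a nonpositively curved metric. -/
structure IsConformalDefect (σ : Metric M) (v : M → ℝ) : Prop where
  smooth : ContMDiff (𝓡 2) 𝓘(ℝ, ℝ) ∞ v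
  nonneg : ∀ x, 0 ≤ v x
  exists_eq_zero : ∃ x, v x = 0
  divOp_le : ∀ e ∈ smoothCharts M, ∀ y ∈ e.target,
    divOp (laplaceCoeff σ e) (fun z => v (e.symm z)) y ≤ √(gram σ e y).det

/-- The mass of the function `v` in the ball of radius `2` of the chart `e`. -/
def chartMass (e : OpenPartialHomeomorph M Plane) (v : M → ℝ) : ℝ :=
  ∫ y in closedBall (0 : Plane) 2, v (e.symm y)

variable {σ : Metric M}

theorem IsConformalDefect.chartMass_nonneg {v : M → ℝ} (hv : IsConformalDefect σ v)
    (e : OpenPartialHomeomorph M Plane) : 0 ≤ chartMass e v :=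
  setIntegral_nonneg measurableSet_closedBall fun _ _ => hv.nonneg _

theorem IsConformalDefect.isNonnegSupersolution {v : M → ℝ} (hv : IsConformalDefect σ v)
    {e : OpenPartialHomeomorph M Plane} {ρ : ℝ} (h : IsFlatChart σ e ρ) :
    IsNonnegSupersolution (laplaceCoeff σ e) (fun y => v (e.symm y)) where
  contDiffAt y hy := by
    have h1 : ContDiffAt ℝ ∞ (fun y => v (e.symm y)) y := by
      rw [← contMDiffAt_iff_contDiffAt]
      exact hv.smooth.contMDiffAt.comp y
        ((contMDiffOn_chart_symm h.mem).contMDiffAt (e.open_target.mem_nhds (h.subset_target hy)))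
    exact_mod_cast contDiffAt_infty.1 h1 2
  nonneg y := hv.nonneg _
  divOp_le y hy := (hv.divOp_le e h.mem y (h.subset_target hy)).trans (h.sqrt_det_le_one hy)

theorem contDiffAt_transition {e e' : OpenPartialHomeomorph M Plane} (he : e ∈ smoothCharts M)
    (he' : e' ∈ smoothCharts M) {y : Plane} (hy : y ∈ e'.target) (hy' : e'.symm y ∈ e.source) :
    ContDiffAt ℝ ∞ (fun z => e (e'.symm z)) y := by
  rw [← contMDiffAt_iff_contDiffAt]
  exact ((contMDiffOn_chart he).contMDiffAt (e.open_source.mem_nhds hy')).comp y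
    ((contMDiffOn_chart_symm he').contMDiffAt (e'.open_target.mem_nhds hy))

theorem det_fderiv_transition_ne_zero {e e' : OpenPartialHomeomorph M Plane}
    (he : e ∈ smoothCharts M) (he' : e' ∈ smoothCharts M) {y : Plane} (hy : y ∈ e'.target)
    (hy' : e'.symm y ∈ e.source) : (fderiv ℝ (fun z => e (e'.symm z)) y).det ≠ 0 := by
  have h1 := ((contDiffAt_transition he he' hy hy').differentiableAt (by simp)).hasFDerivAt
  have h2 : e.symm (e (e'.symm y)) = e'.symm y := e.left_inv hy'
  have h3 := ((contDiffAt_transition he' he (y := e (e'.symm y)) (e.map_source hy')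
    (by rw [h2]; exact e'.map_target hy)).differentiableAt (by simp)).hasFDerivAt
  have h4 := h3.comp y h1
  have h5 : ((fun z => e' (e.symm z)) ∘ fun z => e (e'.symm z)) =ᶠ[𝓝 y] id := by
    have h6 : ∀ᶠ z in 𝓝 y, e'.symm z ∈ e.source :=
      (e'.continuousAt_symm hy).preimage_mem_nhds (e.open_source.mem_nhds hy')
    filter_upwards [h6, e'.open_target.mem_nhds hy] with z hz hz'
    simp only [Function.comp, id, e.left_inv hz, e'.right_inv hz']
  have h6 := (h4.congr_of_eventuallyEq h5.symm).unique (hasFDerivAt_id y)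
  intro h7
  have h8 := congrArg (fun L : Plane →L[ℝ] Plane => LinearMap.det (L : Plane →ₗ[ℝ] Plane)) h6
  have h9 : LinearMap.det ((ContinuousLinearMap.id ℝ Plane : Plane →L[ℝ] Plane) :
      Plane →ₗ[ℝ] Plane) = 1 := LinearMap.det_id
  simp only [ContinuousLinearMap.toLinearMap_comp, LinearMap.det_comp, h9] at h8
  rw [ContinuousLinearMap.det] at h7
  rw [h7, mul_zero] at h8
  exact zero_ne_one h8

/-- If the unit balls of two nearly flat charts meet, the mass in one chart controls the mass in
the other: it controls the mass of a small ball around a common point, and the weak Harnack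
inequality propagates this to the whole of the second chart. -/
theorem exists_chartMass_le_of_overlap {e e' : OpenPartialHomeomorph M Plane} {ρ ρ' : ℝ}
    (h : IsFlatChart σ e ρ) (h' : IsFlatChart σ e' ρ') {x : M} (hx : x ∈ e.source)
    (hx1 : e x ∈ ball (0 : Plane) 1) (hx' : x ∈ e'.source) (hx1' : e' x ∈ ball (0 : Plane) 1) :
    ∃ C > 0, ∀ v, IsConformalDefect σ v → chartMass e' v ≤ C * (1 + chartMass e v) := by
  obtain ⟨C, hC, hharnack⟩ := exists_integral_closedBall_le
  set z := e' x with hz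
  have hzt : z ∈ e'.target := e'.map_source hx'
  have hzs : e'.symm z = x := e'.left_inv hx'
  set φ : Plane → Plane := fun y => e (e'.symm y) with hφ
  set c := |(fderiv ℝ φ z).det| / 2 with hc
  have hdet0 : 0 < |(fderiv ℝ φ z).det| :=
    abs_pos.2 (det_fderiv_transition_ne_zero h.mem h'.mem hzt (hzs.symm ▸ hx))
  have hc0 : 0 < c := by positivity
  have hsmooth := contDiffAt_transition h.mem h'.mem hzt (hzs.symm ▸ hx)
  have hev : ∀ᶠ y in 𝓝 z, y ∈ e'.target ∧ e'.symm y ∈ e.source ∧ φ y ∈ ball (0 : Plane) 2 ∧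
      c < |(fderiv ℝ φ y).det| := by
    refine (e'.open_target.eventually_mem hzt).and (((e'.continuousAt_symm hzt).eventually_mem
      (e.open_source.mem_nhds (hzs.symm ▸ hx))).and ((hsmooth.continuousAt.eventually_mem
      (isOpen_ball.mem_nhds ?_)).and ?_))
    · rw [hzs]; exact ball_subset_ball (by norm_num) hx1
    · have h1 : ContinuousAt (fun y => |(fderiv ℝ φ y).det|) z :=
        (ContinuousLinearMap.continuous_det.continuousAt.comp
          (hsmooth.fderiv_right (m := 0) (by simp)).continuousAt).abs
      exact continuousAt_const.eventually_lt h1 (by rw [hc]; linarith)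
  obtain ⟨r, hr, hball⟩ := Metric.eventually_nhds_iff_ball.1 hev
  set ε := min (1 / 10) (r / 10) with hε
  have hε0 : 0 < ε := by positivity
  have hε1 : ε ≤ 1 / 10 := min_le_left _ _
  have hεr : 10 * ε ≤ r := by have := min_le_right (1 / 10) (r / 10); linarith
  have hz1 : ‖z‖ ≤ 1 := (mem_ball_zero_iff.1 hx1').le
  set S := ball z (10 * ε)
  have hS : ∀ y ∈ S, y ∈ e'.target ∧ e'.symm y ∈ e.source ∧ φ y ∈ ball (0 : Plane) 2 ∧
      c < |(fderiv ℝ φ y).det| := fun y hy => hball y (ball_subset_ball hεr hy)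
  have hS5 : S ⊆ closedBall (0 : Plane) 5 := by
    intro y hy
    have h1 : dist y z < 10 * ε := hy
    have h2 : dist z 0 ≤ 1 := by simpa using hz1
    have h3 := dist_triangle y z 0
    rw [mem_closedBall]
    linarith
  have hφ' : ∀ y ∈ S, HasFDerivWithinAt φ (fderiv ℝ φ y) S y := fun y hy =>
    ((contDiffAt_transition h.mem h'.mem (hS y hy).1
      (hS y hy).2.1).differentiableAt (by simp)).hasFDerivAt.hasFDerivWithinAt
  have hinj : InjOn φ S := by
    intro y hy y' hy' hyy
    have h1 : e'.symm y = e'.symm y' := e.injOn (hS y hy).2.1 (hS y' hy').2.1 hyy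
    exact e'.symm.injOn (hS y hy).1 (hS y' hy').1 h1
  refine ⟨C + 20000 / ε ^ 3 * c⁻¹, by positivity, fun v hv => ?_⟩
  have hsup := hv.isNonnegSupersolution h
  have hsup' := hv.isNonnegSupersolution h'
  have himage : φ '' S ⊆ closedBall (0 : Plane) 2 := by
    rintro _ ⟨y, hy, rfl⟩
    exact ball_subset_closedBall (hS y hy).2.2.1
  have h5 : closedBall (0 : Plane) 2 ⊆ closedBall 0 5 := closedBall_subset_closedBall (by norm_num)
  have hint2 : IntegrableOn (fun y => v (e.symm y)) (closedBall (0 : Plane) 2) :=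
    hsup.integrableOn h5
  have hintim : IntegrableOn (fun y => v (e.symm y)) (φ '' S) := hint2.mono_set himage
  have hmass : ∫ y in S, v (e'.symm y) ≤ c⁻¹ * chartMass e v := by
    have h1 := integral_image_eq_integral_abs_det_fderiv_smul volume measurableSet_ball hφ' hinj
      (fun y => v (e.symm y))
    have h2 := (integrableOn_image_iff_integrableOn_abs_det_fderiv_smul volume measurableSet_ball
      hφ' hinj (fun y => v (e.symm y))).1 hintim
    have h3 : ∫ y in S, c * v (e'.symm y)
        ≤ ∫ y in S, |(fderiv ℝ φ y).det| • v (e.symm (φ y)) := by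
      refine setIntegral_mono_on ((hsup'.integrableOn hS5).const_mul c) h2 measurableSet_ball
        fun y hy => ?_
      rw [hφ, smul_eq_mul]
      simp only
      rw [e.left_inv (hS y hy).2.1]
      exact mul_le_mul_of_nonneg_right (hS y hy).2.2.2.le (hv.nonneg _)
    rw [integral_const_mul, ← h1] at h3
    have h4 : ∫ y in φ '' S, v (e.symm y) ≤ chartMass e v :=
      setIntegral_mono_set hint2 (Eventually.of_forall fun y => hv.nonneg _)
        (LE.le.eventuallyLE himage)
    rw [inv_mul_eq_div, le_div_iff₀' hc0]
    exact h3.trans h4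
  have hmono : chartMass e' v ≤ ∫ y in closedBall z 3, v (e'.symm y) := by
    refine setIntegral_mono_set (hsup'.integrableOn ?_) (Eventually.of_forall fun y => hv.nonneg _)
      (LE.le.eventuallyLE ?_)
    · exact closedBall_subset_closedBall' (by rw [dist_zero_right]; linarith)
    · exact closedBall_subset_closedBall' (by rw [dist_zero_left]; linarith)
  have hV := hv.chartMass_nonneg e
  calc chartMass e' v ≤ C + 20000 / ε ^ 3 * ∫ y in S, v (e'.symm y) :=
        hmono.trans (hharnack _ _ z ε h'.nearlyFlat hsup' hz1 hε0 hε1)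
    _ ≤ C + 20000 / ε ^ 3 * (c⁻¹ * chartMass e v) := by gcongr
    _ ≤ (C + 20000 / ε ^ 3 * c⁻¹) * (1 + chartMass e v) := by
        have h1 : 0 ≤ C * chartMass e v := by positivity
        have h2 : 0 ≤ 20000 / ε ^ 3 * c⁻¹ := by positivity
        linarith

/-- A finite family of nearly flat charts whose balls of radius `1 / 2` cover the surface, and a
bound, valid in all of these charts, for the masses of all conformal defects. -/
theorem exists_flatAtlas [CompactSpace M] [ConnectedSpace M] (σ : Metric M) :
    ∃ (s : Set (OpenPartialHomeomorph M Plane)) (C : ℝ), s.Finite ∧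
      (∀ e ∈ s, ∃ ρ, IsFlatChart σ e ρ) ∧
      (∀ x, ∃ e ∈ s, x ∈ e.source ∧ ‖e x‖ < 1 / 2) ∧
      ∀ e ∈ s, ∀ v, IsConformalDefect σ v → chartMass e v ≤ C := by
  choose E R hE hsrc hzero using exists_isFlatChart σ
  let P : M → M → Prop := fun p q =>
    ∃ C > 0, ∀ v, IsConformalDefect σ v → chartMass (E q) v ≤ C * (1 + chartMass (E p) v)
  have htrans : IsTrans M P := by
    refine ⟨?_⟩
    rintro p q r ⟨C, hC, h1⟩ ⟨C', hC', h2⟩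
    refine ⟨C' * (1 + C), by positivity, fun v hv => ?_⟩
    have hV := hv.chartMass_nonneg (E p)
    calc chartMass (E r) v ≤ C' * (1 + chartMass (E q) v) := h2 v hv
      _ ≤ C' * (1 + C * (1 + chartMass (E p) v)) := by gcongr; exact h1 v hv
      _ ≤ C' * (1 + C) * (1 + chartMass (E p) v) := by
          have : 0 ≤ C' * chartMass (E p) v := by positivity
          linarith
  have hnhds : ∀ p (r : ℝ), 0 < r → ∀ᶠ q in 𝓝 p, q ∈ (E p).source ∧ E p q ∈ ball (0 : Plane) r := by
    intro p r hr
    refine ((E p).open_source.eventually_mem (hsrc p)).and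
      (((E p).continuousAt (hsrc p)).eventually_mem (isOpen_ball.mem_nhds ?_))
    rw [hzero]
    exact mem_ball_self hr
  have hP : ∀ p q, P p q := by
    refine PreconnectedSpace.induction₂' P (fun p => ?_) htrans
    filter_upwards [hnhds p 1 one_pos] with q hq
    have hq' : E q q ∈ ball (0 : Plane) 1 := by rw [hzero]; exact mem_ball_self one_pos
    exact ⟨exists_chartMass_le_of_overlap (hE p) (hE q) hq.1 hq.2 (hsrc q) hq',
      exists_chartMass_le_of_overlap (hE q) (hE p) (hsrc q) hq' hq.1 hq.2⟩
  obtain ⟨t, -, ht⟩ := isCompact_univ.elim_nhds_subcover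
    (fun p => {q | q ∈ (E p).source ∧ E p q ∈ ball (0 : Plane) (1 / 2)})
    (fun p _ => hnhds p (1 / 2) (by norm_num))
  have hcover : ∀ x, ∃ p ∈ t, x ∈ (E p).source ∧ ‖E p x‖ < 1 / 2 := by
    intro x
    obtain ⟨p, hp, h1, h2⟩ := mem_iUnion₂.1 (ht (mem_univ x))
    exact ⟨p, hp, h1, by simpa using h2⟩
  choose C hC hCP using hP
  obtain ⟨C₀, hC₀, hzeroMass⟩ := exists_integral_closedBall_le_of_zero
  refine ⟨E '' t, ∑ p ∈ t, ∑ q ∈ t, C p q * (1 + C₀), (t.finite_toSet).image E, ?_, ?_, ?_⟩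
  · rintro _ ⟨p, -, rfl⟩
    exact ⟨R p, hE p⟩
  · intro x
    obtain ⟨p, hp, h⟩ := hcover x
    exact ⟨E p, mem_image_of_mem E hp, h⟩
  · rintro _ ⟨q, hq, rfl⟩ v hv
    obtain ⟨x₀, hx₀⟩ := hv.exists_eq_zero
    obtain ⟨p, hp, hxs, hx1⟩ := hcover x₀
    have hsup := hv.isNonnegSupersolution (hE p)
    have h1 : chartMass (E p) v ≤ C₀ := by
      have h2 := hzeroMass _ _ (E p x₀) (hE p).nearlyFlat hsup (by linarith)
        (by rw [(E p).left_inv hxs, hx₀])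
      refine le_trans (setIntegral_mono_set (hsup.integrableOn ?_)
        (Eventually.of_forall fun y => hv.nonneg _) (LE.le.eventuallyLE ?_)) h2
      · exact closedBall_subset_closedBall' (by rw [dist_zero_right]; linarith)
      · exact closedBall_subset_closedBall' (by rw [dist_zero_left]; linarith)
    have hnn : ∀ p q, 0 ≤ C p q * (1 + C₀) := fun p q => by have := hC p q; positivity
    calc chartMass (E q) v ≤ C p q * (1 + chartMass (E p) v) := hCP p q v hv
      _ ≤ C p q * (1 + C₀) := by have := hC p q; gcongr
      _ ≤ ∑ q ∈ t, C p q * (1 + C₀) :=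
          Finset.single_le_sum (f := fun q => C p q * (1 + C₀)) (fun q _ => hnn p q) hq
      _ ≤ ∑ p ∈ t, ∑ q ∈ t, C p q * (1 + C₀) :=
          Finset.single_le_sum (f := fun p => ∑ q ∈ t, C p q * (1 + C₀))
            (fun p _ => Finset.sum_nonneg fun q _ => hnn p q) hp

/-! ### Curves with small acceleration in the plane -/

/-- A smooth function with derivative at least `1 / 2` has an inverse of class `C²`, defined on an
interval of definite length. -/
theorem exists_smooth_inverse {p : ℝ → ℝ}
    (hp : ∀ s ∈ Ioo (-1 / 4 : ℝ) (1 / 4), ContDiffAt ℝ ∞ p s)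
    (hp' : ∀ s ∈ Ioo (-1 / 4 : ℝ) (1 / 4), 1 / 2 ≤ deriv p s) :
    ∃ θ : ℝ → ℝ, ContDiffOn ℝ 2 θ (Ioo (p 0 - 1 / 8) (p 0 + 1 / 8)) ∧
      (∀ y ∈ Ioo (p 0 - 1 / 8) (p 0 + 1 / 8), θ y ∈ Ioo (-1 / 4 : ℝ) (1 / 4) ∧ p (θ y) = y ∧
        HasDerivAt θ (deriv p (θ y))⁻¹ y) ∧
      ∀ s ∈ Ioo (-1 / 4 : ℝ) (1 / 4), θ (p s) = s := by
  set J := Ioo (-1 / 4 : ℝ) (1 / 4) with hJ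
  set O := Ioo (p 0 - 1 / 8) (p 0 + 1 / 8) with hO
  have hcont : ContinuousOn p J := fun s hs => (hp s hs).continuousAt.continuousWithinAt
  have hdiff : DifferentiableOn ℝ p (interior J) := by
    rw [hJ, interior_Ioo]
    exact fun s hs => ((hp s hs).differentiableAt (by simp)).differentiableWithinAt
  have hgrow : ∀ s ∈ J, ∀ t ∈ J, s ≤ t → 1 / 2 * (t - s) ≤ p t - p s := by
    refine (convex_Ioo _ _).mul_sub_le_image_sub_of_le_deriv hcont hdiff ?_
    rw [interior_Ioo]
    exact hp'
  have hinj : InjOn p J := by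
    intro s hs t ht hst
    rcases le_total s t with h | h
    · have := hgrow s hs t ht h; linarith
    · have := hgrow t ht s hs h; linarith
  have h0 : (0 : ℝ) ∈ J := by constructor <;> norm_num
  have hsurj : ∀ y ∈ O, ∃ s ∈ J, p s = y := by
    intro y hy
    set s := 2 * |y - p 0| with hs
    have hs0 : 0 ≤ s := by positivity
    have hs4 : s < 1 / 4 := by
      have : |y - p 0| < 1 / 8 := abs_lt.2 ⟨by linarith [hy.1], by linarith [hy.2]⟩
      linarith
    have hsJ : s ∈ J := ⟨by linarith, hs4⟩
    have hsJ' : -s ∈ J := ⟨by linarith, by linarith⟩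
    have h1 := hgrow 0 h0 s hsJ hs0
    have h2 := hgrow (-s) hsJ' 0 h0 (by linarith)
    have h3 := abs_le.1 (le_refl |y - p 0|)
    have hsub : Icc (-s) s ⊆ J := fun t ht => ⟨by linarith [ht.1], by linarith [ht.2]⟩
    obtain ⟨t, ht, hty⟩ := intermediate_value_Icc (by linarith : -s ≤ s) (hcont.mono hsub)
      (show y ∈ Icc (p (-s)) (p s) from ⟨by linarith, by linarith⟩)
    exact ⟨t, hsub ht, hty⟩
  set θ := Function.invFunOn p J with hθ
  have hθJ : ∀ y ∈ O, θ y ∈ J := fun y hy => Function.invFunOn_mem (hsurj y hy)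
  have hθp : ∀ y ∈ O, p (θ y) = y := fun y hy => Function.invFunOn_eq (hsurj y hy)
  have hθs : ∀ s ∈ J, θ (p s) = s := fun s hs =>
    hinj (Function.invFunOn_mem ⟨s, hs, rfl⟩) hs (Function.invFunOn_eq ⟨s, hs, rfl⟩)
  have hlip : LipschitzOnWith 2 θ O := by
    refine LipschitzOnWith.of_dist_le_mul fun y hy z hz => ?_
    rw [Real.dist_eq, Real.dist_eq]
    have h1 := hθp y hy
    have h2 := hθp z hz
    push_cast
    rcases le_total (θ y) (θ z) with h | h
    · have h3 := hgrow _ (hθJ y hy) _ (hθJ z hz) h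
      rw [abs_sub_comm, abs_of_nonneg (by linarith), abs_sub_comm]
      have := le_abs_self (z - y)
      linarith
    · have h3 := hgrow _ (hθJ z hz) _ (hθJ y hy) h
      rw [abs_of_nonneg (by linarith)]
      have := le_abs_self (y - z)
      linarith
  have hθd : ∀ y ∈ O, HasDerivAt θ (deriv p (θ y))⁻¹ y := by
    intro y hy
    refine HasDerivAt.of_local_left_inverse
      ((hlip.continuousOn y hy).continuousAt (isOpen_Ioo.mem_nhds hy))
      ((hp _ (hθJ y hy)).differentiableAt (by simp)).hasDerivAt
      (by linarith [hp' _ (hθJ y hy)]) ?_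
    filter_upwards [isOpen_Ioo.mem_nhds hy] with z hz using hθp z hz
  have hsmooth : ∀ n : ℕ, ContDiffOn ℝ n θ O := by
    intro n
    induction n with
    | zero => exact contDiffOn_zero.2 hlip.continuousOn
    | succ n ih =>
      push_cast
      rw [contDiffOn_succ_iff_deriv_of_isOpen isOpen_Ioo]
      refine ⟨fun y hy => (hθd y hy).differentiableAt.differentiableWithinAt,
        fun h => absurd h (by simp), ?_⟩
      have h1 : ContDiffOn ℝ n (fun y => (deriv p (θ y))⁻¹) O := by
        refine ContDiffOn.inv (ContDiffOn.comp (g := deriv p) (t := J) ?_ ih hθJ)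
          fun y hy => (by linarith [hp' _ (hθJ y hy)])
        intro s hs
        have h2 : ContDiffOn ℝ ∞ p J := fun s hs => (hp s hs).contDiffWithinAt
        exact ((contDiffOn_infty_iff_deriv_of_isOpen isOpen_Ioo).1 h2).2.of_le
          (by exact_mod_cast le_top) s hs
      exact h1.congr fun y hy => (hθd y hy).deriv
  exact ⟨θ, by exact_mod_cast hsmooth 2, fun y hy => ⟨hθJ y hy, hθp y hy, hθd y hy⟩, hθs⟩

/-- A plane curve in the unit disc, parametrized by the interval `(-1 / 4, 1 / 4)`, with speed close
to `1` and very small acceleration. -/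
structure IsTameCurve (X : ℝ → Plane) : Prop where
  contDiffAt : ∀ s ∈ Ioo (-1 / 4 : ℝ) (1 / 4), ∀ i, ContDiffAt ℝ ∞ (fun r => X r i) s
  norm_le : ∀ s ∈ Ioo (-1 / 4 : ℝ) (1 / 4), ‖X s‖ ≤ 1
  speed_ge : ∀ s ∈ Ioo (-1 / 4 : ℝ) (1 / 4), 9 / 10 ≤ ∑ i, deriv (fun r => X r i) s ^ 2
  speed_le : ∀ s ∈ Ioo (-1 / 4 : ℝ) (1 / 4), ∑ i, deriv (fun r => X r i) s ^ 2 ≤ 11 / 10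
  deriv₂_le : ∀ s ∈ Ioo (-1 / 4 : ℝ) (1 / 4), ∀ i,
    |deriv (deriv fun r => X r i) s| ≤ 1 / 400

theorem neg_mem_Ioo_quarter {s : ℝ} (hs : s ∈ Ioo (-1 / 4 : ℝ) (1 / 4)) :
    -s ∈ Ioo (-1 / 4 : ℝ) (1 / 4) := ⟨by linarith [hs.2], by linarith [hs.1]⟩

theorem IsTameCurve.comp_neg {X : ℝ → Plane} (hX : IsTameCurve X) :
    IsTameCurve fun s => X (-s) := by
  have h1 : ∀ i s, deriv (fun r => X (-r) i) s = -deriv (fun r => X r i) (-s) := fun i s =>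
    deriv_comp_neg (fun r => X r i) s
  have h2 : ∀ i s, deriv (deriv fun r => X (-r) i) s = deriv (deriv fun r => X r i) (-s) := by
    intro i s
    rw [show (deriv fun r => X (-r) i) = fun s => -deriv (fun r => X r i) (-s) from
      funext (h1 i), deriv.fun_neg, deriv_comp_neg, neg_neg]
  refine ⟨fun s hs i => ?_, fun s hs => hX.norm_le _ (neg_mem_Ioo_quarter hs), fun s hs => ?_,
    fun s hs => ?_, fun s hs i => ?_⟩
  · exact (hX.contDiffAt _ (neg_mem_Ioo_quarter hs) i).comp s contDiff_neg.contDiffAt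
  · simpa [h1] using hX.speed_ge _ (neg_mem_Ioo_quarter hs)
  · simpa [h1] using hX.speed_le _ (neg_mem_Ioo_quarter hs)
  · rw [h2]
    exact hX.deriv₂_le _ (neg_mem_Ioo_quarter hs) i

theorem IsTameCurve.abs_deriv_le {X : ℝ → Plane} (hX : IsTameCurve X) {s : ℝ}
    (hs : s ∈ Ioo (-1 / 4 : ℝ) (1 / 4)) (i : Fin 2) : |deriv (fun r => X r i) s| ≤ 11 / 10 := by
  have h1 := hX.speed_le s hs
  have h2 := Finset.single_le_sum (f := fun i => deriv (fun r => X r i) s ^ 2)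
    (fun i _ => sq_nonneg _) (Finset.mem_univ i)
  exact abs_le_of_sq_le_sq (by simp only at h2; linarith) (by norm_num)

theorem IsTameCurve.differentiableAt_deriv {X : ℝ → Plane} (hX : IsTameCurve X) {s : ℝ}
    (hs : s ∈ Ioo (-1 / 4 : ℝ) (1 / 4)) (i : Fin 2) :
    DifferentiableAt ℝ (deriv fun r => X r i) s := by
  have h2 : ContDiffOn ℝ ∞ (fun r => X r i) (Ioo (-1 / 4 : ℝ) (1 / 4)) := fun s hs =>
    (hX.contDiffAt s hs i).contDiffWithinAt
  exact (((contDiffOn_infty_iff_deriv_of_isOpen isOpen_Ioo).1 h2).2.contDiffAt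
    (isOpen_Ioo.mem_nhds hs)).differentiableAt (by simp)

/-- A tame curve progresses steadily, up to orientation, along one of the coordinate axes. -/
theorem IsTameCurve.exists_half_le_deriv {X : ℝ → Plane} (hX : IsTameCurve X) :
    ∃ i, (∀ s ∈ Ioo (-1 / 4 : ℝ) (1 / 4), 1 / 2 ≤ deriv (fun r => X r i) s) ∨
      ∀ s ∈ Ioo (-1 / 4 : ℝ) (1 / 4), 1 / 2 ≤ -deriv (fun r => X r i) s := by
  have h0 : (0 : ℝ) ∈ Ioo (-1 / 4 : ℝ) (1 / 4) := by constructor <;> norm_num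
  have hclose : ∀ i, ∀ s ∈ Ioo (-1 / 4 : ℝ) (1 / 4),
      |deriv (fun r => X r i) s - deriv (fun r => X r i) 0| ≤ 1 / 100 := by
    intro i s hs
    have h1 := (convex_Ioo (-1 / 4 : ℝ) (1 / 4)).norm_image_sub_le_of_norm_deriv_le
      (f := deriv fun r => X r i) (C := 1 / 400) (fun r hr => hX.differentiableAt_deriv hr i)
      (fun r hr => hX.deriv₂_le r hr i) h0 hs
    rw [Real.norm_eq_abs, Real.norm_eq_abs, sub_zero] at h1
    have h2 : |s| ≤ 1 / 4 := abs_le.2 ⟨by linarith [hs.1], by linarith [hs.2]⟩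
    linarith
  obtain ⟨i, hi⟩ : ∃ i, 9 / 20 ≤ deriv (fun r => X r i) 0 ^ 2 := by
    by_contra! hcon
    have h1 := hX.speed_ge 0 h0
    rw [Fin.sum_univ_two] at h1
    linarith [hcon 0, hcon 1]
  have h3 : 6 / 10 ≤ |deriv (fun r => X r i) 0| := by
    rw [← sq_abs] at hi
    nlinarith [abs_nonneg (deriv (fun r => X r i) 0)]
  refine ⟨i, ?_⟩
  rcases le_abs'.1 h3 with h | h
  · refine Or.inr fun s hs => ?_
    have := abs_le.1 (hclose i s hs)
    linarith
  · refine Or.inl fun s hs => ?_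
    have := abs_le.1 (hclose i s hs)
    linarith

theorem IsTameCurve.injOn {X : ℝ → Plane} (hX : IsTameCurve X) :
    InjOn X (Ioo (-1 / 4 : ℝ) (1 / 4)) := by
  have key : ∀ X : ℝ → Plane, IsTameCurve X → ∀ i,
      (∀ s ∈ Ioo (-1 / 4 : ℝ) (1 / 4), 1 / 2 ≤ deriv (fun r => X r i) s) →
      InjOn X (Ioo (-1 / 4 : ℝ) (1 / 4)) := by
    intro X hX i hi s hs t ht hst
    obtain ⟨θ, -, -, hθ⟩ := exists_smooth_inverse (fun s hs => hX.contDiffAt s hs i) hi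
    rw [← hθ s hs, ← hθ t ht, hst]
  obtain ⟨i, hi | hi⟩ := hX.exists_half_le_deriv
  · exact key X hX i hi
  · have h1 := key _ hX.comp_neg i fun s hs => by
      rw [deriv_comp_neg (fun r => X r i) s]
      exact hi _ (neg_mem_Ioo_quarter hs)
    intro s hs t ht hst
    have := h1 (neg_mem_Ioo_quarter hs) (neg_mem_Ioo_quarter ht) (by simpa using hst)
    linarith

/-- A tame curve that progresses steadily along a coordinate axis is a tame graph over this axis. -/
theorem IsTameCurve.exists_isTameGraph {X : ℝ → Plane} (hX : IsTameCurve X) {i j : Fin 2}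
    (hij : i ≠ j) (hi : ∀ s ∈ Ioo (-1 / 4 : ℝ) (1 / 4), 1 / 2 ≤ deriv (fun r => X r i) s) :
    ∃ h : ℝ → ℝ, IsTameGraph i j (X 0 i) (1 / 16) h ∧
      ∀ s ∈ Ioo (-1 / 4 : ℝ) (1 / 4), X s = graphPoint i (X s i) (h (X s i)) := by
  obtain ⟨θ, hθc, hθ, hθs⟩ := exists_smooth_inverse (fun s hs => hX.contDiffAt s hs i) hi
  set m := X 0 i with hm
  set J := Ioo (-1 / 4 : ℝ) (1 / 4) with hJ
  have hO : Ioo (m - 2 * (1 / 16)) (m + 2 * (1 / 16)) = Ioo (m - 1 / 8) (m + 1 / 8) := by norm_num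
  set O := Ioo (m - 1 / 8) (m + 1 / 8) with hO'
  set p : ℝ → ℝ := fun r => X r i with hp
  set q : ℝ → ℝ := fun r => X r j with hq
  have hqd : ∀ s ∈ J, HasDerivAt q (deriv q s) s := fun s hs =>
    ((hX.contDiffAt s hs j).differentiableAt (by simp)).hasDerivAt
  have hd : ∀ y ∈ O, HasDerivAt (fun y => q (θ y)) (deriv q (θ y) / deriv p (θ y)) y := by
    intro y hy
    rw [div_eq_mul_inv]
    exact (hqd _ (hθ y hy).1).comp y (hθ y hy).2.2
  have hcoord : ∀ s ∈ J, ∀ k, |X s k| ≤ 1 := fun s hs k =>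
    ((PiLp.norm_apply_le (X s) k).trans (hX.norm_le s hs))
  refine ⟨fun y => q (θ y), ⟨hij, by norm_num, by norm_num, ?_, ?_, ?_, ?_⟩, ?_⟩
  · rw [hO]
    intro y hy
    have h1 : ContDiffAt ℝ 2 q (θ y) := by
      exact_mod_cast contDiffAt_infty.1 (hX.contDiffAt _ (hθ y hy).1 j) 2
    exact h1.comp y (hθc.contDiffAt (isOpen_Ioo.mem_nhds hy))
  · rw [hO]
    intro y hy
    rw [(hd y hy).deriv, abs_div]
    have h1 := hX.abs_deriv_le (hθ y hy).1 j
    have h2 := hi _ (hθ y hy).1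
    rw [abs_of_pos (by linarith : 0 < deriv p (θ y)), div_le_iff₀ (by linarith)]
    linarith
  · rw [hO]
    intro y hy
    have hev : deriv (fun y => q (θ y)) =ᶠ[𝓝 y] fun y => deriv q (θ y) / deriv p (θ y) := by
      filter_upwards [isOpen_Ioo.mem_nhds hy] with z hz using (hd z hz).deriv
    have hy' := (hθ y hy).1
    have h2 := hi _ hy'
    have h3 : 0 < deriv p (θ y) := by linarith
    have h4 : HasDerivAt (fun s => deriv q s / deriv p s) _ (θ y) :=
      (hX.differentiableAt_deriv hy' j).hasDerivAt.fun_div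
        (hX.differentiableAt_deriv hy' i).hasDerivAt h3.ne'
    have h5 := h4.comp y (hθ y hy).2.2
    rw [hev.deriv_eq]
    have h6 := h5.deriv
    simp only [Function.comp_def] at h6
    rw [h6]
    have h7 := hX.abs_deriv_le hy' j
    have h8 := hX.abs_deriv_le hy' i
    have h9 := hX.deriv₂_le _ hy' i
    have h10 := hX.deriv₂_le _ hy' j
    have h11 : |deriv (deriv q) (θ y) * deriv p (θ y) - deriv q (θ y) * deriv (deriv p) (θ y)|
        ≤ 1 := by
      calc _ ≤ |deriv (deriv q) (θ y) * deriv p (θ y)|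
            + |deriv q (θ y) * deriv (deriv p) (θ y)| := abs_sub _ _
        _ ≤ 1 / 400 * (11 / 10) + 11 / 10 * (1 / 400) :=
            add_le_add (abs_mul_le_of_le h10 h8) (abs_mul_le_of_le h7 h9)
        _ ≤ 1 := by norm_num
    have h12 : (1 / 2) ^ 3 ≤ deriv p (θ y) ^ 3 := by gcongr
    rw [← div_eq_mul_inv, div_div, abs_div, abs_of_pos (by positivity :
      0 < deriv p (θ y) ^ 2 * deriv p (θ y)), div_le_iff₀ (by positivity), ← pow_succ]
    norm_num at h12 ⊢
    linarith
  · intro y h1 h2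
    have hy : y i ∈ O := by
      rw [abs_le] at h1
      exact ⟨by linarith, by linarith⟩
    have h3 := hcoord _ (hθ _ hy).1 j
    have h4 := hcoord 0 (by constructor <;> norm_num) i
    have h5 : |y i| ≤ 17 / 16 := by
      have := abs_sub_abs_le_abs_sub (y i) m
      linarith
    have h6 : |y j| ≤ 17 / 16 := by
      have := abs_sub_abs_le_abs_sub (y j) (q (θ (y i)))
      have h7 : |q (θ (y i))| ≤ 1 := h3
      linarith
    rw [mem_closedBall_zero_iff, EuclideanSpace.norm_eq]
    refine Real.sqrt_le_iff.2 ⟨by norm_num, ?_⟩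
    have h7 : y i ^ 2 ≤ (17 / 16) ^ 2 := sq_le_sq' (by linarith [(abs_le.1 h5).1]) (abs_le.1 h5).2
    have h8 : y j ^ 2 ≤ (17 / 16) ^ 2 := sq_le_sq' (by linarith [(abs_le.1 h6).1]) (abs_le.1 h6).2
    simp only [Real.norm_eq_abs, sq_abs, Fin.sum_univ_two]
    rcases fin_two_cases i j hij with ⟨rfl, rfl⟩ | ⟨rfl, rfl⟩ <;> linarith
  · intro s hs
    ext k
    by_cases hk : k = i
    · subst hk; rw [graphPoint_self]
    · have hkj : k = j := by
        rcases fin_two_cases i j hij with ⟨rfl, rfl⟩ | ⟨rfl, rfl⟩ <;> fin_cases k <;> simp_all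
      subst hkj
      rw [graphPoint_ne hij]
      change X s k = q (θ (X s i))
      rw [hθs s hs]

/-- Nonnegative supersolutions have bounded integrals along tame curves, in terms of their mass. -/
theorem exists_integral_tameCurve_le :
    ∃ C : ℝ, 0 < C ∧ ∀ (a : Plane → Matrix (Fin 2) (Fin 2) ℝ) (v : Plane → ℝ) (X : ℝ → Plane),
      NearlyFlat a → IsNonnegSupersolution a v → IsTameCurve X →
      ∫ s in (-1 / 64 : ℝ)..(1 / 64), v (X s) ≤ C * (1 + ∫ y in closedBall (0 : Plane) 2, v y) := by
  obtain ⟨C, hC, hgraph⟩ := exists_integral_graph_le (w := 1 / 16) (by norm_num)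
  refine ⟨2 * C, by positivity, fun a v X ha hv hX => ?_⟩
  have key : ∀ X : ℝ → Plane, IsTameCurve X → ∀ i,
      (∀ s ∈ Ioo (-1 / 4 : ℝ) (1 / 4), 1 / 2 ≤ deriv (fun r => X r i) s) →
      ∫ s in (-1 / 64 : ℝ)..(1 / 64), v (X s)
        ≤ 2 * C * (1 + ∫ y in closedBall (0 : Plane) 2, v y) := by
    intro X hX i hi
    obtain ⟨j, hij⟩ := exists_ne i
    obtain ⟨h, hh, hXh⟩ := hX.exists_isTameGraph hij.symm hi
    set p : ℝ → ℝ := fun r => X r i with hp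
    have hle : (-1 / 64 : ℝ) ≤ 1 / 64 := by norm_num
    have huIcc : uIcc (-1 / 64 : ℝ) (1 / 64) = Icc (-1 / 64) (1 / 64) := uIcc_of_le hle
    have hsub : Icc (-1 / 64 : ℝ) (1 / 64) ⊆ Ioo (-1 / 4 : ℝ) (1 / 4) := fun s hs =>
      ⟨by linarith [hs.1], by linarith [hs.2]⟩
    have h0 : (0 : ℝ) ∈ Ioo (-1 / 4 : ℝ) (1 / 4) := by constructor <;> norm_num
    have hpd : ∀ s ∈ Ioo (-1 / 4 : ℝ) (1 / 4), HasDerivAt p (deriv p s) s := fun s hs =>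
      ((hX.contDiffAt s hs i).differentiableAt (by simp)).hasDerivAt
    have hpm : ∀ s ∈ Icc (-1 / 64 : ℝ) (1 / 64),
        p s ∈ Icc (p 0 - 1 / 16 / 2) (p 0 + 1 / 16 / 2) := by
      intro s hs
      have h1 := (convex_Ioo (-1 / 4 : ℝ) (1 / 4)).norm_image_sub_le_of_norm_deriv_le
        (f := p) (C := 11 / 10) (fun r hr => (hpd r hr).differentiableAt)
        (fun r hr => hX.abs_deriv_le hr i) h0 (hsub hs)
      rw [Real.norm_eq_abs, Real.norm_eq_abs, sub_zero] at h1
      have h2 : |s| ≤ 1 / 64 := abs_le.2 ⟨by linarith [hs.1], by linarith [hs.2]⟩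
      have h3 := abs_le.1 (h1.trans (by gcongr : 11 / 10 * |s| ≤ 11 / 10 * (1 / 64)))
      exact ⟨by linarith, by linarith⟩
    set g : ℝ → ℝ := fun r => v (graphPoint i r (h r)) with hg
    have hgX : ∀ s ∈ Icc (-1 / 64 : ℝ) (1 / 64), g (p s) = v (X s) := fun s hs =>
      congrArg v (hXh s (hsub hs)).symm
    have hIsub : Icc (p 0 - 1 / 16 / 2) (p 0 + 1 / 16 / 2)
        ⊆ Ioo (p 0 - 2 * (1 / 16)) (p 0 + 2 * (1 / 16)) := fun r hr =>
      ⟨by linarith [hr.1], by linarith [hr.2]⟩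
    have hgc : ContinuousOn g (Icc (p 0 - 1 / 16 / 2) (p 0 + 1 / 16 / 2)) := by
      refine hv.continuousOn.comp (t := closedBall 0 5) ?_ ?_
      · exact (continuous_graphPoint i).comp_continuousOn (continuousOn_id.prodMk fun r hr =>
          (hh.contDiffAt r (hIsub hr)).continuousAt.continuousWithinAt)
      · intro r hr
        refine closedBall_subset_closedBall (by norm_num) (hh.tube _ ?_ ?_)
        · rw [graphPoint_self]
          exact abs_le.2 ⟨by linarith [hr.1], by linarith [hr.2]⟩
        · rw [graphPoint_self, graphPoint_ne hij.symm, sub_self, abs_zero]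
          norm_num
    have hp'c : ContinuousOn (deriv p) (Icc (-1 / 64 : ℝ) (1 / 64)) := fun s hs =>
      (hX.differentiableAt_deriv (hsub hs) i).continuousAt.continuousWithinAt
    have himage : p '' Icc (-1 / 64 : ℝ) (1 / 64) ⊆ Icc (p 0 - 1 / 16 / 2) (p 0 + 1 / 16 / 2) := by
      rintro _ ⟨s, hs, rfl⟩
      exact hpm s hs
    have hsubst := intervalIntegral.integral_comp_mul_deriv' (a := -1 / 64) (b := 1 / 64)
      (f := p) (f' := deriv p) (g := g) (fun s hs => hpd s (hsub (huIcc ▸ hs))) (huIcc ▸ hp'c)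
      (huIcc ▸ hgc.mono himage)
    have hgpc : ContinuousOn (fun s => g (p s)) (Icc (-1 / 64 : ℝ) (1 / 64)) :=
      hgc.comp (fun s hs => (hpd s (hsub hs)).continuousAt.continuousWithinAt) hpm
    have hnn : ∀ r, 0 ≤ g r := fun r => hv.nonneg _
    have h1 : ∫ s in (-1 / 64 : ℝ)..(1 / 64), v (X s)
        = ∫ s in (-1 / 64 : ℝ)..(1 / 64), g (p s) :=
      intervalIntegral.integral_congr fun s hs => (hgX s (huIcc ▸ hs)).symm
    have h2 : ∫ s in (-1 / 64 : ℝ)..(1 / 64), g (p s)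
        ≤ ∫ s in (-1 / 64 : ℝ)..(1 / 64), 2 * ((g ∘ p) s * deriv p s) := by
      refine intervalIntegral.integral_mono_on hle
        (hgpc.intervalIntegrable_of_Icc hle)
        (((hgpc.mul hp'c).const_mul 2).intervalIntegrable_of_Icc hle) fun s hs => ?_
      have h3 := hi s (hsub hs)
      have h4 := hnn (p s)
      simp only [Function.comp]
      nlinarith
    have hpmono : p (-1 / 64) ≤ p (1 / 64) := by
      have := (convex_Ioo (-1 / 4 : ℝ) (1 / 4)).mul_sub_le_image_sub_of_le_deriv
        (f := p) (C := 1 / 2) (fun s hs => (hpd s hs).continuousAt.continuousWithinAt)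
        (by rw [interior_Ioo]
            exact fun s hs => (hpd s hs).differentiableAt.differentiableWithinAt)
        (by rw [interior_Ioo]; exact hi) (-1 / 64) (hsub ⟨le_rfl, hle⟩) (1 / 64)
        (hsub ⟨hle, le_rfl⟩) hle
      linarith
    have h5 : ∫ r in p (-1 / 64)..p (1 / 64), g r
        ≤ ∫ r in Icc (p 0 - 1 / 16 / 2) (p 0 + 1 / 16 / 2), g r := by
      rw [intervalIntegral.integral_of_le hpmono]
      refine setIntegral_mono_set (hgc.integrableOn_compact isCompact_Icc)
        (Eventually.of_forall hnn) (LE.le.eventuallyLE ?_)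
      exact Ioc_subset_Icc_self.trans (Icc_subset_Icc (hpm _ ⟨le_rfl, hle⟩).1
        (hpm _ ⟨hle, le_rfl⟩).2)
    rw [intervalIntegral.integral_const_mul, hsubst] at h2
    have h6 := hgraph a v i j (p 0) h ha hv hh
    rw [h1]
    linarith
  obtain ⟨i, hi | hi⟩ := hX.exists_half_le_deriv
  · exact key X hX i hi
  · have h1 := key _ hX.comp_neg i fun s hs => by
      rw [deriv_comp_neg (fun r => X r i) s]
      exact hi _ (neg_mem_Ioo_quarter hs)
    have h2 := intervalIntegral.integral_comp_neg (a := -1 / 64) (b := 1 / 64)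
      (fun s => v (X s))
    rw [h2] at h1
    convert h1 using 2 <;> norm_num

/-! ### Geodesics in nearly flat charts -/

/-- A curve of speed at most `L` that starts at a point of the unit ball of a chart stays in this
ball as long as its length does not exceed the distance to the boundary. -/
theorem mem_source_of_deriv_le [T2Space M] {e : OpenPartialHomeomorph M Plane}
    (hsub : closedBall (0 : Plane) 1 ⊆ e.target) {γ : ℝ → M} (hγ : Continuous γ) {L : ℝ}
    (hL : 0 ≤ L) (hd : ∀ t, γ t ∈ e.source → ‖e (γ t)‖ ≤ 1 →
      DifferentiableAt ℝ (fun s => e (γ s)) t ∧ ‖deriv (fun s => e (γ s)) t‖ ≤ L)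
    {a b : ℝ} (ha : γ a ∈ e.source) (hab : ‖e (γ a)‖ + L * (b - a) < 1) :
    ∀ t ∈ Icc a b, γ t ∈ e.source ∧ ‖e (γ t)‖ ≤ 1 := by
  set f : ℝ → Plane := fun s => e (γ s) with hf
  set K := e.source ∩ e ⁻¹' closedBall (0 : Plane) 1 with hK
  have hKc : IsClosed K := by
    rw [hK, ← e.symm_image_eq_source_inter_preimage hsub]
    exact ((isCompact_closedBall 0 1).image_of_continuousOn (e.continuousOn_symm.mono hsub)).isClosed
  set Z := γ ⁻¹' K with hZ
  have hZc : IsClosed Z := hKc.preimage hγ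
  have hZmem : ∀ t ∈ Z, γ t ∈ e.source ∧ ‖f t‖ ≤ 1 := fun t ht =>
    ⟨ht.1, mem_closedBall_zero_iff.1 ht.2⟩
  have hfc : ContinuousOn f Z := fun t ht =>
    (hd t (hZmem t ht).1 (hZmem t ht).2).1.continuousAt.continuousWithinAt
  set S := {t ∈ Z | ‖f t - f a‖ ≤ L * (t - a)} with hS
  have hSc : IsClosed S := hZc.isClosed_le ((hfc.sub continuousOn_const).norm) (by fun_prop)
  intro t ht
  have hab' : a ≤ b := ht.1.trans ht.2
  have hLab : 0 ≤ L * (b - a) := mul_nonneg hL (by linarith)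
  have hmain : Icc a b ⊆ S := by
    refine (hSc.inter isClosed_Icc).Icc_subset_of_forall_exists_gt
      ⟨⟨ha, mem_closedBall_zero_iff.2 (by linarith)⟩, by simp⟩ ?_
    rintro t ⟨⟨htZ, hta⟩, htab⟩ y hy
    have h1 : ‖f t‖ < 1 := by
      have h2 := norm_sub_norm_le (f t) (f a)
      have h3 : L * (t - a) ≤ L * (b - a) := by
        have := htab.2.le
        gcongr
      have h4 : ‖f a‖ + L * (b - a) < 1 := hab
      linarith
    have hev : ∀ᶠ s in 𝓝 t, γ s ∈ e.source ∧ ‖f s‖ < 1 :=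
      (hγ.continuousAt.eventually_mem (e.open_source.mem_nhds htZ.1)).and
        ((hd t htZ.1 h1.le).1.continuousAt.norm.eventually_lt continuousAt_const h1)
    obtain ⟨δ, hδ, hball⟩ := Metric.eventually_nhds_iff_ball.1 hev
    set s := min y (t + δ / 2) with hs
    have hts : t < s := lt_min hy (by linarith)
    have hst : s ≤ t + δ / 2 := min_le_right _ _
    have hseg : ∀ r ∈ Icc t s, γ r ∈ e.source ∧ ‖f r‖ < 1 := fun r hr =>
      hball r (by rw [mem_ball, Real.dist_eq, abs_lt]; constructor <;> linarith [hr.1, hr.2])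
    have h2 := (convex_Icc t s).norm_image_sub_le_of_norm_deriv_le (f := f) (C := L)
      (fun r hr => (hd r (hseg r hr).1 (hseg r hr).2.le).1)
      (fun r hr => (hd r (hseg r hr).1 (hseg r hr).2.le).2) (left_mem_Icc.2 hts.le)
      (right_mem_Icc.2 hts.le)
    rw [Real.norm_of_nonneg (by linarith)] at h2
    obtain ⟨h3, h4⟩ := hseg s (right_mem_Icc.2 hts.le)
    refine ⟨s, ⟨⟨h3, mem_closedBall_zero_iff.2 h4.le⟩, ?_⟩, hts, min_le_left _ _⟩
    calc ‖f s - f a‖ ≤ ‖f s - f t‖ + ‖f t - f a‖ := norm_sub_le_norm_sub_add_norm_sub _ _ _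
      _ ≤ L * (s - t) + L * (t - a) := add_le_add h2 hta
      _ = L * (s - a) := by ring
  exact hZmem t (hmain ht).1

theorem deriv_coord {f : ℝ → Plane} {t : ℝ} (hf : DifferentiableAt ℝ f t) (i : Fin 2) :
    deriv (fun s => f s i) t = deriv f t i :=
  ((hasFDerivAt_coord i (f t)).comp_hasDerivAt t hf.hasDerivAt).deriv

section Geodesic

variable {σ : Metric M} {e : OpenPartialHomeomorph M Plane} {ρ : ℝ} {γ : ℝ → M} {T : ℝ}

theorem IsFlatChart.speed_bounds (h : IsFlatChart σ e ρ) (hγ : IsClosedGeodesic σ γ T) {t : ℝ}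
    (ht : γ t ∈ e.source) (ht1 : ‖e (γ t)‖ ≤ 1) :
    9 / 10 ≤ ρ ^ 2 * ∑ i, deriv (fun s => e (γ s) i) t ^ 2 ∧
      ρ ^ 2 * ∑ i, deriv (fun s => e (γ s) i) t ^ 2 ≤ 11 / 10 := by
  have hd : ∀ i, deriv (fun s => e (γ s)) t i = deriv (fun s => e (γ s) i) t := fun i =>
    (deriv_coord ((contDiffAt_chart_comp hγ.smooth h.mem ht).differentiableAt (by simp)) i).symm
  have h1 := hγ.unit_speed t
  rw [speed_eq σ hγ.smooth h.mem ht, Real.sqrt_eq_one] at h1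
  simp only [hd] at h1
  have hy : e (γ t) ∈ closedBall (0 : Plane) 5 := mem_closedBall_zero_iff.2 (by linarith)
  have hG := h.gram_sub_le _ hy
  set d : Fin 2 → ℝ := fun i => deriv (fun s => e (γ s) i) t
  have hρ : 0 < ρ ^ 2 := by have := h.pos; positivity
  have key : |∑ i, ∑ j, d i * d j * (gram σ e (e (γ t)) i j
      - ρ ^ 2 * (1 : Matrix (Fin 2) (Fin 2) ℝ) i j)| ≤ 1 / 1000 * (ρ ^ 2 * ∑ i, d i ^ 2) := by
    calc _ ≤ ∑ i, ∑ j, |d i| * |d j| * (1 / 2000 * ρ ^ 2) := by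
          refine (Finset.abs_sum_le_sum_abs _ _).trans (Finset.sum_le_sum fun i _ =>
            (Finset.abs_sum_le_sum_abs _ _).trans (Finset.sum_le_sum fun j _ => ?_))
          rw [abs_mul, abs_mul]
          gcongr
          exact hG i j
      _ ≤ _ := by
          simp only [Fin.sum_univ_two]
          rw [← sq_abs (d 0), ← sq_abs (d 1)]
          nlinarith [mul_nonneg hρ.le (sq_nonneg (|d 0| - |d 1|))]
  have h2 : ∑ i, ∑ j, d i * d j * (gram σ e (e (γ t)) i j
      - ρ ^ 2 * (1 : Matrix (Fin 2) (Fin 2) ℝ) i j) = 1 - ρ ^ 2 * ∑ i, d i ^ 2 := by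
    rw [← h1]
    simp [Fin.sum_univ_two]
    ring
  rw [h2, abs_le] at key
  constructor <;> linarith [key.1, key.2]

theorem IsFlatChart.norm_deriv_le (h : IsFlatChart σ e ρ) (hγ : IsClosedGeodesic σ γ T) {t : ℝ}
    (ht : γ t ∈ e.source) (ht1 : ‖e (γ t)‖ ≤ 1) : ‖deriv (fun s => e (γ s)) t‖ ≤ 2 / ρ := by
  have hd : ∀ i, deriv (fun s => e (γ s)) t i = deriv (fun s => e (γ s) i) t := fun i =>
    (deriv_coord ((contDiffAt_chart_comp hγ.smooth h.mem ht).differentiableAt (by simp)) i).symm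
  have h1 := (h.speed_bounds hγ ht ht1).2
  have hρ := h.pos
  rw [EuclideanSpace.norm_eq]
  refine Real.sqrt_le_iff.2 ⟨by positivity, ?_⟩
  simp only [Real.norm_eq_abs, sq_abs, hd]
  rw [div_pow, le_div_iff₀ (by positivity)]
  linarith

theorem IsFlatChart.mem_source_of_abs_sub_le [T2Space M] (h : IsFlatChart σ e ρ)
    (hγ : IsClosedGeodesic σ γ T) {t₀ : ℝ} (ht : γ t₀ ∈ e.source) (ht1 : ‖e (γ t₀)‖ < 1 / 2)
    {t : ℝ} (htt : |t - t₀| ≤ ρ / 4) : γ t ∈ e.source ∧ ‖e (γ t)‖ ≤ 1 := by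
  have hρ := h.pos
  have hsub : closedBall (0 : Plane) 1 ⊆ e.target :=
    (closedBall_subset_closedBall (by norm_num)).trans h.subset_target
  have hd : ∀ t, γ t ∈ e.source → ‖e (γ t)‖ ≤ 1 →
      DifferentiableAt ℝ (fun s => e (γ s)) t ∧ ‖deriv (fun s => e (γ s)) t‖ ≤ 2 / ρ :=
    fun t h1 h2 => ⟨(contDiffAt_chart_comp hγ.smooth h.mem h1).differentiableAt (by simp),
      h.norm_deriv_le hγ h1 h2⟩
  have hlen : 2 / ρ * (ρ / 4) = 1 / 2 := by field_simp; norm_num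
  rw [abs_le] at htt
  rcases le_total t₀ t with htt' | htt'
  · refine mem_source_of_deriv_le hsub hγ.smooth.continuous (L := 2 / ρ) (by positivity) hd
      (a := t₀) (b := t₀ + ρ / 4) ht ?_ t ⟨htt', by linarith⟩
    rw [add_sub_cancel_left, hlen]
    linarith
  · have h1 := mem_source_of_deriv_le (γ := fun s => γ (-s)) hsub
      (hγ.smooth.continuous.comp continuous_neg) (L := 2 / ρ) (by positivity) (fun s hs hs1 => ?_)
      (a := -t₀) (b := -t₀ + ρ / 4) (by simpa using ht) ?_ (-t) ⟨by linarith, by linarith⟩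
    · simpa using h1
    · obtain ⟨h2, h3⟩ := hd (-s) hs hs1
      refine ⟨h2.comp s differentiable_neg.differentiableAt, ?_⟩
      rw [deriv_comp_neg (fun s => e (γ s)) s, norm_neg]
      exact h3
    · rw [add_sub_cancel_left, hlen, neg_neg]
      linarith

theorem deriv_comp_add_mul (f : ℝ → ℝ) (a b s : ℝ) :
    deriv (fun r => f (a + b * r)) s = b * deriv f (a + b * s) := by
  rw [deriv_comp_mul_left b (fun r => f (a + r)) s, deriv_comp_const_add, smul_eq_mul]

/-- Rescaled to nearly unit speed in a nearly flat chart, a geodesic is a tame curve. -/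
theorem IsFlatChart.isTameCurve [T2Space M] (h : IsFlatChart σ e ρ)
    (hγ : IsClosedGeodesic σ γ T) {t₀ : ℝ} (ht : γ t₀ ∈ e.source) (ht1 : ‖e (γ t₀)‖ < 1 / 2) :
    IsTameCurve fun s => e (γ (t₀ + ρ * s)) := by
  have hρ := h.pos
  have hmem : ∀ s ∈ Ioo (-1 / 4 : ℝ) (1 / 4),
      γ (t₀ + ρ * s) ∈ e.source ∧ ‖e (γ (t₀ + ρ * s))‖ ≤ 1 := by
    intro s hs
    refine h.mem_source_of_abs_sub_le hγ ht ht1 ?_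
    rw [add_sub_cancel_left, abs_mul, abs_of_pos hρ]
    have : |s| ≤ 1 / 4 := abs_le.2 ⟨by linarith [hs.1], by linarith [hs.2]⟩
    have := mul_le_mul_of_nonneg_left this hρ.le
    linarith
  have hd : ∀ i s, deriv (fun r => e (γ (t₀ + ρ * r)) i) s
      = ρ * deriv (fun r => e (γ r) i) (t₀ + ρ * s) := fun i s =>
    deriv_comp_add_mul (fun r => e (γ r) i) t₀ ρ s
  have hd2 : ∀ i s, deriv (deriv fun r => e (γ (t₀ + ρ * r)) i) s
      = ρ ^ 2 * deriv (deriv fun r => e (γ r) i) (t₀ + ρ * s) := by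
    intro i s
    rw [show (deriv fun r => e (γ (t₀ + ρ * r)) i)
      = fun s => ρ * deriv (fun r => e (γ r) i) (t₀ + ρ * s) from funext (hd i),
      deriv_const_mul_field, deriv_comp_add_mul (deriv fun r => e (γ r) i)]
    ring
  refine ⟨fun s hs i => ?_, fun s hs => (hmem s hs).2, fun s hs => ?_, fun s hs => ?_,
    fun s hs i => ?_⟩
  · have h1 : ContDiffAt ℝ ∞ (fun r => e (γ r)) (t₀ + ρ * s) :=
      contDiffAt_chart_comp hγ.smooth h.mem (hmem s hs).1
    have h2 : ContDiffAt ℝ ∞ (fun r => t₀ + ρ * r) s :=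
      (contDiff_const.add (contDiff_const.mul contDiff_id)).contDiffAt
    exact (contDiff_coord i).contDiffAt.comp s
      (ContDiffAt.comp (g := fun r => e (γ r)) s h1 h2)
  · simp only [hd, mul_pow, ← Finset.mul_sum]
    exact (h.speed_bounds hγ (hmem s hs).1 (hmem s hs).2).1
  · simp only [hd, mul_pow, ← Finset.mul_sum]
    exact (h.speed_bounds hγ (hmem s hs).1 (hmem s hs).2).2
  · obtain ⟨hs1, hs2⟩ := hmem s hs
    rw [hd2]
    have hgeo := hγ.geodesic_eq e h.mem _ hs1 i
    have hsp := (h.speed_bounds hγ hs1 hs2).2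
    have hy : e (γ (t₀ + ρ * s)) ∈ closedBall (0 : Plane) 5 :=
      mem_closedBall_zero_iff.2 (by linarith)
    set t := t₀ + ρ * s
    set d : Fin 2 → ℝ := fun i => deriv (fun s => e (γ s) i) t
    have h1 : deriv (deriv fun s => e (γ s) i) t
        = -∑ k, ∑ l, christoffel σ e i k l (e (γ t)) * d k * d l := by linarith
    have h2 : |∑ k, ∑ l, christoffel σ e i k l (e (γ t)) * d k * d l|
        ≤ 1 / 500 * ∑ k, d k ^ 2 := by
      calc _ ≤ ∑ k, ∑ l, 1 / 1000 * |d k| * |d l| := by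
            refine (Finset.abs_sum_le_sum_abs _ _).trans (Finset.sum_le_sum fun k _ =>
              (Finset.abs_sum_le_sum_abs _ _).trans (Finset.sum_le_sum fun l _ => ?_))
            rw [abs_mul, abs_mul]
            gcongr
            exact h.abs_christoffel_le hy i k l
        _ ≤ _ := by
            simp only [Fin.sum_univ_two]
            rw [← sq_abs (d 0), ← sq_abs (d 1)]
            nlinarith [sq_nonneg (|d 0| - |d 1|)]
    rw [h1, abs_mul, abs_neg, abs_of_pos (by positivity : 0 < ρ ^ 2)]
    have h3 := mul_le_mul_of_nonneg_left h2 (sq_nonneg ρ)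
    linarith

theorem IsFlatChart.le_period [T2Space M] (h : IsFlatChart σ e ρ)
    (hγ : IsClosedGeodesic σ γ T) {t₀ : ℝ} (ht : γ t₀ ∈ e.source) (ht1 : ‖e (γ t₀)‖ < 1 / 2) :
    ρ / 4 ≤ T := by
  by_contra! hcon
  have hρ := h.pos
  have hT := hγ.period_pos
  have hT' : T / ρ < 1 / 4 := by rw [div_lt_iff₀ hρ]; linarith
  have hT0 : 0 < T / ρ := by positivity
  have h1 := (h.isTameCurve hγ ht ht1).injOn (x₁ := 0) (x₂ := T / ρ)
    ⟨by norm_num, by norm_num⟩ ⟨by linarith, hT'⟩ (by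
      simp only [mul_zero, add_zero]
      rw [mul_div_cancel₀ _ hρ.ne', hγ.periodic t₀])
  linarith

end Geodesic

/-- The integral of a conformal defect over a short piece of a geodesic in a nearly flat chart. -/
theorem exists_integral_geodesic_le (M : Type*) [TopologicalSpace M] [ChartedSpace Plane M]
    [IsManifold (𝓡 2) ∞ M] [T2Space M] :
    ∃ C : ℝ, 0 < C ∧ ∀ (σ : Metric M) (e : OpenPartialHomeomorph M Plane) (ρ : ℝ) (γ : ℝ → M)
      (T t₀ : ℝ) (v : M → ℝ), IsFlatChart σ e ρ → IsClosedGeodesic σ γ T →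
      IsConformalDefect σ v → γ t₀ ∈ e.source → ‖e (γ t₀)‖ < 1 / 2 →
      ∫ t in (t₀ - ρ / 64)..(t₀ + ρ / 64), v (γ t) ≤ C * (1 + chartMass e v) := by
  obtain ⟨C, hC, hcurve⟩ := exists_integral_tameCurve_le
  refine ⟨C, hC, fun σ e ρ γ T t₀ v h hγ hv ht ht1 => ?_⟩
  have hρ := h.pos
  have h1 := hcurve _ _ _ h.nearlyFlat (hv.isNonnegSupersolution h) (h.isTameCurve hγ ht ht1)
  have h2 : ∫ s in (-1 / 64 : ℝ)..(1 / 64), v (e.symm (e (γ (t₀ + ρ * s))))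
      = ∫ s in (-1 / 64 : ℝ)..(1 / 64), v (γ (t₀ + ρ * s)) := by
    refine intervalIntegral.integral_congr fun s hs => ?_
    rw [uIcc_of_le (by norm_num)] at hs
    have h3 : |s| ≤ 1 / 4 := abs_le.2 ⟨by linarith [hs.1], by linarith [hs.2]⟩
    have h4 := h.mem_source_of_abs_sub_le hγ ht ht1 (t := t₀ + ρ * s) (by
      rw [add_sub_cancel_left, abs_mul, abs_of_pos hρ]
      have := mul_le_mul_of_nonneg_left h3 hρ.le
      linarith)
    simp only [e.left_inv h4.1]
  have h5 := intervalIntegral.smul_integral_comp_add_mul (a := -1 / 64) (b := 1 / 64)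
    (fun t => v (γ t)) ρ t₀
  rw [show t₀ + ρ * (-1 / 64) = t₀ - ρ / 64 by ring, show t₀ + ρ * (1 / 64) = t₀ + ρ / 64 by ring,
    smul_eq_mul] at h5
  have hV := hv.chartMass_nonneg e
  have h6 : ∫ s in (-1 / 64 : ℝ)..(1 / 64), v (γ (t₀ + ρ * s)) ≤ C * (1 + chartMass e v) :=
    h2 ▸ h1
  rw [← h5]
  have h7 : 0 ≤ C * (1 + chartMass e v) := by positivity
  nlinarith [h.le_half]

theorem exists_pos_le_of_finite {α : Type*} {s : Set α} (hs : s.Finite) {f : α → ℝ}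
    (hf : ∀ x ∈ s, 0 < f x) : ∃ r : ℝ, 0 < r ∧ ∀ x ∈ s, r ≤ f x := by
  induction s, hs using Set.Finite.induction_on with
  | empty => exact ⟨1, one_pos, by simp⟩
  | @insert a s _ _ ih =>
    obtain ⟨r, hr, h⟩ := ih fun x hx => hf x (mem_insert_of_mem _ hx)
    refine ⟨min r (f a), lt_min hr (hf a (mem_insert _ _)), ?_⟩
    rintro x (rfl | hx)
    · exact min_le_right _ _
    · exact (min_le_left _ _).trans (h x hx)

/-- The length of a closed geodesic is bounded below, and the integral of a conformal defect over
the geodesic is bounded in terms of the length. -/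
theorem exists_integral_closedGeodesic_le [T2Space M] [CompactSpace M] [ConnectedSpace M]
    (σ : Metric M) :
    ∃ C τ : ℝ, 0 < C ∧ 0 < τ ∧ ∀ (γ : ℝ → M) (T : ℝ), IsClosedGeodesic σ γ T → τ ≤ T ∧
      ∀ v, IsConformalDefect σ v → ∫ t in (0 : ℝ)..T, v (γ t) ≤ C * (1 + T) := by
  obtain ⟨s, C₁, hs, hflat, hcover, hmass⟩ := exists_flatAtlas σ
  obtain ⟨C₂, hC₂, hlocal⟩ := exists_integral_geodesic_le M
  choose! R hR using hflat
  obtain ⟨r, hr, hrR⟩ := exists_pos_le_of_finite hs fun e he => (hR e he).pos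
  set D := C₂ * (1 + max C₁ 0) with hD
  have hD0 : 0 < D := by positivity
  set τ := r / 64 with hτ
  have hτ0 : 0 < τ := by positivity
  refine ⟨D * (1 + 1 / (2 * τ)), τ, by positivity, hτ0, fun γ T hγ => ⟨?_, fun v hv => ?_⟩⟩
  · obtain ⟨e, he, h1, h2⟩ := hcover (γ 0)
    have h3 := (hR e he).le_period hγ h1 h2
    have h4 := hrR e he
    linarith
  have hcont : Continuous fun t => v (γ t) := hv.smooth.continuous.comp hγ.smooth.continuous
  have hint : ∀ a b, IntervalIntegrable (fun t => v (γ t)) volume a b := fun a b =>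
    hcont.intervalIntegrable a b
  have hnn : 0 ≤ᵐ[volume] fun t => v (γ t) := Eventually.of_forall fun t => hv.nonneg _
  have hpiece : ∀ t₀, ∫ t in (t₀ - τ)..(t₀ + τ), v (γ t) ≤ D := by
    intro t₀
    obtain ⟨e, he, h1, h2⟩ := hcover (γ t₀)
    have h3 := hlocal σ e (R e) γ T t₀ v (hR e he) hγ hv h1 h2
    have h4 := hrR e he
    have h5 : ∫ t in (t₀ - τ)..(t₀ + τ), v (γ t)
        ≤ ∫ t in (t₀ - R e / 64)..(t₀ + R e / 64), v (γ t) :=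
      intervalIntegral.integral_mono_interval (by linarith) (by linarith) (by linarith)
        (ae_restrict_of_ae hnn) (hint _ _)
    have h6 : chartMass e v ≤ max C₁ 0 := (hmass e he v hv).trans (le_max_left _ _)
    calc _ ≤ C₂ * (1 + chartMass e v) := h5.trans h3
      _ ≤ D := by rw [hD]; gcongr
  have hT := hγ.period_pos
  set n := ⌈T / (2 * τ)⌉₊ with hn
  have hn1 : T ≤ 2 * τ * n := by
    have := Nat.le_ceil (T / (2 * τ))
    rw [div_le_iff₀ (by positivity)] at this
    linarith
  have hn2 : (n : ℝ) ≤ T / (2 * τ) + 1 := (Nat.ceil_lt_add_one (by positivity)).le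
  have hsum := intervalIntegral.sum_integral_adjacent_intervals (f := fun t => v (γ t))
    (μ := volume) (a := fun k : ℕ => 2 * τ * k) (n := n) fun k _ => hint _ _
  have h1 : ∫ t in (0 : ℝ)..T, v (γ t) ≤ ∫ t in (0 : ℝ)..(2 * τ * n), v (γ t) :=
    intervalIntegral.integral_mono_interval le_rfl hT.le hn1 (ae_restrict_of_ae hnn) (hint _ _)
  have h2 : ∫ t in (0 : ℝ)..(2 * τ * n), v (γ t) ≤ n * D := by
    have h3 := hsum.symm
    simp only [Nat.cast_zero, mul_zero] at h3
    rw [h3]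
    calc _ ≤ ∑ _k ∈ Finset.range n, D := by
          refine Finset.sum_le_sum fun k _ => ?_
          have := hpiece (2 * τ * k + τ)
          rwa [show 2 * τ * k + τ - τ = 2 * τ * k by ring,
            show 2 * τ * k + τ + τ = 2 * τ * ((k + 1 : ℕ) : ℝ) by push_cast; ring] at this
      _ = n * D := by simp
  calc _ ≤ n * D := h1.trans h2
    _ ≤ (T / (2 * τ) + 1) * D := by gcongr
    _ ≤ D * (1 + 1 / (2 * τ)) * (1 + T) := by
        have h3 : 0 ≤ D * (1 / (2 * τ)) := by positivity
        have h4 : 0 ≤ D * T := by positivity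
        rw [show T / (2 * τ) = T * (1 / (2 * τ)) by ring]
        linarith

/-! ### Area and the maximum of the conformal factor -/

section Area

variable [MeasurableSpace M] [BorelSpace M] {σ g : Metric M}

theorem area_pos [Nonempty M] (σ : Metric M) : 0 < area σ := by
  obtain ⟨p⟩ := ‹Nonempty M›
  obtain ⟨e, ρ, h, -, -⟩ := exists_isFlatChart σ p
  have hρ := h.pos
  have hme : AEMeasurable e.symm ((volume.restrict e.target).withDensity
      fun y => ENNReal.ofReal √(gram σ e y).det) :=
    (e.continuousOn_symm.aemeasurable e.open_target.measurableSet).mono_ac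
      (withDensity_absolutelyContinuous _ _)
  have h1 : chartMeasure σ e univ ≤ area σ :=
    Measure.le_iff'.1 (le_iSup₂ (f := fun e (_ : e ∈ smoothCharts M) => chartMeasure σ e) e h.mem) _
  refine lt_of_lt_of_le ?_ h1
  rw [chartMeasure, Measure.map_apply_of_aemeasurable hme MeasurableSet.univ, preimage_univ,
    withDensity_apply _ MeasurableSet.univ, Measure.restrict_univ]
  calc (0 : ℝ≥0∞) < ENNReal.ofReal (ρ ^ 2 / 2) * volume (closedBall (0 : Plane) 5) :=
        ENNReal.mul_pos (by simpa using pow_pos hρ 2) (measure_closedBall_pos _ _ (by norm_num)).ne'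
    _ = ∫⁻ y in closedBall (0 : Plane) 5, ENNReal.ofReal (ρ ^ 2 / 2) := by
        rw [setLIntegral_const]
    _ ≤ ∫⁻ y in closedBall (0 : Plane) 5, ENNReal.ofReal √(gram σ e y).det := by
        refine setLIntegral_mono' measurableSet_closedBall fun y hy => ENNReal.ofReal_le_ofReal ?_
        obtain ⟨s, hs, hs1, -⟩ := h.exists_normalized hy
        rw [abs_le] at hs1
        rw [hs]
        nlinarith [sq_nonneg ρ]
    _ ≤ ∫⁻ y in e.target, ENNReal.ofReal √(gram σ e y).det :=
        lintegral_mono_set h.subset_target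

theorem area_conformal_le {u : M → ℝ} (hc : IsConformalFactor σ g u) {m : ℝ} (hm : ∀ x, u x ≤ m) :
    area g ≤ ENNReal.ofReal (Real.exp (2 * m)) * area σ := by
  set c := ENNReal.ofReal (Real.exp (2 * m)) with hcdef
  have hchart : ∀ e ∈ smoothCharts M, chartMeasure g e ≤ c • chartMeasure σ e := by
    intro e he
    have hle : (volume.restrict e.target).withDensity (fun y => ENNReal.ofReal √(gram g e y).det)
        ≤ c • (volume.restrict e.target).withDensity
          (fun y => ENNReal.ofReal √(gram σ e y).det) := by
      rw [← withDensity_smul' _ _ ENNReal.ofReal_ne_top]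
      refine withDensity_mono (Eventually.of_forall fun y => ?_)
      rw [Pi.smul_apply, smul_eq_mul, ← ENNReal.ofReal_mul (Real.exp_pos _).le]
      refine ENNReal.ofReal_le_ofReal ?_
      rw [gram_conformal_eq_smul hc, Matrix.det_smul, Fintype.card_fin,
        Real.sqrt_mul (by positivity), Real.sqrt_sq (Real.exp_pos _).le]
      gcongr
      exact hm _
    have hme : AEMeasurable e.symm (c • (volume.restrict e.target).withDensity
        fun y => ENNReal.ofReal √(gram σ e y).det) :=
      ((e.continuousOn_symm.aemeasurable e.open_target.measurableSet).mono_ac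
        (withDensity_absolutelyContinuous _ _)).smul_measure _
    rw [chartMeasure, chartMeasure, ← Measure.map_smul]
    exact Measure.map_mono_of_aemeasurable hle hme
  have h1 : riemannianMeasure g ≤ c • riemannianMeasure σ := by
    refine iSup₂_le fun e he => (hchart e he).trans ?_
    have h2 : chartMeasure σ e ≤ riemannianMeasure σ :=
      le_iSup₂ (f := fun e (_ : e ∈ smoothCharts M) => chartMeasure σ e) e he
    exact Measure.le_iff'.2 fun s => by
      simp only [Measure.smul_apply, smul_eq_mul]
      gcongr
  exact Measure.le_iff'.1 h1 univ

/-- If the areas agree, the conformal factor cannot be negative everywhere. -/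
theorem conformalFactor_bound_nonneg [Nonempty M] {u : M → ℝ} (hc : IsConformalFactor σ g u)
    {A : ℝ≥0} (hσ : area σ = A) (hg : area g = A) {m : ℝ} (hm : ∀ x, u x ≤ m) : 0 ≤ m := by
  by_contra! hneg
  have hA : 0 < A := by
    have := area_pos σ
    rw [hσ] at this
    exact_mod_cast this
  have h1 := area_conformal_le hc hm
  rw [hσ, hg] at h1
  have h2 : ENNReal.ofReal (Real.exp (2 * m)) * (A : ℝ≥0∞) < 1 * A := by
    refine ENNReal.mul_lt_mul_left (by exact_mod_cast hA.ne') ENNReal.coe_ne_top ?_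
    rw [← ENNReal.ofReal_one]
    exact (ENNReal.ofReal_lt_ofReal_iff one_pos).2 (by rw [← Real.exp_zero]; exact Real.exp_lt_exp.2 (by linarith))
  rw [one_mul] at h2
  exact absurd h1 (not_le.2 h2)

end Area

/-! ### Integrals of the conformal factor over closed geodesics -/

/-- For the conformal factor `u` of a nonpositively curved metric, `max u - u` is a conformal
defect. -/
theorem IsConformalFactor.isConformalDefect {σ g : Metric M} {u : M → ℝ}
    (hc : IsConformalFactor σ g u) (hσ : IsHyperbolic σ) (hg : IsNonpositivelyCurved g) {x₀ : M}
    (hx₀ : ∀ x, u x ≤ u x₀) : IsConformalDefect σ fun x => u x₀ - u x where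
  smooth := contMDiff_const.sub hc.smooth
  nonneg x := sub_nonneg.2 (hx₀ x)
  exists_eq_zero := ⟨x₀, sub_self _⟩
  divOp_le e he y hy := by
    rw [divOp_const_sub]
    have := neg_sqrt_det_le_divOp hc he hy hσ hg
    linarith

theorem IsClosedGeodesic.length_eq {σ : Metric M} {γ : ℝ → M} {T : ℝ}
    (hγ : IsClosedGeodesic σ γ T) : length σ γ T = T := by
  simp [length, hγ.unit_speed]

theorem IsClosedGeodesic.lineIntegral_eq {σ : Metric M} {γ : ℝ → M} {T : ℝ}
    (hγ : IsClosedGeodesic σ γ T) (u : M → ℝ) :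
    lineIntegral σ γ T u = ∫ t in (0 : ℝ)..T, u (γ t) := by
  simp [lineIntegral, hγ.unit_speed]

theorem IsClosedGeodesic.length_conformal {σ g : Metric M} {γ : ℝ → M} {T : ℝ}
    (hγ : IsClosedGeodesic σ γ T) {u : M → ℝ} (hc : IsConformalFactor σ g u) :
    length g γ T = ∫ t in (0 : ℝ)..T, Real.exp (u (γ t)) := by
  rw [length]
  refine intervalIntegral.integral_congr fun t _ => ?_
  have h1 := hγ.unit_speed t
  rw [speed, Real.sqrt_eq_one] at h1
  simp only [speed]
  rw [hc.inner_eq, h1, mul_one, show 2 * u (γ t) = u (γ t) + u (γ t) by ring, Real.exp_add,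
    Real.sqrt_mul_self (Real.exp_pos _).le]

/-- The conformal factor of a nonpositively curved metric with the area of `σ` cannot have a very
negative integral over a closed geodesic. -/
theorem exists_le_integral_conformalFactor [T2Space M] [CompactSpace M] [ConnectedSpace M]
    [MeasurableSpace M] [BorelSpace M] {σ : Metric M} (hσ : IsHyperbolic σ) {A : ℝ≥0}
    (hA : area σ = A) :
    ∃ C τ : ℝ, 0 < C ∧ 0 < τ ∧ ∀ (γ : ℝ → M) (T : ℝ), IsClosedGeodesic σ γ T → τ ≤ T ∧
      ∀ (u : M → ℝ) (g : Metric M), IsConformalFactor σ g u → IsNonpositivelyCurved g →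
        area g = A → -(C * (1 + T)) ≤ ∫ t in (0 : ℝ)..T, u (γ t) := by
  obtain ⟨C, τ, hC, hτ, h⟩ := exists_integral_closedGeodesic_le σ
  refine ⟨C, τ, hC, hτ, fun γ T hγ => ⟨(h γ T hγ).1, fun u g hc hg hgA => ?_⟩⟩
  obtain ⟨x₀, -, hx₀⟩ := isCompact_univ.exists_isMaxOn univ_nonempty
    hc.smooth.continuous.continuousOn
  replace hx₀ : ∀ x, u x ≤ u x₀ := fun x => hx₀ (mem_univ x)
  have hm := conformalFactor_bound_nonneg hc hA hgA hx₀
  have h1 := (h γ T hγ).2 _ (hc.isConformalDefect hσ hg hx₀)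
  have hcont : Continuous fun t => u (γ t) := hc.smooth.continuous.comp hγ.smooth.continuous
  rw [intervalIntegral.integral_sub intervalIntegrable_const (hcont.intervalIntegrable _ _),
    intervalIntegral.integral_const, sub_zero, smul_eq_mul] at h1
  have h2 := mul_nonneg hγ.period_pos.le hm
  linarith

/-- Jensen's inequality for the exponential function, in the form `e^c (1 + x - c) ≤ e^x` averaged
over an interval. -/
theorem mul_exp_average_le {f : ℝ → ℝ} (hf : Continuous f) {T : ℝ} (hT : 0 < T) :
    T * Real.exp ((∫ t in (0 : ℝ)..T, f t) / T) ≤ ∫ t in (0 : ℝ)..T, Real.exp (f t) := by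
  set c := (∫ t in (0 : ℝ)..T, f t) / T with hc
  have h1 : ∫ t in (0 : ℝ)..T, Real.exp c * (1 + (f t - c)) ≤ ∫ t in (0 : ℝ)..T, Real.exp (f t) := by
    refine intervalIntegral.integral_mono_on hT.le
      (Continuous.intervalIntegrable (by fun_prop) _ _)
      (Continuous.intervalIntegrable (by fun_prop) _ _) fun t _ => ?_
    have h2 := Real.add_one_le_exp (f t - c)
    calc Real.exp c * (1 + (f t - c)) ≤ Real.exp c * Real.exp (f t - c) := by
          gcongr; linarith
      _ = Real.exp (f t) := by rw [← Real.exp_add]; congr 1; ring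
  rw [intervalIntegral.integral_const_mul, intervalIntegral.integral_add intervalIntegrable_const
    ((hf.intervalIntegrable _ _).sub intervalIntegrable_const),
    intervalIntegral.integral_sub (hf.intervalIntegrable _ _) intervalIntegrable_const,
    intervalIntegral.integral_const, intervalIntegral.integral_const, sub_zero, smul_eq_mul,
    smul_eq_mul, hc, mul_div_cancel₀ _ hT.ne', sub_self, add_zero, mul_one, mul_comm] at h1
  exact h1

end ConformalSurface

end

theorem theoremC {M : Type*} [TopologicalSpace M] [ChartedSpace ConformalSurface.Plane M]
    [IsManifold (𝓡 2) ∞ M] [T2Space M] [CompactSpace M] [ConnectedSpace M]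
    [MeasurableSpace M] [BorelSpace M]
    (σ : ConformalSurface.Metric M) (hσ : ConformalSurface.IsHyperbolic σ)
    (A : ℝ≥0) (hA : ConformalSurface.area σ = A) :
    (∀ N : ℝ, 0 < N → ∃ ε : ℝ, 0 < ε ∧
      ∀ (γ : ℝ → M) (T : ℝ), ConformalSurface.IsClosedGeodesic σ γ T →
        ConformalSurface.length σ γ T ≤ N →
        ∀ g ∈ ConformalSurface.nonposConformalClass σ A,
          ε ≤ ConformalSurface.length g γ T) ∧
    (∃ K₄ : ℝ → ℝ, (∀ l, 0 < K₄ l) ∧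
      ∀ (γ : ℝ → M) (T : ℝ), ConformalSurface.IsClosedGeodesic σ γ T →
        ∀ (u : M → ℝ) (g : ConformalSurface.Metric M),
          ConformalSurface.IsConformalFactor σ g u →
          g ∈ ConformalSurface.nonposConformalClass σ A →
          -K₄ (ConformalSurface.length σ γ T) ≤ ConformalSurface.lineIntegral σ γ T u) := by
  obtain ⟨C, τ, hC, hτ, h⟩ := ConformalSurface.exists_le_integral_conformalFactor hσ hA
  refine ⟨fun N hN => ⟨τ * Real.exp (-(C * (1 + N) / τ)), by positivity, ?_⟩,
    fun l => C * (1 + |l|), fun l => by positivity, ?_⟩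
  · rintro γ T hγ hN g ⟨⟨u, hc⟩, hg, hgA⟩
    rw [hγ.length_eq] at hN
    obtain ⟨hτT, hu⟩ := h γ T hγ
    have h1 := hu u g hc hg hgA
    have hcont : Continuous fun t => u (γ t) := hc.smooth.continuous.comp hγ.smooth.continuous
    rw [hγ.length_conformal hc]
    refine le_trans ?_ (ConformalSurface.mul_exp_average_le hcont hγ.period_pos)
    have hT := hγ.period_pos
    gcongr
    calc -(C * (1 + N) / τ) ≤ -(C * (1 + T) / T) := by
          rw [neg_le_neg_iff]
          gcongr
      _ = -(C * (1 + T)) / T := by ring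
      _ ≤ _ := by gcongr
  · rintro γ T hγ u g hc ⟨-, hg, hgA⟩
    rw [hγ.length_eq, hγ.lineIntegral_eq]
    simp only [abs_of_pos hγ.period_pos]
    exact (h γ T hγ).2 u g hc hg hgA
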